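/- Let $1<p<\infty$, $m\ge 1$. Let $L^p_m$ and $H^p_m$ be the spaces of $m$-vectors of functions in $L^p$, respectively in the Hardy space $H^p$, of the unit circle $\mathbb T$. Let $\mathrm{Rat}_0^m(\mathbb T)$ be the space of $m$-vectors of strictly proper rational functions with poles only on $\mathbb T$, and let $\mathbb P$ be the Riesz projection of $L^p_m$ onto $H^p_m$. For $\Omega\in\mathrm{Rat}^{m\times m}$ (the rational $m\times m$ matrix functions, with poles on $\mathbb T$ allowed) with $\det\Omega\not\equiv0$, let $T_\Omega$ be the operator in $H^p_m$ given by $$\mathrm{Dom}(T_\Omega)=\{f\in H^p_m:\ \Omega f=h+\eta,\ h\in L^p_m,\ \eta\in\mathrm{Rat}_0^m(\mathbb T)\},\qquad T_\Omega f=\mathbb P h .$$ Suppose $\Omega$ has a Wiener–Hopf type factorization $\Omega=z^{-k}\Omega_-\Omega_0P_0\Omega_+$, that is, $k\ge0$ is an integer; $\Omega_-,\Omega_-^{-1}$ are rational matrix functions without poles outside the open unit disk, $\infty$ included; $\Omega_+,\Omega_+^{-1}$ are rational matrix functions without poles in the closed unit disk; $\Omega_0=\mathrm{diag}(\phi_1,\dots,\phi_m)$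 with rational functions $\phi_i=s_i/q_i$, where $s_i,q_i$ are coprime nonzero polynomials whose zeroes all lie on $\mathbb T$; and $P_0$ is a lower triangular matrix polynomial with $\det P_0(z)=z^N$ for some integer $N\ge0$. Write the middle factor as $$\Xi=z^{-k}\Omega_0P_0=z^{-k}\Big(\frac{p_{ij}}{q_i}\Big)_{i,j=1}^m,\qquad p_{ij}=s_i\,(P_0)_{ij},$$ and let $k_j=\deg p_{jj}$ (if $s_j$ is constant, then $p_{jj}$ is a nonzero constant times $z^{k_j}$). Suppose that the factorization is in special form: in each column of $\Xi$ the largest difference between the degree of the numerator and the degree of the denominator occurs on the diagonal, i.e. $$k_n-\deg q_n\ \ge\ \deg p_{jn}-\deg q_j\qquad(1\le n<j\le m),$$ where $\deg 0=-\infty$. Then $$\dim\mathrm{Ker}\,T_\Omega=\sum_{j=1}^m\max(k+\deg q_j-k_j,0),$$ and in fact $$\mathrm{Ker}\,T_\Xi=\bigoplus_{j=1}^m\mathcal P_{k+\deg q_j-k_j-1},$$ where $\mathcal P_n$ is the space of polynomials of degree at most $n$, and $\mathcal P_n=\{0\}$ for $n<0$. If in addition $\Omega$ has no zeroes on $\mathbb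 T$ (i.e. $\Omega^{-1}$ has no poles on $\mathbb T$), then $T_\Omega$ is Fredholm (closed, densely defined, with finite-dimensional kernel and closed range of finite codimension) and $$\mathrm{codim}\,\mathrm{Ran}\,T_\Omega=\sum_{j=1}^m\max(k_j-\deg q_j-k,0).$$ -/

import Mathlib

open MeasureTheory Filter Topology
open scoped ENNReal NNReal

namespace RatToeplitz

/-- The boundary variable: the point `z = e^{2π i t}` of the unit circle. -/
noncomputable def bdry (t : UnitAddCircle) : ℂ := (AddCircle.toCircle t : ℂ)

/-- Normalised Lebesgue measure on the unit circle. -/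
noncomputable abbrev circleMeasure : Measure UnitAddCircle := AddCircle.haarAddCircle

theorem continuous_bdry : Continuous bdry :=
  continuous_subtype_val.comp AddCircle.continuous_toCircle

theorem norm_bdry (t : UnitAddCircle) : ‖bdry t‖ = 1 := Circle.norm_coe _

theorem bdry_injective : Function.Injective bdry := fun _ _ h =>
  AddCircle.injective_toCircle one_ne_zero (Subtype.ext h)

theorem bdry_mul_fourier (n : ℤ) (t : UnitAddCircle) :
    bdry t * fourier n t = fourier (n + 1) t := by
  rw [fourier_add, fourier_one, mul_comm]; rfl

theorem integrable_poly_mul (P : Polynomial ℂ) {F : UnitAddCircle → ℂ}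
    (hF : Integrable F circleMeasure) :
    Integrable (fun t => P.eval (bdry t) * F t) circleMeasure := by
  have hc : Continuous fun t => P.eval (bdry t) := P.continuous.comp continuous_bdry
  obtain ⟨C, hC⟩ := isCompact_univ.exists_bound_of_continuousOn hc.continuousOn
  exact hF.bdd_mul (c := C) hc.aestronglyMeasurable (ae_of_all _ fun t => hC t trivial)

theorem integrable_of_continuous {u : UnitAddCircle → ℂ} (hu : Continuous u) :
    Integrable u circleMeasure := by
  obtain ⟨C, hC⟩ := isCompact_univ.exists_bound_of_continuousOn hu.continuousOn
  exact Integrable.of_bound hu.aestronglyMeasurable C (ae_of_all _ fun t => hC t trivial)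

theorem norm_fourierCoeff_le (F : UnitAddCircle → ℂ) (n : ℤ) :
    ‖fourierCoeff F n‖ ≤ ∫ t, ‖F t‖ ∂circleMeasure := by
  refine (norm_integral_le_integral_norm _).trans (le_of_eq ?_)
  refine integral_congr_ae (ae_of_all _ fun t => ?_)
  simp only [norm_smul, fourier_apply, Circle.norm_coe, one_mul]

theorem fourierCoeff_sub' {f g : UnitAddCircle → ℂ} (hf : Integrable f circleMeasure)
    (hg : Integrable g circleMeasure) (n : ℤ) :
    fourierCoeff (fun t => f t - g t) n = fourierCoeff f n - fourierCoeff g n := by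
  unfold fourierCoeff
  rw [← integral_sub (hf.fourier_smul _) (hg.fourier_smul _)]
  simp only [smul_sub]

theorem fourierCoeff_add' {f g : UnitAddCircle → ℂ} (hf : Integrable f circleMeasure)
    (hg : Integrable g circleMeasure) (n : ℤ) :
    fourierCoeff (fun t => f t + g t) n = fourierCoeff f n + fourierCoeff g n := by
  unfold fourierCoeff
  rw [← integral_add (hf.fourier_smul _) (hg.fourier_smul _)]
  simp only [smul_add]

theorem fourierCoeff_bdry_mul (F : UnitAddCircle → ℂ) (n : ℤ) :
    fourierCoeff (fun t => bdry t * F t) n = fourierCoeff F (n - 1) := by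
  unfold fourierCoeff
  refine integral_congr_ae (ae_of_all _ fun t => ?_)
  have := bdry_mul_fourier (-n) t
  simp only [smul_eq_mul]
  rw [show -(n - 1) = -n + 1 by ring, ← this]
  ring

theorem fourierCoeff_linear_mul (a : ℂ) {F : UnitAddCircle → ℂ}
    (hF : Integrable F circleMeasure) (n : ℤ) :
    fourierCoeff (fun t => (bdry t - a) * F t) n
      = fourierCoeff F (n - 1) - a * fourierCoeff F n := by
  have h1 : Integrable (fun t => bdry t * F t) circleMeasure := by
    simpa using integrable_poly_mul Polynomial.X hF
  have := fourierCoeff_sub' h1 (hF.const_mul a) n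
  rw [fourierCoeff_bdry_mul, fourierCoeff.const_mul] at this
  rw [← this]
  congr 1
  ext t; ring

/-- Riemann–Lebesgue lemma on the circle. -/
theorem tendsto_fourierCoeff {F : UnitAddCircle → ℂ} (hF : Integrable F circleMeasure) :
    Tendsto (fun n : ℤ => fourierCoeff F n) cofinite (𝓝 0) := by
  rw [Metric.tendsto_nhds]
  intro ε hε
  have hmem : (hF.toL1 F) ∈
      closure ((Submodule.span ℂ (Set.range (@fourierLp 1 _ 1 _)) :
        Submodule ℂ (Lp ℂ 1 circleMeasure)) : Set (Lp ℂ 1 circleMeasure)) := by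
    rw [← Submodule.topologicalClosure_coe, span_fourierLp_closure_eq_top (by simp)]; trivial
  obtain ⟨s, hs, hsd⟩ := Metric.mem_closure_iff.1 hmem ε hε
  have hint : ∀ x : Lp ℂ 1 circleMeasure, Integrable (x : UnitAddCircle → ℂ) circleMeasure :=
    fun x => L1.integrable_coeFn x
  have hfin : ∀ᶠ n : ℤ in cofinite, fourierCoeff (s : UnitAddCircle → ℂ) n = 0 := by
    clear hsd
    induction hs using Submodule.span_induction with
    | mem x hx =>
      obtain ⟨k, rfl⟩ := hx
      filter_upwards [(Set.finite_singleton k).compl_mem_cofinite] with n hn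
      rw [fourierCoeff_congr_ae (coeFn_fourierLp 1 k), fourierCoeff_fourier]
      simpa [Pi.single_apply] using hn
    | zero =>
      refine Eventually.of_forall fun n => ?_
      rw [fourierCoeff_congr_ae (Lp.coeFn_zero ℂ 1 circleMeasure)]
      simp [fourierCoeff]
    | add x y _ _ hx hy =>
      filter_upwards [hx, hy] with n hx hy
      rw [fourierCoeff_congr_ae (Lp.coeFn_add x y), fourierCoeff.add (hint x) (hint y)]
      simp [hx, hy]
    | smul c x _ hx =>
      filter_upwards [hx] with n hx
      rw [fourierCoeff_congr_ae (Lp.coeFn_smul c x)]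
      erw [fourierCoeff.const_smul]
      simp [hx]
  filter_upwards [hfin] with n hn
  have h1 := fourierCoeff_sub' hF (hint s) n
  rw [hn, sub_zero] at h1
  rw [dist_zero_right, ← h1]
  refine (norm_fourierCoeff_le _ n).trans_lt ?_
  rw [dist_eq_norm, L1.norm_eq_integral_norm] at hsd
  refine lt_of_eq_of_lt (integral_congr_ae ?_) hsd
  filter_upwards [Lp.coeFn_sub (hF.toL1 F) s, hF.coeFn_toL1] with t h2 h3
  rw [h2, Pi.sub_apply, h3]

/-- An integrable function all of whose Fourier coefficients vanish is zero almost everywhere. -/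
theorem ae_eq_zero_of_fourierCoeff {F : UnitAddCircle → ℂ} (hF : Integrable F circleMeasure)
    (h : ∀ n, fourierCoeff F n = 0) : F =ᵐ[circleMeasure] 0 := by
  have hb : ∀ φ : C(UnitAddCircle, ℂ), Integrable (fun t => φ t * F t) circleMeasure := fun φ =>
    hF.bdd_mul (c := ‖φ‖) φ.continuous.aestronglyMeasurable
      (ae_of_all _ fun t => φ.norm_coe_le_norm t)
  have hφ : ∀ φ : C(UnitAddCircle, ℂ), ∫ t, φ t * F t ∂circleMeasure = 0 := by
    intro φ
    have hspan : ∀ ψ ∈ Submodule.span ℂ (Set.range (@fourier 1)),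
        ∫ t, ψ t * F t ∂circleMeasure = 0 := by
      intro ψ hψ
      induction hψ using Submodule.span_induction with
      | mem x hx =>
        obtain ⟨k, rfl⟩ := hx
        have := h (-k)
        simpa only [fourierCoeff, neg_neg, smul_eq_mul] using this
      | zero => simp
      | add x y _ _ hx hy =>
        simp only [ContinuousMap.add_apply, add_mul]
        rw [integral_add (hb x) (hb y), hx, hy, add_zero]
      | smul c x _ hx =>
        simp only [ContinuousMap.smul_apply, smul_eq_mul, mul_assoc]
        rw [integral_const_mul, hx, mul_zero]
    have hmem : φ ∈ closure ((Submodule.span ℂ (Set.range (@fourier 1)) :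
        Submodule ℂ C(UnitAddCircle, ℂ)) : Set C(UnitAddCircle, ℂ)) := by
      rw [← Submodule.topologicalClosure_coe, span_fourier_closure_eq_top]; trivial
    by_contra hne
    have hpos : 0 < ‖∫ t, φ t * F t ∂circleMeasure‖ := norm_pos_iff.2 hne
    set M := ∫ t, ‖F t‖ ∂circleMeasure with hM
    have hM0 : 0 ≤ M := integral_nonneg fun _ => norm_nonneg _
    obtain ⟨ψ, hψ, hd⟩ := Metric.mem_closure_iff.1 hmem
      (‖∫ t, φ t * F t ∂circleMeasure‖ / (M + 1)) (by positivity)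
    have hkey : ∫ t, φ t * F t ∂circleMeasure = ∫ t, (φ - ψ) t * F t ∂circleMeasure := by
      simp only [ContinuousMap.sub_apply, sub_mul]
      rw [integral_sub (hb φ) (hb ψ), hspan ψ hψ, sub_zero]
    have hle : ‖∫ t, φ t * F t ∂circleMeasure‖ ≤ ‖φ - ψ‖ * M := by
      rw [hkey, hM, ← integral_const_mul]
      refine (norm_integral_le_integral_norm _).trans (integral_mono (hb _).norm
        (hF.norm.const_mul _) fun t => ?_)
      simp only [norm_mul]
      exact mul_le_mul_of_nonneg_right ((φ - ψ).norm_coe_le_norm t) (norm_nonneg _)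
    rw [dist_eq_norm, lt_div_iff₀ (by positivity)] at hd
    nlinarith [norm_nonneg (φ - ψ)]
  refine ae_eq_zero_of_forall_setIntegral_isClosed_eq_zero hF fun s hs => ?_
  have hδ : ∀ n : ℕ, (0 : ℝ) < 1 / ((n : ℝ) + 1) := fun n => Nat.one_div_pos_of_nat
  let ψ : ℕ → C(UnitAddCircle, ℂ) := fun n =>
    ⟨fun t => (((thickenedIndicator (hδ n) s t : ℝ≥0) : ℝ) : ℂ), by fun_prop⟩
  have hlim : Tendsto (fun n => ∫ t, ψ n t * F t ∂circleMeasure) atTop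
      (𝓝 (∫ t, s.indicator F t ∂circleMeasure)) := by
    refine tendsto_integral_of_dominated_convergence (fun t => ‖F t‖)
      (fun n => (hb (ψ n)).aestronglyMeasurable) hF.norm (fun n => ae_of_all _ fun t => ?_)
      (ae_of_all _ fun t => ?_)
    · rw [norm_mul]
      refine mul_le_of_le_one_left (norm_nonneg _) ?_
      have := thickenedIndicator_le_one (hδ n) s t
      simpa [ψ] using this
    · have h1 := tendsto_pi_nhds.1 (thickenedIndicator_tendsto_indicator_closure hδ
        tendsto_one_div_add_atTop_nhds_zero_nat s) t
      rw [hs.closure_eq] at h1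
      have h2 : Tendsto (fun n => ψ n t) atTop
          (𝓝 (((s.indicator (fun _ => (1 : ℝ≥0)) t : ℝ≥0) : ℝ) : ℂ)) :=
        (Complex.continuous_ofReal.tendsto _).comp ((NNReal.continuous_coe.tendsto _).comp h1)
      convert! h2.mul_const (F t) using 2
      by_cases ht : t ∈ s <;> simp [ht]
  simp only [hφ] at hlim
  rw [← integral_indicator hs.measurableSet]
  exact (tendsto_nhds_unique hlim tendsto_const_nhds)

/-- Downward recursion: no negative coefficients can appear when dividing by `z - a`, `1 ≤ |a|`. -/
theorem coeff_neg_of_mul {H : UnitAddCircle → ℂ} (hH : Integrable H circleMeasure) {a : ℂ}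
    (ha : 1 ≤ ‖a‖)
    (h : ∀ n < 0, fourierCoeff (fun t => (bdry t - a) * H t) n = 0) :
    ∀ n < 0, fourierCoeff H n = 0 := by
  intro n hn
  have hrec : ∀ j : ℕ, fourierCoeff H (n - j) = a ^ j * fourierCoeff H n := by
    intro j
    induction j with
    | zero => simp
    | succ j ih =>
      have := h (n - j) (by omega)
      rw [fourierCoeff_linear_mul a hH, sub_eq_zero] at this
      rw [show n - ((j + 1 : ℕ) : ℤ) = n - j - 1 by push_cast; ring, this, ih]; ring
  have hlim : Tendsto (fun j : ℕ => ‖fourierCoeff H (n - j)‖) atTop (𝓝 0) := by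
    have hinj : Function.Injective fun j : ℕ => n - (j : ℤ) := fun i j hij => by
      simp only [sub_right_inj, Nat.cast_inj] at hij; exact hij
    have := (tendsto_fourierCoeff hH).comp hinj.tendsto_cofinite
    rw [Nat.cofinite_eq_atTop] at this
    simpa using this.norm
  have hge : ∀ j : ℕ, ‖fourierCoeff H n‖ ≤ ‖fourierCoeff H (n - j)‖ := fun j => by
    rw [hrec, norm_mul, norm_pow]
    exact le_mul_of_one_le_left (norm_nonneg _) (one_le_pow₀ ha)
  exact norm_le_zero_iff.1 (ge_of_tendsto' hlim hge)

/-- Upward recursion, for `|a| ≤ 1`. -/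
theorem coeff_ge_of_mul {H : UnitAddCircle → ℂ} (hH : Integrable H circleMeasure) {a : ℂ}
    (ha : ‖a‖ ≤ 1) (N : ℤ)
    (h : ∀ n ≥ N, fourierCoeff (fun t => (bdry t - a) * H t) n = 0) :
    ∀ n ≥ N - 1, fourierCoeff H n = 0 := by
  intro n hn
  have hrec : ∀ j : ℕ, fourierCoeff H n = a ^ j * fourierCoeff H (n + j) := by
    intro j
    induction j with
    | zero => simp
    | succ j ih =>
      have := h (n + j + 1) (by omega)
      rw [fourierCoeff_linear_mul a hH, sub_eq_zero, add_sub_cancel_right] at this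
      rw [ih, this, show n + ((j + 1 : ℕ) : ℤ) = n + j + 1 by push_cast; ring]; ring
  have hlim : Tendsto (fun j : ℕ => ‖fourierCoeff H (n + j)‖) atTop (𝓝 0) := by
    have hinj : Function.Injective fun j : ℕ => n + (j : ℤ) := fun i j hij => by
      simp only [add_right_inj, Nat.cast_inj] at hij; exact hij
    have := (tendsto_fourierCoeff hH).comp hinj.tendsto_cofinite
    rw [Nat.cofinite_eq_atTop] at this
    simpa using this.norm
  have hge : ∀ j : ℕ, ‖fourierCoeff H n‖ ≤ ‖fourierCoeff H (n + j)‖ := fun j => by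
    rw [hrec j, norm_mul, norm_pow]
    exact mul_le_of_le_one_left (norm_nonneg _) (pow_le_one₀ (norm_nonneg _) ha)
  exact norm_le_zero_iff.1 (ge_of_tendsto' hlim hge)

theorem fourierCoeff_const (c : ℂ) (n : ℤ) :
    fourierCoeff (fun _ : UnitAddCircle => c) n = if n = 0 then c else 0 := by
  have h1 := fourierCoeff.const_mul (T := 1) (fourier 0) c n
  simp only [fourier_zero, mul_one] at h1
  rw [h1, fourierCoeff_fourier (T := 1) 0, Pi.single_apply]
  simp

/-- Division by `z - a`, `|a| < 1`, of a function whose anti-analytic part is continuous. -/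
theorem exists_antianalytic_part_step {a : ℂ} (ha : ‖a‖ < 1) {h : UnitAddCircle → ℂ}
    (hh : Integrable h circleMeasure) {u : UnitAddCircle → ℂ} (hu : Continuous u)
    (hu0 : ∀ n ≥ 0, fourierCoeff u n = 0)
    (huh : ∀ n < 0, fourierCoeff u n = fourierCoeff (fun t => (bdry t - a) * h t) n) :
    ∃ v : UnitAddCircle → ℂ, Continuous v ∧ (∀ n ≥ 0, fourierCoeff v n = 0) ∧
      ∀ n < 0, fourierCoeff v n = fourierCoeff h n := by
  have hne : ∀ t, bdry t - a ≠ 0 := fun t ht => by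
    rw [sub_eq_zero] at ht
    rw [← ht, norm_bdry] at ha
    exact lt_irrefl _ ha
  obtain ⟨c, hc⟩ : ∃ c, c = fourierCoeff h (-1) := ⟨_, rfl⟩
  obtain ⟨v, hv⟩ : ∃ v : UnitAddCircle → ℂ, v = fun t => (u t + c) / (bdry t - a) := ⟨_, rfl⟩
  have hvc : Continuous v := by
    rw [hv]
    exact (hu.add continuous_const).div (continuous_bdry.sub continuous_const) hne
  have hvi := integrable_of_continuous hvc
  have hrec : ∀ n, fourierCoeff v (n - 1) - a * fourierCoeff v n
      = fourierCoeff u n + if n = 0 then c else 0 := by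
    intro n
    rw [← fourierCoeff_linear_mul a hvi, ← fourierCoeff_const c n,
      ← fourierCoeff_add' (integrable_of_continuous hu) (integrable_of_continuous
        continuous_const)]
    congr 1; ext t
    rw [hv]; exact mul_div_cancel₀ _ (hne t)
  have hv0 : ∀ n ≥ 0, fourierCoeff v n = 0 := by
    have := coeff_ge_of_mul hvi ha.le 1 (fun n hn => by
      rw [fourierCoeff_linear_mul a hvi, hrec, hu0 n (by omega), if_neg (by omega), add_zero])
    simpa using this
  refine ⟨v, hvc, hv0, ?_⟩
  have hind : ∀ j : ℕ, fourierCoeff v (-1 - j) = fourierCoeff h (-1 - j) := by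
    intro j
    induction j with
    | zero =>
      have := hrec 0
      rw [hv0 0 le_rfl, hu0 0 le_rfl] at this
      simpa [hc] using this
    | succ j ihj =>
      have h1 := hrec (-1 - j)
      rw [if_neg (by omega), huh _ (by omega), fourierCoeff_linear_mul a hh, ihj, add_zero,
        sub_left_inj] at h1
      rw [show -1 - ((j + 1 : ℕ) : ℤ) = -1 - j - 1 by push_cast; ring, h1]
  intro n hn
  have := hind (-1 - n).toNat
  rwa [Int.toNat_of_nonneg (by omega), sub_sub_cancel] at this

theorem eval_prod_cons (a : ℂ) (s : Multiset ℂ) (w : ℂ) :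
    (((a ::ₘ s).map fun a => Polynomial.X - Polynomial.C a).prod).eval w
      = (w - a) * ((s.map fun a => Polynomial.X - Polynomial.C a).prod).eval w := by
  simp only [Multiset.map_cons, Multiset.prod_cons, Polynomial.eval_mul, Polynomial.eval_sub,
    Polynomial.eval_X, Polynomial.eval_C]

/-- If a nonzero polynomial multiple of `h` is analytic, the anti-analytic part of `h` is a
continuous function. -/
theorem exists_antianalytic_part (s : Multiset ℂ) : ∀ {h : UnitAddCircle → ℂ},
    Integrable h circleMeasure →
    (∀ n < 0, fourierCoeff
      (fun t => ((s.map fun a => Polynomial.X - Polynomial.C a).prod).eval (bdry t) * h t) n = 0) →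
    ∃ u : UnitAddCircle → ℂ, Continuous u ∧ (∀ n ≥ 0, fourierCoeff u n = 0) ∧
      ∀ n < 0, fourierCoeff u n = fourierCoeff h n := by
  induction s using Multiset.induction_on with
  | empty =>
    intro h hh h0
    refine ⟨0, continuous_zero, fun n _ => by simp [fourierCoeff], fun n hn => ?_⟩
    have := h0 n hn
    simp only [Multiset.map_zero, Multiset.prod_zero, Polynomial.eval_one, one_mul] at this
    rw [this]; simp [fourierCoeff]
  | cons a s ih =>
    intro h hh h0
    simp only [eval_prod_cons] at h0
    obtain ⟨P, hP⟩ : ∃ P, P = (s.map fun a => Polynomial.X - Polynomial.C a).prod := ⟨_, rfl⟩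
    rw [← hP] at h0
    rw [← hP] at ih
    rcases le_or_gt 1 ‖a‖ with ha | ha
    · have e : (fun t => (bdry t - a) * (P.eval (bdry t) * h t))
          = fun t => (bdry t - a) * P.eval (bdry t) * h t := funext fun t => by ring
      refine ih hh (coeff_neg_of_mul (H := fun t => P.eval (bdry t) * h t)
        (integrable_poly_mul P hh) ha ?_)
      rw [e]; exact h0
    · have e : (fun t => P.eval (bdry t) * ((bdry t - a) * h t))
          = fun t => (bdry t - a) * P.eval (bdry t) * h t := funext fun t => by ring
      have hh' : Integrable (fun t => (bdry t - a) * h t) circleMeasure := by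
        have h1 := integrable_poly_mul (Polynomial.X - Polynomial.C a) hh
        simp only [Polynomial.eval_sub, Polynomial.eval_X, Polynomial.eval_C] at h1
        exact h1
      obtain ⟨u, hu, hu0, huh⟩ := ih hh' (by rw [e]; exact h0)
      exact exists_antianalytic_part_step ha hh hu hu0 huh

theorem fourierCoeff_eq_zero_of_support (s : Multiset ℂ) (hs : ∀ a ∈ s, ‖a‖ = 1) :
    ∀ {h : UnitAddCircle → ℂ}, Integrable h circleMeasure →
    (∀ n : ℤ, (n < 0 ∨ (Multiset.card s : ℤ) ≤ n) → fourierCoeff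
      (fun t => ((s.map fun a => Polynomial.X - Polynomial.C a).prod).eval (bdry t) * h t) n = 0) →
    ∀ n, fourierCoeff h n = 0 := by
  induction s using Multiset.induction_on with
  | empty =>
    intro h hh h0 n
    have := h0 n (by simp; omega)
    simpa using this
  | cons a s ih =>
    intro h hh h0
    have ha : ‖a‖ = 1 := hs a (Multiset.mem_cons_self a s)
    have hH := integrable_poly_mul (s.map fun a => Polynomial.X - Polynomial.C a).prod hh
    have hmul : ∀ n : ℤ, (n < 0 ∨ (Multiset.card s : ℤ) + 1 ≤ n) →
        fourierCoeff (fun t => (bdry t - a) *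
          ((s.map fun a => Polynomial.X - Polynomial.C a).prod.eval (bdry t) * h t)) n = 0 := by
      intro n hn
      rw [← h0 n (by simpa using hn)]
      congr 1; ext t
      rw [eval_prod_cons, mul_assoc]
    refine ih (fun b hb => hs b (Multiset.mem_cons_of_mem hb)) hh ?_
    rintro n (hn | hn)
    · exact coeff_neg_of_mul hH ha.ge (fun n hn => hmul n (Or.inl hn)) n hn
    · exact coeff_ge_of_mul hH ha.le (Multiset.card s + 1) (fun n hn => hmul n (Or.inr hn)) n
        (by omega)

theorem ae_eval_ne_zero {d : Polynomial ℂ} (hd : d ≠ 0) :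
    ∀ᵐ t ∂circleMeasure, d.eval (bdry t) ≠ 0 := by
  have hfin : {t | ¬ d.eval (bdry t) ≠ 0}.Finite := by
    refine ((d.rootSet_finite ℂ).preimage bdry_injective.injOn).subset fun t ht => ?_
    simp only [ne_eq, not_not, Set.mem_ofPred_eq] at ht
    simp [Polynomial.mem_rootSet, hd, ht]
  have : NullSingletonClass circleMeasure := ⟨fun x => by
    have h1 := AddCircle.volume_closedBall (T := 1) (x := x) 0
    have h2 := AddCircle.volume_eq_smul_haarAddCircle (T := 1)
    rw [ENNReal.ofReal_one, one_smul] at h2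
    rw [Metric.closedBall_zero, h2] at h1
    simpa using h1⟩
  exact hfin.measure_zero circleMeasure

theorem fourierCoeff_pow_mul (k : ℕ) (F : UnitAddCircle → ℂ) (n : ℤ) :
    fourierCoeff (fun t => bdry t ^ k * F t) n = fourierCoeff F (n - k) := by
  induction k generalizing n with
  | zero => simp
  | succ k ih =>
    have e : (fun t => bdry t ^ (k + 1) * F t) = fun t => bdry t * (bdry t ^ k * F t) :=
      funext fun t => by ring
    rw [e, fourierCoeff_bdry_mul, ih]
    congr 1; push_cast; ring

/-- Integrable functions on the circle without negative Fourier coefficients. -/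
def Analytic (F : UnitAddCircle → ℂ) : Prop :=
  Integrable F circleMeasure ∧ ∀ n < 0, fourierCoeff F n = 0

theorem Analytic.congr {F G : UnitAddCircle → ℂ} (hF : Analytic F) (h : F =ᵐ[circleMeasure] G) :
    Analytic G :=
  ⟨hF.1.congr h, fun n hn => by rw [← fourierCoeff_congr_ae h]; exact hF.2 n hn⟩

theorem Analytic.add {F G : UnitAddCircle → ℂ} (hF : Analytic F) (hG : Analytic G) :
    Analytic (fun t => F t + G t) :=
  ⟨hF.1.add hG.1, fun n hn => by
    rw [fourierCoeff_add' hF.1 hG.1, hF.2 n hn, hG.2 n hn, add_zero]⟩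

theorem Analytic.poly_mul {F : UnitAddCircle → ℂ} (hF : Analytic F) (P : Polynomial ℂ) :
    Analytic (fun t => P.eval (bdry t) * F t) := by
  induction P using Polynomial.induction_on' with
  | add P Q hP hQ =>
    have := hP.add hQ
    simpa only [Polynomial.eval_add, add_mul] using this
  | monomial k c =>
    refine ⟨integrable_poly_mul _ hF.1, fun n hn => ?_⟩
    simp only [Polynomial.eval_monomial, mul_assoc]
    rw [fourierCoeff.const_mul, fourierCoeff_pow_mul, hF.2 _ (by omega), mul_zero]

theorem fourierCoeff_poly (P : Polynomial ℂ) (n : ℤ)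
    (hn : n < 0 ∨ (P.degree < (n.toNat : WithBot ℕ))) :
    fourierCoeff (fun t => P.eval (bdry t)) n = 0 := by
  have h1 : Integrable (fun _ : UnitAddCircle => (1 : ℂ)) circleMeasure := integrable_const _
  have e : (fun t => P.eval (bdry t)) = fun t =>
      ∑ k ∈ P.support, P.coeff k * (bdry t ^ k * (1 : ℂ)) := by
    funext t
    rw [Polynomial.eval_eq_sum, Polynomial.sum_def]
    simp only [mul_one]
  have hi : ∀ k ∈ P.support,
      Integrable (fun t => P.coeff k * (bdry t ^ k * (1 : ℂ))) circleMeasure := fun k _ => by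
    have := integrable_poly_mul (Polynomial.monomial k (P.coeff k)) h1
    simpa only [Polynomial.eval_monomial, mul_assoc] using this
  have e2 := congrFun (fourierCoeff.sum P.support
    (fun k t => P.coeff k * (bdry t ^ k * (1 : ℂ))) hi) n
  rw [e]
  have e3 : (fun t => ∑ k ∈ P.support, P.coeff k * (bdry t ^ k * (1 : ℂ)))
      = ∑ k ∈ P.support, fun t => P.coeff k * (bdry t ^ k * (1 : ℂ)) := by
    funext t; rw [Finset.sum_apply]
  rw [e3, e2, Finset.sum_apply]
  refine Finset.sum_eq_zero fun k hk => ?_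
  rw [fourierCoeff.const_mul, fourierCoeff_pow_mul, fourierCoeff_const, if_neg, mul_zero]
  intro h0
  rcases hn with hn | hn
  · omega
  · have hk' : n.toNat = k := by omega
    rw [hk'] at hn
    exact (Polynomial.mem_support_iff.1 hk) (Polynomial.coeff_eq_zero_of_degree_lt hn)

/-- Boundary values of a rational function (off its finitely many poles on the circle). -/
noncomputable def ratVal (r : RatFunc ℂ) (t : UnitAddCircle) : ℂ :=
  r.eval (RingHom.id ℂ) (bdry t)

theorem ratVal_mul_denom (r : RatFunc ℂ) :
    ∀ᵐ t ∂circleMeasure, r.denom.eval (bdry t) * ratVal r t = r.num.eval (bdry t) := by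
  filter_upwards [ae_eval_ne_zero r.denom_ne_zero] with t ht
  simp only [ratVal, RatFunc.eval, Polynomial.eval₂_id]
  exact mul_div_cancel₀ _ ht

theorem ratVal_add (r s : RatFunc ℂ) :
    ∀ᵐ t ∂circleMeasure, ratVal (r + s) t = ratVal r t + ratVal s t := by
  filter_upwards [ae_eval_ne_zero r.denom_ne_zero, ae_eval_ne_zero s.denom_ne_zero] with t hr hs
  exact RatFunc.eval_add (f := RingHom.id ℂ) (a := bdry t) (by simpa using hr) (by simpa using hs)

theorem ratVal_C_mul (c : ℂ) (r : RatFunc ℂ) :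
    ∀ᵐ t ∂circleMeasure, ratVal (RatFunc.C c * r) t = c * ratVal r t := by
  filter_upwards [ae_eval_ne_zero r.denom_ne_zero] with t hr
  have := RatFunc.eval_mul (f := RingHom.id ℂ) (a := bdry t) (x := RatFunc.C c) (y := r)
    (by simp) (by simpa using hr)
  simpa [ratVal] using this

/-- `Rat₀(𝕋)`: strictly proper rational functions with poles only on the unit circle. -/
def IsRatZero (r : RatFunc ℂ) : Prop :=
  (∀ z : ℂ, r.denom.IsRoot z → ‖z‖ = 1) ∧ r.num.degree < r.denom.degree

theorem IsRatZero.add {r s : RatFunc ℂ} (hr : IsRatZero r) (hs : IsRatZero s) :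
    IsRatZero (r + s) := by
  refine ⟨fun z hz => ?_, ?_⟩
  · have : (r.denom * s.denom).IsRoot z := hz.dvd (RatFunc.denom_add_dvd r s)
    rcases Polynomial.root_mul.1 this with h | h
    exacts [hr.1 z h, hs.1 z h]
  · have key := congrArg Polynomial.degree (RatFunc.num_denom_add r s)
    have h1 := Polynomial.degree_add_le (r.num * s.denom) (r.denom * s.num)
    have hlt : (r.num * s.denom + r.denom * s.num).degree < (r.denom * s.denom).degree := by
      refine h1.trans_lt (max_lt ?_ ?_)
      · rw [Polynomial.degree_mul, Polynomial.degree_mul]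
        exact WithBot.add_lt_add_right
          (Polynomial.degree_eq_bot.not.2 s.denom_ne_zero) hr.2
      · rw [Polynomial.degree_mul, Polynomial.degree_mul]
        exact WithBot.add_lt_add_left
          (Polynomial.degree_eq_bot.not.2 r.denom_ne_zero) hs.2
    have hne : (r.denom * s.denom).degree ≠ ⊥ := Polynomial.degree_eq_bot.not.2
      (mul_ne_zero r.denom_ne_zero s.denom_ne_zero)
    by_contra hcon
    rw [not_lt] at hcon
    rw [Polynomial.degree_mul, Polynomial.degree_mul (p := r.num * s.denom + r.denom * s.num)]
      at key
    have h2 := WithBot.add_lt_add_right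
      (Polynomial.degree_eq_bot.not.2 (r + s).denom_ne_zero) hlt
    rw [← key, add_comm] at h2
    exact absurd (add_le_add_left hcon (r.denom * s.denom).degree) (by simpa [add_comm] using h2.not_ge)

theorem IsRatZero.C_mul (c : ℂ) {r : RatFunc ℂ} (hr : IsRatZero r) :
    IsRatZero (RatFunc.C c * r) := by
  refine ⟨fun z hz => ?_, ?_⟩
  · have h : (RatFunc.C c * r).denom ∣ r.denom := by
      have := RatFunc.denom_mul_dvd (RatFunc.C c) r
      rwa [RatFunc.denom_C, one_mul] at this
    exact hr.1 z (hz.dvd h)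
  · have key := congrArg Polynomial.degree (RatFunc.num_denom_mul (RatFunc.C c) r)
    rw [RatFunc.denom_C, RatFunc.num_C, one_mul] at key
    have hlt : (Polynomial.C c * r.num).degree < r.denom.degree :=
      by
      rw [← Polynomial.smul_eq_C_mul]
      exact (Polynomial.degree_smul_le c r.num).trans_lt hr.2
    by_contra hcon
    rw [not_lt] at hcon
    rw [Polynomial.degree_mul, Polynomial.degree_mul (p := Polynomial.C c * r.num)] at key
    have h2 := WithBot.add_lt_add_right
      (Polynomial.degree_eq_bot.not.2 (RatFunc.C c * r).denom_ne_zero) hlt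
    rw [← key, add_comm] at h2
    exact h2.not_ge (add_le_add_right hcon _)


/-- The strictly proper rational functions with poles on the circle meet `L¹` trivially. -/
theorem fourierCoeff_eq_zero_of_ratVal {δ : RatFunc ℂ} (hδ : IsRatZero δ)
    {h : UnitAddCircle → ℂ} (hh : Integrable h circleMeasure)
    (he : ∀ᵐ t ∂circleMeasure, h t = ratVal δ t) (n : ℤ) : fourierCoeff h n = 0 := by
  have hq : (δ.denom.roots.map fun a => Polynomial.X - Polynomial.C a).prod = δ.denom :=
    ((IsAlgClosed.splits δ.denom).eq_prod_roots_of_monic δ.monic_denom).symm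
  refine fourierCoeff_eq_zero_of_support δ.denom.roots (fun a ha => hδ.1 a
    (Polynomial.isRoot_of_mem_roots ha)) hh (fun n hn => ?_) n
  have hc : (fun t => δ.denom.eval (bdry t) * h t) =ᵐ[circleMeasure]
      fun t => δ.num.eval (bdry t) := by
    filter_upwards [he, ratVal_mul_denom δ] with t h1 h2
    rw [h1, h2]
  rw [hq, fourierCoeff_congr_ae hc]
  refine fourierCoeff_poly _ n (hn.imp_right fun hn => hδ.2.trans_le ?_)
  rw [← (IsAlgClosed.splits δ.denom).natDegree_eq_card_roots] at hn
  rw [Polynomial.degree_eq_natDegree δ.denom_ne_zero]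
  have : δ.denom.natDegree ≤ n.toNat := by omega
  exact_mod_cast this

section Operator

variable (p : ℝ≥0∞) [Fact (1 ≤ p)] {m : ℕ}

theorem integrable_Lp (f : Lp ℂ p circleMeasure) : Integrable f circleMeasure :=
  (Lp.memLp f).integrable Fact.out

/-- The Hardy space `H^p` of the circle: `L^p` functions without negative Fourier coefficients. -/
noncomputable def Hp : Submodule ℂ (Lp ℂ p circleMeasure) where
  carrier := {f | ∀ n < 0, fourierCoeff f n = 0}
  zero_mem' := fun n _ => by
    rw [fourierCoeff_congr_ae (Lp.coeFn_zero ℂ p circleMeasure)]; simp [fourierCoeff]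
  add_mem' := fun {f g} hf hg n hn => by
    rw [fourierCoeff_congr_ae (Lp.coeFn_add f g),
      fourierCoeff.add (integrable_Lp p f) (integrable_Lp p g), Pi.add_apply, hf n hn, hg n hn,
      add_zero]
  smul_mem' := fun c f hf n hn => by
    rw [fourierCoeff_congr_ae (Lp.coeFn_smul c f)]
    erw [fourierCoeff.const_smul]
    rw [hf n hn, smul_zero]

variable {p}

/-- `g ∈ H^p` is the Riesz projection of `h ∈ L^p`: both have the same Fourier coefficients of
index `n ≥ 0`. -/
def IsRieszProj (h : Lp ℂ p circleMeasure) (g : Hp p) : Prop :=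
  ∀ n ≥ 0, fourierCoeff (g : Lp ℂ p circleMeasure) n = fourierCoeff h n

theorem IsRieszProj.add {h h' : Lp ℂ p circleMeasure} {g g' : Hp p} (H : IsRieszProj h g)
    (H' : IsRieszProj h' g') : IsRieszProj (h + h') (g + g') := fun n hn => by
  rw [Submodule.coe_add, fourierCoeff_congr_ae (Lp.coeFn_add _ _),
    fourierCoeff_congr_ae (Lp.coeFn_add h h'),
    fourierCoeff.add (integrable_Lp p _) (integrable_Lp p _),
    fourierCoeff.add (integrable_Lp p _) (integrable_Lp p _), Pi.add_apply, Pi.add_apply,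
    H n hn, H' n hn]

theorem IsRieszProj.smul (c : ℂ) {h : Lp ℂ p circleMeasure} {g : Hp p} (H : IsRieszProj h g) :
    IsRieszProj (c • h) (c • g) := fun n hn => by
  rw [Submodule.coe_smul, fourierCoeff_congr_ae (Lp.coeFn_smul c _),
    fourierCoeff_congr_ae (Lp.coeFn_smul c h)]
  erw [fourierCoeff.const_smul, fourierCoeff.const_smul]
  rw [H n hn]

/-- `Ω f = h + η` almost everywhere on the circle, with `h ∈ L^p_m` and `η ∈ Rat₀^m(𝕋)`. -/
def IsDecomp (Ω : Matrix (Fin m) (Fin m) (RatFunc ℂ)) (f : Fin m → Hp p)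
    (h : Fin m → Lp ℂ p circleMeasure) (η : Fin m → RatFunc ℂ) : Prop :=
  (∀ i, IsRatZero (η i)) ∧ ∀ i, ∀ᵐ t ∂circleMeasure,
    ∑ j, ratVal (Ω i j) t * (f j : Lp ℂ p circleMeasure) t = h i t + ratVal (η i) t

theorem IsDecomp.add {Ω : Matrix (Fin m) (Fin m) (RatFunc ℂ)} {f f' : Fin m → Hp p}
    {h h' : Fin m → Lp ℂ p circleMeasure} {η η' : Fin m → RatFunc ℂ} (H : IsDecomp Ω f h η)
    (H' : IsDecomp Ω f' h' η') : IsDecomp Ω (f + f') (h + h') (η + η') := by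
  refine ⟨fun i => (H.1 i).add (H'.1 i), fun i => ?_⟩
  have hf : ∀ᵐ t ∂circleMeasure, ∀ j, (f j + f' j : Hp p).1 t
      = (f j : Lp ℂ p circleMeasure) t + (f' j : Lp ℂ p circleMeasure) t :=
    ae_all_iff.2 fun j => Lp.coeFn_add _ _
  filter_upwards [H.2 i, H'.2 i, hf, Lp.coeFn_add (h i) (h' i), ratVal_add (η i) (η' i)]
    with t h1 h2 h3 h4 h5
  simp only [Pi.add_apply, h3, mul_add, Finset.sum_add_distrib, h1, h2, h4, h5]
  ring

theorem IsDecomp.smul {Ω : Matrix (Fin m) (Fin m) (RatFunc ℂ)} (c : ℂ) {f : Fin m → Hp p}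
    {h : Fin m → Lp ℂ p circleMeasure} {η : Fin m → RatFunc ℂ} (H : IsDecomp Ω f h η) :
    IsDecomp Ω (c • f) (c • h) (fun i => RatFunc.C c * η i) := by
  refine ⟨fun i => (H.1 i).C_mul c, fun i => ?_⟩
  have hf : ∀ᵐ t ∂circleMeasure, ∀ j, (c • f j : Hp p).1 t
      = c * (f j : Lp ℂ p circleMeasure) t :=
    ae_all_iff.2 fun j => Lp.coeFn_smul c _
  filter_upwards [H.2 i, hf, Lp.coeFn_smul c (h i), ratVal_C_mul c (η i)] with t h1 h3 h4 h5
  simp only [Pi.smul_apply, h3, h4, h5, smul_eq_mul, ← mul_add, ← h1, Finset.mul_sum]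
  exact Finset.sum_congr rfl fun j _ => by ring

theorem isDecomp_zero (Ω : Matrix (Fin m) (Fin m) (RatFunc ℂ)) :
    IsDecomp Ω (0 : Fin m → Hp p) 0 0 := by
  refine ⟨fun i => ⟨fun z hz => ?_, ?_⟩, fun i => ?_⟩
  · simp at hz
  · simp
  · filter_upwards [Lp.coeFn_zero ℂ p circleMeasure] with t ht
    simp [ratVal]

/-- The value of `T_Ω` does not depend on the decomposition. -/
theorem toeplitz_value_unique {Ω : Matrix (Fin m) (Fin m) (RatFunc ℂ)} {f g g' : Fin m → Hp p}
    {h h' : Fin m → Lp ℂ p circleMeasure} {η η' : Fin m → RatFunc ℂ} (H : IsDecomp Ω f h η)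
    (H' : IsDecomp Ω f h' η') (hg : ∀ i, IsRieszProj (h i) (g i))
    (hg' : ∀ i, IsRieszProj (h' i) (g' i)) : g = g' := by
  funext i
  have hδ : IsRatZero (η' i + RatFunc.C (-1) * η i) := (H'.1 i).add ((H.1 i).C_mul _)
  have he : ∀ᵐ t ∂circleMeasure, h i t - h' i t = ratVal (η' i + RatFunc.C (-1) * η i) t := by
    filter_upwards [H.2 i, H'.2 i, ratVal_add (η' i) (RatFunc.C (-1) * η i),
      ratVal_C_mul (-1) (η i)] with t h1 h2 h3 h4
    rw [h3, h4]
    linear_combination h2 - h1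
  have hc : ∀ n, fourierCoeff (h i) n = fourierCoeff (h' i) n := fun n => by
    have := fourierCoeff_eq_zero_of_ratVal hδ ((integrable_Lp p (h i)).sub (integrable_Lp p (h' i)))
      he n
    rw [← sub_eq_zero, ← fourierCoeff_sub' (integrable_Lp p _) (integrable_Lp p _)]
    exact this
  have hG : ((g i : Lp ℂ p circleMeasure) : UnitAddCircle → ℂ) =ᵐ[circleMeasure]
      (g' i : Lp ℂ p circleMeasure) := by
    have := ae_eq_zero_of_fourierCoeff ((integrable_Lp p (g i : Lp ℂ p circleMeasure)).sub
      (integrable_Lp p (g' i : Lp ℂ p circleMeasure))) (fun n => by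
        have h1 := fourierCoeff_sub' (integrable_Lp p (g i : Lp ℂ p circleMeasure))
          (integrable_Lp p (g' i : Lp ℂ p circleMeasure)) n
        refine Eq.trans h1 ?_
        rcases lt_or_ge n 0 with hn | hn
        · rw [(g i).2 n hn, (g' i).2 n hn, sub_zero]
        · rw [hg i n hn, hg' i n hn, hc, sub_self])
    filter_upwards [this] with t ht
    exact sub_eq_zero.1 ht
  exact Subtype.ext (Lp.ext hG)

theorem exists_poly_analytic {ι : Type*} (s : Finset ι) (r : ι → RatFunc ℂ) (f : ι → Hp p) :
    ∃ D : Polynomial ℂ, D ≠ 0 ∧ Analytic (fun t => D.eval (bdry t) *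
      ∑ j ∈ s, ratVal (r j) t * (f j : Lp ℂ p circleMeasure) t) := by
  classical
  induction s using Finset.induction_on with
  | empty => exact ⟨1, one_ne_zero, by simp [Analytic, fourierCoeff]⟩
  | insert a s ha ih =>
    obtain ⟨D, hD, hA⟩ := ih
    refine ⟨(r a).denom * D, mul_ne_zero (r a).denom_ne_zero hD, ?_⟩
    have hfa : Analytic (f a : Lp ℂ p circleMeasure) := ⟨integrable_Lp p _, (f a).2⟩
    refine ((hA.poly_mul (r a).denom).add (hfa.poly_mul (D * (r a).num))).congr ?_
    filter_upwards [ratVal_mul_denom (r a)] with t ht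
    rw [Finset.sum_insert ha, Polynomial.eval_mul, Polynomial.eval_mul, ← ht]
    ring

theorem exists_rieszProj {Ω : Matrix (Fin m) (Fin m) (RatFunc ℂ)} {f : Fin m → Hp p}
    {h : Fin m → Lp ℂ p circleMeasure} {η : Fin m → RatFunc ℂ} (H : IsDecomp Ω f h η) :
    ∃ g : Fin m → Hp p, ∀ i, IsRieszProj (h i) (g i) := by
  suffices ∀ i, ∃ g : Hp p, IsRieszProj (h i) g from Classical.axiomOfChoice this
  intro i
  obtain ⟨D, hD, hA⟩ := exists_poly_analytic Finset.univ (Ω i) f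
  have h1 : Analytic (fun _ => (1 : ℂ)) := ⟨integrable_const _, fun n hn => by
    rw [fourierCoeff_const, if_neg hn.ne]⟩
  set E := (η i).denom * D with hE
  have hE0 : E ≠ 0 := mul_ne_zero (η i).denom_ne_zero hD
  have hEh : Analytic (fun t => E.eval (bdry t) * h i t) := by
    refine ((hA.poly_mul (η i).denom).add (h1.poly_mul (-(D * (η i).num)))).congr ?_
    filter_upwards [H.2 i, ratVal_mul_denom (η i)] with t h2 h3
    rw [h2, Polynomial.eval_neg, Polynomial.eval_mul, hE, Polynomial.eval_mul, ← h3]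
    ring
  have hfac := (IsAlgClosed.splits E).eq_prod_roots
  obtain ⟨Q, hQ⟩ : ∃ Q, Q = (E.roots.map fun a => Polynomial.X - Polynomial.C a).prod := ⟨_, rfl⟩
  have hlead : E.leadingCoeff ≠ 0 := Polynomial.leadingCoeff_ne_zero.2 hE0
  have hQh : Analytic (fun t => Q.eval (bdry t) * h i t) := by
    refine (hEh.poly_mul (Polynomial.C E.leadingCoeff⁻¹)).congr (ae_of_all _ fun t => ?_)
    have : E.eval (bdry t) = E.leadingCoeff * Q.eval (bdry t) := by
      conv_lhs => rw [hfac, ← hQ, Polynomial.eval_mul, Polynomial.eval_C]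
    simp only [Polynomial.eval_C, this]
    field_simp
  rw [hQ] at hQh
  obtain ⟨u, huc, hu0, huh⟩ := exists_antianalytic_part E.roots (integrable_Lp p (h i)) hQh.2
  let U : Lp ℂ p circleMeasure := ContinuousMap.toLp p circleMeasure ℂ ⟨u, huc⟩
  have hU : (U : UnitAddCircle → ℂ) =ᵐ[circleMeasure] u :=
    ContinuousMap.coeFn_toLp circleMeasure (⟨u, huc⟩ : C(UnitAddCircle, ℂ))
  have hdiff : ∀ n, fourierCoeff ((h i - U : Lp ℂ p circleMeasure)) n
      = fourierCoeff (h i) n - fourierCoeff u n := fun n => by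
    rw [fourierCoeff_congr_ae (Lp.coeFn_sub (h i) U), ← fourierCoeff_congr_ae hU]
    exact fourierCoeff_sub' (integrable_Lp p _) (integrable_Lp p _) n
  exact ⟨⟨h i - U, fun n hn => by rw [hdiff, huh n hn, sub_self]⟩, fun n hn => by
    show fourierCoeff ((h i - U : Lp ℂ p circleMeasure)) n = _
    rw [hdiff, hu0 n hn, sub_zero]⟩

/-- `Dom(T_Ω)`: the `f ∈ H^p_m` such that `Ω f = h + η` with `h ∈ L^p_m`, `η ∈ Rat₀^m(𝕋)`. -/
noncomputable def toeplitzDomain (p : ℝ≥0∞) [Fact (1 ≤ p)]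
    (Ω : Matrix (Fin m) (Fin m) (RatFunc ℂ)) : Submodule ℂ (Fin m → Hp p) where
  carrier := {f | ∃ h η, IsDecomp Ω f h η}
  zero_mem' := ⟨0, 0, isDecomp_zero Ω⟩
  add_mem' := fun ⟨_, _, H⟩ ⟨_, _, H'⟩ => ⟨_, _, H.add H'⟩
  smul_mem' := fun c _ ⟨_, _, H⟩ => ⟨_, _, H.smul c⟩

/-- `g` is a value of `T_Ω` at `f`: `Ω f = h + η` as above and `g` is the Riesz projection of `h`. -/
def IsToeplitzValue (Ω : Matrix (Fin m) (Fin m) (RatFunc ℂ)) (f g : Fin m → Hp p) : Prop :=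
  ∃ h η, IsDecomp Ω f h η ∧ ∀ i, IsRieszProj (h i) (g i)

theorem exists_toeplitzValue {Ω : Matrix (Fin m) (Fin m) (RatFunc ℂ)}
    (f : toeplitzDomain p Ω) : ∃ g, IsToeplitzValue Ω (f : Fin m → Hp p) g := by
  obtain ⟨h, η, H⟩ := f.2
  obtain ⟨g, hg⟩ := exists_rieszProj H
  exact ⟨g, h, η, H, hg⟩

theorem IsToeplitzValue.unique {Ω : Matrix (Fin m) (Fin m) (RatFunc ℂ)} {f g g' : Fin m → Hp p}
    (hg : IsToeplitzValue Ω f g) (hg' : IsToeplitzValue Ω f g') : g = g' := by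
  obtain ⟨_, _, H, hP⟩ := hg
  obtain ⟨_, _, H', hP'⟩ := hg'
  exact toeplitz_value_unique H H' hP hP'

/-- The Toeplitz-like operator `T_Ω (H^p_m → H^p_m)`, `T_Ω f = ℙ h` where `Ω f = h + η`. -/
noncomputable def toeplitz (p : ℝ≥0∞) [Fact (1 ≤ p)]
    (Ω : Matrix (Fin m) (Fin m) (RatFunc ℂ)) : (Fin m → Hp p) →ₗ.[ℂ] (Fin m → Hp p) where
  domain := toeplitzDomain p Ω
  toFun :=
    { toFun := fun f => (exists_toeplitzValue f).choose
      map_add' := fun f f' => by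
        obtain ⟨_, _, H, hP⟩ := (exists_toeplitzValue f).choose_spec
        obtain ⟨_, _, H', hP'⟩ := (exists_toeplitzValue f').choose_spec
        exact (exists_toeplitzValue (f + f')).choose_spec.unique
          ⟨_, _, H.add H', fun i => (hP i).add (hP' i)⟩
      map_smul' := fun c f => by
        obtain ⟨_, _, H, hP⟩ := (exists_toeplitzValue f).choose_spec
        exact (exists_toeplitzValue (c • f)).choose_spec.unique
          ⟨_, _, H.smul c, fun i => (hP i).smul c⟩ }

theorem toeplitz_isToeplitzValue (Ω : Matrix (Fin m) (Fin m) (RatFunc ℂ))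
    (f : (toeplitz p Ω).domain) :
    IsToeplitzValue Ω (f : Fin m → Hp p) (toeplitz p Ω f) :=
  (exists_toeplitzValue (p := p) (Ω := Ω) f).choose_spec

end Operator

section Fredholm

/-- The kernel of an unbounded operator, as a subspace of the ambient space. -/
def opKer {E F : Type*} [AddCommGroup E] [Module ℂ E] [AddCommGroup F] [Module ℂ F]
    (T : E →ₗ.[ℂ] F) : Submodule ℂ E := (LinearMap.ker T.toFun).map T.domain.subtype

/-- The range of an unbounded operator. -/
def opRan {E F : Type*} [AddCommGroup E] [Module ℂ E] [AddCommGroup F] [Module ℂ F]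
    (T : E →ₗ.[ℂ] F) : Submodule ℂ F := LinearMap.range T.toFun

variable {E F : Type*} [NormedAddCommGroup E] [NormedSpace ℂ E] [NormedAddCommGroup F]
  [NormedSpace ℂ F]

/-- Fredholm unbounded operators: densely defined, closed, with finite-dimensional kernel and closed
range of finite codimension. -/
structure IsFredholm (T : E →ₗ.[ℂ] F) : Prop where
  dense_domain : Dense (T.domain : Set E)
  isClosed : T.IsClosed
  finite_ker : FiniteDimensional ℂ (opKer T)
  isClosed_ran : IsClosed (opRan T : Set F)
  finite_coker : FiniteDimensional ℂ (F ⧸ opRan T)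

end Fredholm

/-- The subspace `𝒫_n ⊆ H^p` of polynomials of degree at most `n`; it is `{0}` for `n < 0`. -/
noncomputable def polySpace (p : ℝ≥0∞) [Fact (1 ≤ p)] (n : ℤ) : Submodule ℂ (Hp p) where
  carrier := {f | ∃ P : Polynomial ℂ, (∀ i : ℕ, n < i → P.coeff i = 0) ∧
    ∀ᵐ t ∂circleMeasure, (f : Lp ℂ p circleMeasure) t = P.eval (bdry t)}
  zero_mem' := ⟨0, by simp, by
    filter_upwards [Lp.coeFn_zero ℂ p circleMeasure] with t ht
    rw [Polynomial.eval_zero]; exact ht⟩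
  add_mem' := by
    rintro f g ⟨P, hP, hf⟩ ⟨Q, hQ, hg⟩
    refine ⟨P + Q, fun i hi => by simp [hP i hi, hQ i hi], ?_⟩
    filter_upwards [hf, hg, Lp.coeFn_add (f : Lp ℂ p circleMeasure) g] with t h1 h2 h3
    rw [Submodule.coe_add, h3, Pi.add_apply, h1, h2, Polynomial.eval_add]
  smul_mem' := by
    rintro c f ⟨P, hP, hf⟩
    refine ⟨c • P, fun i hi => by simp [hP i hi], ?_⟩
    filter_upwards [hf, Lp.coeFn_smul c (f : Lp ℂ p circleMeasure)] with t h1 h3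
    rw [Submodule.coe_smul, h3, Pi.smul_apply, h1, Polynomial.eval_smul]

section Factorization

variable {m : ℕ}

/-- No pole of the rational matrix function `Ω` lies in the set `S ⊆ ℂ`. -/
def NoPolesOn (Ω : Matrix (Fin m) (Fin m) (RatFunc ℂ)) (S : Set ℂ) : Prop :=
  ∀ i j, ∀ z ∈ S, (Ω i j).denom.eval z ≠ 0

/-- Plus functions: no poles in the closed unit disk. -/
def IsPlus (Ω : Matrix (Fin m) (Fin m) (RatFunc ℂ)) : Prop := NoPolesOn Ω {z | ‖z‖ ≤ 1}

/-- Minus functions: no poles outside the open unit disk, the point at infinity included. -/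
def IsMinus (Ω : Matrix (Fin m) (Fin m) (RatFunc ℂ)) : Prop :=
  NoPolesOn Ω {z | 1 ≤ ‖z‖} ∧ ∀ i j, (Ω i j).num.degree ≤ (Ω i j).denom.degree

/-- `Ω` has no zeroes on the unit circle: `Ω⁻¹` has no poles there. -/
def NoZerosOnCircle (Ω : Matrix (Fin m) (Fin m) (RatFunc ℂ)) : Prop :=
  NoPolesOn Ω⁻¹ {z | ‖z‖ = 1}

/-- Wiener–Hopf type factorizations `Ω = z^{-k} Ω₋ Ω₀ P₀ Ω₊`, with `Ω₀ = diag (φ_j)`. -/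
structure WienerHopfFactorization (Ω : Matrix (Fin m) (Fin m) (RatFunc ℂ)) where
  /-- the exponent `k ≥ 0` -/
  k : ℕ
  /-- the factor `Ω₋` -/
  minus : Matrix (Fin m) (Fin m) (RatFunc ℂ)
  /-- the diagonal entries `φ_j` of `Ω₀` -/
  φ : Fin m → RatFunc ℂ
  /-- the polynomial factor `P₀` -/
  P₀ : Matrix (Fin m) (Fin m) (Polynomial ℂ)
  /-- the factor `Ω₊` -/
  plus : Matrix (Fin m) (Fin m) (RatFunc ℂ)
  factorization : Ω = (RatFunc.X⁻¹ ^ k : RatFunc ℂ) • (minus * Matrix.diagonal φ *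
    P₀.map (algebraMap (Polynomial ℂ) (RatFunc ℂ)) * plus)
  minus_isUnit : IsUnit minus
  minus_isMinus : IsMinus minus
  minus_inv_isMinus : IsMinus minus⁻¹
  plus_isUnit : IsUnit plus
  plus_isPlus : IsPlus plus
  plus_inv_isPlus : IsPlus plus⁻¹
  /-- the zeroes of `φ_j` lie on the circle (in particular `φ_j ≠ 0`) -/
  φ_zeros : ∀ j, ∀ z : ℂ, (φ j).num.IsRoot z → ‖z‖ = 1
  /-- the poles of `φ_j` lie on the circle -/
  φ_poles : ∀ j, ∀ z : ℂ, (φ j).denom.IsRoot z → ‖z‖ = 1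
  P₀_lower : ∀ i j, i < j → P₀ i j = 0
  P₀_det : ∃ N : ℕ, P₀.det = Polynomial.X ^ N

namespace WienerHopfFactorization

variable {Ω : Matrix (Fin m) (Fin m) (RatFunc ℂ)} (W : WienerHopfFactorization Ω)

/-- The middle factor `Ξ = z^{-k} Ω₀ P₀`. -/
noncomputable def middle : Matrix (Fin m) (Fin m) (RatFunc ℂ) :=
  (RatFunc.X⁻¹ ^ W.k : RatFunc ℂ) • (Matrix.diagonal W.φ *
    W.P₀.map (algebraMap (Polynomial ℂ) (RatFunc ℂ)))

/-- The denominator `q_i` of the `i`-th row of `z^k Ξ`. -/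
noncomputable def q (i : Fin m) : Polynomial ℂ := (W.φ i).denom

/-- The numerators `p_ij` in `z^k Ξ = (p_ij / q_i)`. -/
noncomputable def num (i j : Fin m) : Polynomial ℂ := (W.φ i).num * W.P₀ i j

/-- `k_j`, the degree of the diagonal numerator `p_jj`. When the `φ_j` have no zeroes, `p_jj` is a
nonzero constant times `z^{k_j}`. -/
noncomputable def kk (j : Fin m) : ℕ := (W.num j j).natDegree

theorem middle_apply (i j : Fin m) : W.middle i j = RatFunc.X⁻¹ ^ W.k *
    (algebraMap (Polynomial ℂ) (RatFunc ℂ) (W.num i j) /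
      algebraMap (Polynomial ℂ) (RatFunc ℂ) (W.q i)) := by
  rw [middle, Matrix.smul_apply, Matrix.diagonal_mul, Matrix.map_apply, smul_eq_mul, num, q,
    map_mul, mul_div_right_comm, RatFunc.num_div_denom]

/-- The factorization is in special form: in each column of `Ξ` the largest difference between the
degree of the numerator and that of the denominator occurs on the diagonal; zero entries, with
numerator of degree `-∞`, give no condition. -/
def SpecialForm : Prop :=
  ∀ n j : Fin m, n < j → W.num j n ≠ 0 →
    ((W.num j n).natDegree : ℤ) - (W.q j).natDegree ≤ (W.kk n : ℤ) - (W.q n).natDegree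

end WienerHopfFactorization

end Factorization

end RatToeplitz

/-! Everything is reduced to one algebraic criterion: `T_Ω f = g` exactly when every component of `Ω
f - g` is a strictly proper rational function with all poles in the closed unit disk
(`isToeplitzValue_iff`). In one direction, the part of `h` killed by the Riesz projection has an
analytic polynomial multiple, so it is rational (`mem_strictBdry_of_degLT`). In the other, a
strictly proper function is split into a part with poles on the circle, which becomes `η`, and a
part with poles inside, which the projection annihilates.

These strictly proper functions form a module over the ring `properDisk` of proper rational
functions with poles in the closed disk, so a matrix invertible over that ring may be cancelled
(`mulVec_mem_strictBdry_iff`). `Ω₋` is such a matrix. The special form supplies another: `Ξ = M D`,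
with `D` the diagonal of `Ξ` and `M` unipotent lower triangular, and the degree condition says
precisely that `M` has proper entries. Hence `Ω = (Ω₋ M) D Ω₊`. The kernel condition decouples into
scalar problems for the components of `Ω₊ f`, solved by polynomials of bounded degree
(`div_mul_incl_mem_strictBdry_iff`); `Ω₊` itself is a bijection of `H^p_m`.

If `Ω` has no zeroes on the circle, all `s_j` are constant and `p_jj = c z^{k_j}`. Multiplying the
`i`-th component of `D Ω₊ f - (Ω₋ M)⁻¹ g` by `q_i` gives `A f - B g` with `A` and `B` free of poles
on the circle. The relation `T_Ω f = g` then says that the Fourier coefficients of `(A f)_i` and `(B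
g)_i` agree from index `deg q_i` on (`isToeplitzValue_iff_coeff`). These are continuous conditions,
so the graph is closed. As `(A f)_i = c z^{k_i - k} F_i` with `F = Ω₊ f` arbitrary, the range is cut
out by the coefficients of `(B g)_i` with index in `[deg q_i, k_i - k)`. These functionals take
arbitrary values (`exists_coeff_eq`), which gives the codimension. The domain is dense because it
contains all polynomial vectors. -/

namespace RatToeplitz

/-! ### Rational functions: order at infinity, location of poles, partial fractions. -/

section Rational

open Polynomial WithZero

/-- The order at infinity of rational functions, as a valuation. -/
noncomputable def inftyVal : Valuation (RatFunc ℂ) (WithZero (Multiplicative ℤ)) := by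
  classical exact RatFunc.inftyValuation ℂ

theorem inftyVal_of_ne_zero {r : RatFunc ℂ} (hr : r ≠ 0) : inftyVal r = exp r.intDegree := by
  classical
  exact RatFunc.inftyValuation_of_nonzero ℂ hr

theorem inftyVal_algebraMap {u : ℂ[X]} (hu : u ≠ 0) :
    inftyVal (algebraMap ℂ[X] (RatFunc ℂ) u) = exp (u.natDegree : ℤ) := by
  rw [inftyVal_of_ne_zero (by simpa using hu), RatFunc.intDegree_polynomial]

theorem algebraMap_ne_zero {u : ℂ[X]} (hu : u ≠ 0) : algebraMap ℂ[X] (RatFunc ℂ) u ≠ 0 := by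
  simpa using hu

theorem inftyVal_div {u v : ℂ[X]} (hu : u ≠ 0) (hv : v ≠ 0) :
    inftyVal (algebraMap ℂ[X] (RatFunc ℂ) u / algebraMap ℂ[X] (RatFunc ℂ) v)
      = exp ((u.natDegree : ℤ) - v.natDegree) := by
  rw [map_div₀, inftyVal_algebraMap hu, inftyVal_algebraMap hv, exp_sub]

theorem inftyVal_div_lt_one {u v : ℂ[X]} (hv : v ≠ 0) :
    inftyVal (algebraMap ℂ[X] (RatFunc ℂ) u / algebraMap ℂ[X] (RatFunc ℂ) v) < 1
      ↔ u.degree < v.degree := by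
  rcases eq_or_ne u 0 with rfl | hu
  · simp [bot_lt_iff_ne_bot, hv]
  rw [inftyVal_div hu hv, ← exp_zero, exp_lt_exp, degree_eq_natDegree hu, degree_eq_natDegree hv,
    Nat.cast_lt]
  omega

theorem inftyVal_div_le_one {u v : ℂ[X]} (hv : v ≠ 0) :
    inftyVal (algebraMap ℂ[X] (RatFunc ℂ) u / algebraMap ℂ[X] (RatFunc ℂ) v) ≤ 1
      ↔ u.degree ≤ v.degree := by
  rcases eq_or_ne u 0 with rfl | hu
  · simp
  rw [inftyVal_div hu hv, ← exp_zero, exp_le_exp, degree_eq_natDegree hu, degree_eq_natDegree hv,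
    Nat.cast_le]
  omega

theorem inftyVal_lt_one_iff (r : RatFunc ℂ) : inftyVal r < 1 ↔ r.num.degree < r.denom.degree := by
  rw [← inftyVal_div_lt_one r.denom_ne_zero, RatFunc.num_div_denom]

theorem inftyVal_le_one_iff (r : RatFunc ℂ) : inftyVal r ≤ 1 ↔ r.num.degree ≤ r.denom.degree := by
  rw [← inftyVal_div_le_one r.denom_ne_zero, RatFunc.num_div_denom]

/-- The rational functions all of whose (finite) poles lie in `S`. -/
noncomputable def polesIn (S : Set ℂ) : Subalgebra ℂ[X] (RatFunc ℂ) where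
  carrier := {r | ∀ z, r.denom.IsRoot z → z ∈ S}
  mul_mem' := fun {r s} hr hs z hz =>
    (root_mul.1 (hz.dvd (RatFunc.denom_mul_dvd r s))).elim (hr z) (hs z)
  add_mem' := fun {r s} hr hs z hz =>
    (root_mul.1 (hz.dvd (RatFunc.denom_add_dvd r s))).elim (hr z) (hs z)
  algebraMap_mem' := fun u z hz => by simp [RatFunc.denom_algebraMap] at hz

theorem polesIn_mono {S T : Set ℂ} (h : S ⊆ T) {r : RatFunc ℂ} (hr : r ∈ polesIn S) :
    r ∈ polesIn T := fun z hz => h (hr z hz)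

theorem algebraMap_mem_polesIn (S : Set ℂ) (u : ℂ[X]) :
    algebraMap ℂ[X] (RatFunc ℂ) u ∈ polesIn S := (polesIn S).algebraMap_mem u

/-- The reduced denominator divides `v`, so fractions need not be in lowest terms for their poles to
be located. -/
theorem inv_mem_polesIn {S : Set ℂ} {v : ℂ[X]} (h : ∀ z, v.IsRoot z → z ∈ S) :
    (algebraMap ℂ[X] (RatFunc ℂ) v)⁻¹ ∈ polesIn S := fun z hz => by
  refine h z (hz.dvd ?_)
  have := RatFunc.denom_div_dvd (K := ℂ) 1 v
  rwa [map_one, one_div] at this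

theorem div_mem_polesIn {S : Set ℂ} (u : ℂ[X]) {v : ℂ[X]}
    (h : ∀ z, v.IsRoot z → z ∈ S) :
    algebraMap ℂ[X] (RatFunc ℂ) u / algebraMap ℂ[X] (RatFunc ℂ) v ∈ polesIn S := by
  rw [div_eq_mul_inv]
  exact mul_mem (algebraMap_mem_polesIn S u) (inv_mem_polesIn h)

theorem sep_roots_prod_isRoot {d : ℂ[X]} (S : Set ℂ) [DecidablePred (· ∈ S)] (hd : d ≠ 0) {z : ℂ} :
    ((d.roots.filter (· ∈ S)).map fun a => X - C a).prod.IsRoot z ↔ z ∈ S ∧ d.IsRoot z := by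
  rw [← mem_roots (Multiset.prod_ne_zero (by simp [X_sub_C_ne_zero])),
    roots_multiset_prod_X_sub_C, Multiset.mem_filter, mem_roots hd, and_comm]

/-- Partial fractions: separation of the poles inside and outside `S`. -/
theorem exists_separation (S : Set ℂ) (r : RatFunc ℂ) : ∃ r₁ r₂, r = r₁ + r₂ ∧
    r₁ ∈ polesIn Sᶜ ∧ r₂ ∈ polesIn S ∧ inftyVal r₂ < 1 ∧
    ∀ T, r ∈ polesIn T → r₁ ∈ polesIn T ∧ r₂ ∈ polesIn T := by
  classical
  have hd := r.denom_ne_zero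
  set d₁ := ((r.denom.roots.filter (· ∈ Sᶜ)).map fun a => X - C a).prod with hd₁
  set d₂ := ((r.denom.roots.filter (· ∈ S)).map fun a => X - C a).prod with hd₂
  have h₁0 : d₁ ≠ 0 := Multiset.prod_ne_zero (by simp [X_sub_C_ne_zero])
  have h₂m : d₂.Monic := monic_multiset_prod_of_monic _ _ fun a _ => monic_X_sub_C a
  have h₂0 : d₂ ≠ 0 := h₂m.ne_zero
  have r₁ : ∀ z, d₁.IsRoot z ↔ z ∈ Sᶜ ∧ r.denom.IsRoot z := fun z => sep_roots_prod_isRoot _ hd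
  have r₂ : ∀ z, d₂.IsRoot z ↔ z ∈ S ∧ r.denom.IsRoot z := fun z => sep_roots_prod_isRoot _ hd
  have hprod : r.denom = d₁ * d₂ := by
    rw [hd₁, hd₂, ← Multiset.prod_add, ← Multiset.map_add, add_comm]
    simp only [Set.mem_compl_iff]
    rw [Multiset.filter_add_not]
    exact (IsAlgClosed.splits r.denom).eq_prod_roots_of_monic r.monic_denom
  -- A common irreducible factor would have a root lying both in `S` and in its complement.
  obtain ⟨a, b, hab⟩ : IsCoprime d₁ d₂ := by
    refine _root_.isCoprime_of_irreducible_dvd (by tauto) ?_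
    intro q hq h1 h2
    obtain ⟨z, hz⟩ := IsAlgClosed.exists_root q hq.degree_pos.ne'
    exact ((r₁ z).1 (hz.dvd h1)).1 ((r₂ z).1 (hz.dvd h2)).1
  have e₁ := algebraMap_ne_zero h₁0
  have e₂ := algebraMap_ne_zero h₂0
  -- From `a d₁ + b d₂ = 1`, the function is `num * b / d₁ + num * a / d₂`. The polynomial part of
  -- the second fraction is moved to the first summand, so that the second becomes strictly proper.
  refine ⟨algebraMap _ _ (r.num * b) / algebraMap _ _ d₁ + algebraMap _ _ ((r.num * a) /ₘ d₂),
    algebraMap _ _ ((r.num * a) %ₘ d₂) / algebraMap _ _ d₂, ?_, ?_, ?_, ?_, ?_⟩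
  · conv_lhs => rw [← RatFunc.num_div_denom r, hprod]
    have hm := congrArg (algebraMap ℂ[X] (RatFunc ℂ)) (modByMonic_add_div (r.num * a) d₂)
    have hab' := congrArg (algebraMap ℂ[X] (RatFunc ℂ)) hab
    simp only [map_add, map_mul, map_one] at hm hab' ⊢
    field_simp
    linear_combination (-(algebraMap ℂ[X] (RatFunc ℂ) r.num)) * hab' -
      (algebraMap ℂ[X] (RatFunc ℂ) d₁) * hm
  · exact add_mem (div_mem_polesIn _ fun z hz => ((r₁ z).1 hz).1) (algebraMap_mem_polesIn _ _)
  · exact div_mem_polesIn _ fun z hz => ((r₂ z).1 hz).1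
  · rw [inftyVal_div_lt_one h₂0]
    exact degree_modByMonic_lt _ h₂m
  · intro T hT
    exact ⟨add_mem (div_mem_polesIn _ fun z hz => hT z ((r₁ z).1 hz).2)
      (algebraMap_mem_polesIn _ _), div_mem_polesIn _ fun z hz => hT z ((r₂ z).1 hz).2⟩

/-- Proper rational functions with poles in the closed unit disk. -/
noncomputable def properDisk : Subring (RatFunc ℂ) :=
  inftyVal.integer ⊓ (polesIn {z | ‖z‖ ≤ 1}).toSubring

theorem mem_properDisk {r : RatFunc ℂ} :
    r ∈ properDisk ↔ inftyVal r ≤ 1 ∧ r ∈ polesIn {z | ‖z‖ ≤ 1} := Iff.rfl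

/-- Strictly proper rational functions with poles in the closed unit disk. -/
noncomputable def strictDisk : AddSubgroup (RatFunc ℂ) where
  carrier := {r | inftyVal r < 1 ∧ r ∈ polesIn {z | ‖z‖ ≤ 1}}
  zero_mem' := ⟨by simp, zero_mem _⟩
  add_mem' := fun hr hs => ⟨inftyVal.map_add_lt hr.1 hs.1, add_mem hr.2 hs.2⟩
  neg_mem' := fun hr => ⟨by rw [Valuation.map_neg]; exact hr.1, neg_mem hr.2⟩

/-- This module structure is what allows matrices invertible over `properDisk` to be removed from
the kernel and range conditions. -/
theorem mul_mem_strictDisk {r s : RatFunc ℂ} (hr : r ∈ properDisk) (hs : s ∈ strictDisk) :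
    r * s ∈ strictDisk :=
  ⟨by rw [map_mul]; exact (mul_le_of_le_one_left' hr.1).trans_lt hs.1, mul_mem hr.2 hs.2⟩

theorem isRatZero_iff {r : RatFunc ℂ} :
    IsRatZero r ↔ inftyVal r < 1 ∧ r ∈ polesIn {z | ‖z‖ = 1} := by
  rw [IsRatZero, inftyVal_lt_one_iff, and_comm]; rfl

end Rational

/-! ### Boundary values, Fourier coefficients and division by polynomials. -/

section Boundary

open Polynomial

/-- Measurable functions on the unit circle modulo almost everywhere equality. -/
abbrev BoundaryFun := UnitAddCircle →ₘ[circleMeasure] ℂ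

/-- With a ring of functions as target, boundary values form a ring homomorphism, and identities
between rational matrices transfer to the circle by pure algebra. -/
noncomputable instance : CommRing BoundaryFun :=
  { (inferInstance : AddCommGroup BoundaryFun), (inferInstance : CommMonoid BoundaryFun) with
    left_distrib := fun x y z => AEEqFun.induction_on₃ x y z fun _ _ _ _ _ _ => by
      simp only [AEEqFun.mk_add_mk, AEEqFun.mk_mul_mk, mul_add]
    right_distrib := fun x y z => AEEqFun.induction_on₃ x y z fun _ _ _ _ _ _ => by
      simp only [AEEqFun.mk_add_mk, AEEqFun.mk_mul_mk, add_mul]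
    zero_mul := fun x => AEEqFun.induction_on x fun _ _ => by
      simp only [AEEqFun.zero_def, AEEqFun.mk_mul_mk]
      exact AEEqFun.mk_eq_mk.2 (ae_of_all _ fun _ => zero_mul _)
    mul_zero := fun x => AEEqFun.induction_on x fun _ _ => by
      simp only [AEEqFun.zero_def, AEEqFun.mk_mul_mk]
      exact AEEqFun.mk_eq_mk.2 (ae_of_all _ fun _ => mul_zero _) }

/-- A ring homomorphism from a field to a nontrivial ring is injective; this is all that
`boundary_injective` needs. -/
instance : Nontrivial BoundaryFun := ⟨0, 1, fun h => by
  have h1 := AEEqFun.mk_eq_mk.1 h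
  obtain ⟨t, ht⟩ := h1.exists
  exact zero_ne_one ht⟩

theorem ratVal_eq (r : RatFunc ℂ) :
    ratVal r = fun t => r.num.eval (bdry t) / r.denom.eval (bdry t) := by
  funext t
  simp only [ratVal, RatFunc.eval, eval₂_id]

theorem measurable_ratVal (r : RatFunc ℂ) : Measurable (ratVal r) := by
  rw [ratVal_eq]
  exact (r.num.continuous.comp continuous_bdry).measurable.div
    (r.denom.continuous.comp continuous_bdry).measurable

/-- Boundary values of rational functions, as a ring homomorphism. -/
noncomputable def boundary : RatFunc ℂ →+* BoundaryFun where
  toFun r := AEEqFun.mk (ratVal r) (measurable_ratVal r).aestronglyMeasurable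
  map_one' := AEEqFun.mk_eq_mk.2 (ae_of_all _ fun t => by simp [ratVal])
  map_zero' := AEEqFun.mk_eq_mk.2 (ae_of_all _ fun t => by simp [ratVal])
  map_add' r s := by
    rw [AEEqFun.mk_add_mk]
    exact AEEqFun.mk_eq_mk.2 (ratVal_add r s)
  map_mul' r s := by
    rw [AEEqFun.mk_mul_mk]
    refine AEEqFun.mk_eq_mk.2 ?_
    filter_upwards [ae_eval_ne_zero r.denom_ne_zero, ae_eval_ne_zero s.denom_ne_zero] with t hr hs
    exact RatFunc.eval_mul (f := RingHom.id ℂ) (a := bdry t) (by simpa using hr)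
      (by simpa using hs)

theorem coeFn_boundary (r : RatFunc ℂ) : boundary r =ᵐ[circleMeasure] ratVal r :=
  AEEqFun.coeFn_mk _ _

/-- Boundary values of polynomials. -/
noncomputable abbrev bpoly (u : ℂ[X]) : BoundaryFun := boundary (algebraMap ℂ[X] (RatFunc ℂ) u)

theorem coeFn_bpoly (u : ℂ[X]) : bpoly u =ᵐ[circleMeasure] fun t => u.eval (bdry t) := by
  filter_upwards [coeFn_boundary (algebraMap ℂ[X] (RatFunc ℂ) u)] with t ht
  rw [ht, ratVal, RatFunc.eval_algebraMap]
  simp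

theorem coeFn_bpoly_mul (u : ℂ[X]) (x : BoundaryFun) :
    (bpoly u * x : BoundaryFun) =ᵐ[circleMeasure] fun t => u.eval (bdry t) * x t := by
  filter_upwards [AEEqFun.coeFn_mul (bpoly u) x, coeFn_bpoly u] with t h1 h2
  rw [h1, Pi.mul_apply, h2]

theorem boundary_injective : Function.Injective boundary := boundary.injective

/-- The integrable functions on the circle whose Fourier coefficients of index `≥ N` vanish. -/
def DegLT (x : BoundaryFun) (N : ℤ) : Prop :=
  Integrable x circleMeasure ∧ ∀ n ≥ N, fourierCoeff x n = 0

theorem DegLT.mono {x : BoundaryFun} {M N : ℤ} (h : DegLT x M) (hMN : M ≤ N) : DegLT x N :=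
  ⟨h.1, fun n hn => h.2 n (hMN.trans hn)⟩

theorem fourierCoeff_aeadd {x y : BoundaryFun} (hx : Integrable x circleMeasure)
    (hy : Integrable y circleMeasure) (n : ℤ) :
    fourierCoeff (x + y : BoundaryFun) n = fourierCoeff x n + fourierCoeff y n := by
  rw [fourierCoeff_congr_ae (AEEqFun.coeFn_add x y)]
  exact fourierCoeff_add' hx hy n

theorem fourierCoeff_aesub {x y : BoundaryFun} (hx : Integrable x circleMeasure)
    (hy : Integrable y circleMeasure) (n : ℤ) :
    fourierCoeff (x - y : BoundaryFun) n = fourierCoeff x n - fourierCoeff y n := by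
  rw [fourierCoeff_congr_ae (AEEqFun.coeFn_sub x y)]
  exact fourierCoeff_sub' hx hy n

theorem integrable_aeadd {x y : BoundaryFun} (hx : Integrable x circleMeasure)
    (hy : Integrable y circleMeasure) : Integrable (x + y : BoundaryFun) circleMeasure :=
  (hx.add hy).congr (AEEqFun.coeFn_add x y).symm

theorem integrable_aesub {x y : BoundaryFun} (hx : Integrable x circleMeasure)
    (hy : Integrable y circleMeasure) : Integrable (x - y : BoundaryFun) circleMeasure :=
  (hx.sub hy).congr (AEEqFun.coeFn_sub x y).symm

theorem DegLT.sub {x y : BoundaryFun} {N : ℤ} (hx : DegLT x N) (hy : DegLT y N) :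
    DegLT (x - y) N :=
  ⟨integrable_aesub hx.1 hy.1, fun n hn => by
    rw [fourierCoeff_aesub hx.1 hy.1, hx.2 n hn, hy.2 n hn, sub_zero]⟩

theorem Analytic.aeadd {x y : BoundaryFun} (hx : Analytic x) (hy : Analytic y) :
    Analytic (x + y : BoundaryFun) :=
  (hx.add hy).congr (AEEqFun.coeFn_add x y).symm

theorem Analytic.aesub {x y : BoundaryFun} (hx : Analytic x) (hy : Analytic y) :
    Analytic (x - y : BoundaryFun) :=
  ⟨integrable_aesub hx.1 hy.1, fun n hn => by
    rw [fourierCoeff_aesub hx.1 hy.1, hx.2 n hn, hy.2 n hn, sub_zero]⟩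

theorem Analytic.bpoly_mul {x : BoundaryFun} (hx : Analytic x) (u : ℂ[X]) :
    Analytic (bpoly u * x : BoundaryFun) :=
  (hx.poly_mul u).congr (coeFn_bpoly_mul u x).symm

theorem integrable_bpoly_mul {x : BoundaryFun} (hx : Integrable x circleMeasure) (u : ℂ[X]) :
    Integrable (bpoly u * x : BoundaryFun) circleMeasure :=
  (integrable_poly_mul u hx).congr (coeFn_bpoly_mul u x).symm

theorem integrable_bpoly (u : ℂ[X]) : Integrable (bpoly u) circleMeasure :=
  (integrable_of_continuous (u.continuous.comp continuous_bdry)).congr (coeFn_bpoly u).symm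

theorem eq_zero_of_fourierCoeff {x : BoundaryFun} (hx : Integrable x circleMeasure)
    (h : ∀ n, fourierCoeff x n = 0) : x = 0 :=
  AEEqFun.ext ((ae_eq_zero_of_fourierCoeff hx h).trans AEEqFun.coeFn_zero.symm)

theorem fourierCoeff_eval (u : ℂ[X]) (n : ℤ) :
    fourierCoeff (fun t => u.eval (bdry t)) n = if n < 0 then 0 else u.coeff n.toNat := by
  induction u using Polynomial.induction_on' with
  | add u v hu hv =>
    simp only [eval_add, coeff_add]
    rw [fourierCoeff_add' (f := fun t => u.eval (bdry t)) (g := fun t => v.eval (bdry t))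
      (integrable_of_continuous (u.continuous.comp continuous_bdry))
      (integrable_of_continuous (v.continuous.comp continuous_bdry)), hu, hv]
    split_ifs <;> simp
  | monomial k c =>
    simp only [eval_monomial]
    have h := fourierCoeff.const_mul (T := 1) (fun t => bdry t ^ k * (1 : ℂ)) c n
    rw [fourierCoeff_pow_mul, fourierCoeff_const] at h
    simp only [mul_one] at h
    rw [h, coeff_monomial]
    split_ifs <;> first | omega | simp

theorem fourierCoeff_bpoly (u : ℂ[X]) (n : ℤ) :
    fourierCoeff (bpoly u) n = if n < 0 then 0 else u.coeff n.toNat := by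
  rw [fourierCoeff_congr_ae (coeFn_bpoly u), fourierCoeff_eval]

theorem analytic_bpoly (u : ℂ[X]) : Analytic (bpoly u) :=
  ⟨integrable_bpoly u, fun n hn => by rw [fourierCoeff_bpoly, if_pos hn]⟩

theorem degLT_bpoly {u : ℂ[X]} {N : ℤ} (h : ∀ i : ℕ, N ≤ i → u.coeff i = 0) :
    DegLT (bpoly u) N :=
  ⟨integrable_bpoly u, fun n hn => by
    rw [fourierCoeff_bpoly]
    split_ifs
    · rfl
    · exact h _ (by omega)⟩

/-- Analytic functions with finitely many nonzero Fourier coefficients are polynomials. -/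
theorem exists_eq_bpoly {x : BoundaryFun} (hx : Analytic x) {N : ℤ} (h : DegLT x N) :
    ∃ u : ℂ[X], (∀ i : ℕ, N ≤ i → u.coeff i = 0) ∧ x = bpoly u := by
  let u : ℂ[X] := ∑ i ∈ Finset.range N.toNat, monomial i (fourierCoeff x i)
  have hu : ∀ i : ℕ, u.coeff i = fourierCoeff x i := fun i => by
    simp only [u, finsetSum_coeff, coeff_monomial, Finset.sum_ite_eq', Finset.mem_range]
    split_ifs with hi
    · rfl
    · exact (h.2 _ (by omega)).symm
  refine ⟨u, fun i hi => by rw [hu, h.2 _ hi], ?_⟩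
  rw [← sub_eq_zero]
  refine eq_zero_of_fourierCoeff (integrable_aesub hx.1 (integrable_bpoly u)) fun n => ?_
  rw [fourierCoeff_aesub hx.1 (integrable_bpoly u), fourierCoeff_bpoly]
  split_ifs with hn
  · rw [hx.2 n hn, sub_zero]
  · rw [hu, Int.toNat_of_nonneg (by omega), sub_self]

/-- Induction over the linear factors of a polynomial. -/
theorem poly_induction_roots {motive : ℂ[X] → Prop} {S : Set ℂ} (const : ∀ c, c ≠ 0 → motive (C c))
    (step : ∀ a w, a ∈ S → w ≠ 0 → motive w → motive ((X - C a) * w)) (w : ℂ[X]) (hw : w ≠ 0)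
    (hS : ∀ z, w.IsRoot z → z ∈ S) : motive w := by
  induction hn : w.natDegree generalizing w with
  | zero =>
    obtain ⟨c, rfl⟩ := natDegree_eq_zero.1 hn
    exact const c (by simpa using hw)
  | succ n ih =>
    obtain ⟨a, ha⟩ := IsAlgClosed.exists_root w (by
      rw [degree_eq_natDegree hw, hn]; exact_mod_cast n.succ_ne_zero)
    obtain ⟨v, hv'⟩ := dvd_iff_isRoot.2 ha
    have hv : v ≠ 0 := fun h => hw (by rw [hv', h, mul_zero])
    rw [hv']
    refine step a v (hS a ha) hv
      (ih v hv (fun z hz => hS z (hz.dvd (hv' ▸ dvd_mul_left v (X - C a)))) ?_)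
    rw [hv'] at hn
    rw [natDegree_mul (X_sub_C_ne_zero a) hv, natDegree_X_sub_C] at hn
    omega

theorem coeFn_linear_mul (a : ℂ) (x : BoundaryFun) :
    (bpoly (X - C a) * x : BoundaryFun) =ᵐ[circleMeasure] fun t => (bdry t - a) * x t := by
  filter_upwards [coeFn_bpoly_mul (X - C a) x] with t ht
  rw [ht, eval_sub, eval_X, eval_C]

theorem fourierCoeff_linear_mul' (a : ℂ) {x : BoundaryFun} (hx : Integrable x circleMeasure)
    (n : ℤ) : fourierCoeff (bpoly (X - C a) * x : BoundaryFun) n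
      = fourierCoeff x (n - 1) - a * fourierCoeff x n := by
  rw [fourierCoeff_congr_ae (coeFn_linear_mul a x), fourierCoeff_linear_mul a hx]

theorem bpoly_C_inv_mul {c : ℂ} (hc : c ≠ 0) (x : BoundaryFun) :
    bpoly (C c⁻¹) * (bpoly (C c) * x) = x := by
  rw [← mul_assoc, ← map_mul, ← map_mul, ← C_mul, inv_mul_cancel₀ hc]
  simp

theorem fourierCoeff_bpoly_C_mul (c : ℂ) (x : BoundaryFun) (n : ℤ) :
    fourierCoeff (bpoly (C c) * x : BoundaryFun) n = c * fourierCoeff x n := by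
  rw [fourierCoeff_congr_ae (coeFn_bpoly_mul _ x)]
  simp only [eval_C]
  exact fourierCoeff.const_mul _ _ _

theorem bpoly_mul (u v : ℂ[X]) : bpoly (u * v) = bpoly u * bpoly v := by
  simp only [bpoly, map_mul]

/-- Division by a polynomial with roots in the closed disk lowers the degree. -/
theorem DegLT.of_bpoly_mul {w : ℂ[X]} (hw : w ≠ 0) (hr : ∀ z, w.IsRoot z → ‖z‖ ≤ 1)
    {x : BoundaryFun} (hx : Integrable x circleMeasure) {N : ℤ} (h : DegLT (bpoly w * x) N) :
    DegLT x (N - w.natDegree) := by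
  refine poly_induction_roots (S := {z | ‖z‖ ≤ 1}) (motive := fun w => ∀ {x : BoundaryFun},
    Integrable x circleMeasure → ∀ {N : ℤ}, DegLT (bpoly w * x) N → DegLT x (N - w.natDegree))
    ?_ ?_ w hw hr hx h
  · intro c hc x hx N h
    refine ⟨hx, fun n hn => ?_⟩
    have := h.2 n (by simpa using hn)
    rw [fourierCoeff_bpoly_C_mul] at this
    exact (mul_eq_zero.1 this).resolve_left hc
  · intro a w ha hw ih x hx N h
    rw [RatToeplitz.bpoly_mul, mul_assoc] at h
    have hi := integrable_bpoly_mul hx w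
    -- Each linear factor lowers the bound by one: from index `N` on, the recursion `c_{n-1} = a
    -- c_n` with `|a| ≤ 1` and the Riemann–Lebesgue lemma force the coefficients to vanish already
    -- from `N - 1`.
    have h1 : DegLT (bpoly w * x) (N - 1) := ⟨hi, coeff_ge_of_mul hi ha N fun n hn => by
      rw [← fourierCoeff_congr_ae (coeFn_linear_mul a _)]; exact h.2 n hn⟩
    refine (ih hx h1).mono ?_
    rw [natDegree_mul (X_sub_C_ne_zero a) hw, natDegree_X_sub_C]
    omega

theorem DegLT.bpoly_mul {x : BoundaryFun} {N : ℤ} (hx : DegLT x N) {w : ℂ[X]} (hw : w ≠ 0) :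
    DegLT (bpoly w * x) (N + w.natDegree) := by
  refine poly_induction_roots (S := Set.univ)
    (motive := fun w => DegLT (bpoly w * x) (N + w.natDegree)) ?_ ?_ w hw fun z _ => trivial
  · intro c hc
    exact ⟨integrable_bpoly_mul hx.1 _, fun n hn => by
      rw [fourierCoeff_bpoly_C_mul, hx.2 n (by simpa using hn), mul_zero]⟩
  · intro a w _ hw ih
    rw [RatToeplitz.bpoly_mul, mul_assoc, natDegree_mul (X_sub_C_ne_zero a) hw, natDegree_X_sub_C]
    refine ⟨integrable_bpoly_mul ih.1 _, fun n hn => ?_⟩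
    rw [fourierCoeff_linear_mul' a ih.1, ih.2 _ (by push_cast at hn; omega),
      ih.2 _ (by push_cast at hn; omega), mul_zero, sub_zero]

/-- Division by a polynomial without roots in the open disk preserves analyticity. -/
theorem Analytic.of_bpoly_mul {w : ℂ[X]} (hw : w ≠ 0) (hr : ∀ z, w.IsRoot z → 1 ≤ ‖z‖)
    {x : BoundaryFun} (hx : Integrable x circleMeasure) (h : Analytic (bpoly w * x : BoundaryFun)) :
    Analytic x := by
  refine poly_induction_roots (S := {z | 1 ≤ ‖z‖}) (motive := fun w => ∀ {x : BoundaryFun},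
    Integrable x circleMeasure → Analytic (bpoly w * x : BoundaryFun) → Analytic x)
    ?_ ?_ w hw hr hx h
  · intro c hc x hx h
    rw [← bpoly_C_inv_mul hc x]
    exact h.bpoly_mul _
  · intro a w ha hw ih x hx h
    rw [RatToeplitz.bpoly_mul, mul_assoc] at h
    have hi := integrable_bpoly_mul hx w
    exact ih hx ⟨hi, coeff_neg_of_mul hi ha fun n hn => by
      rw [← fourierCoeff_congr_ae (coeFn_linear_mul a _)]; exact h.2 n hn⟩

/-- Rational functions without poles on the circle have continuous boundary values. -/
theorem exists_continuous_boundary {r : RatFunc ℂ} (hr : r ∈ polesIn {z | ‖z‖ ≠ 1}) :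
    ∃ c : C(UnitAddCircle, ℂ), boundary r =ᵐ[circleMeasure] c := by
  refine ⟨⟨ratVal r, ?_⟩, coeFn_boundary r⟩
  rw [ratVal_eq]
  exact (r.num.continuous.comp continuous_bdry).div (r.denom.continuous.comp continuous_bdry)
    fun t ht => hr _ ht (norm_bdry t)

theorem integrable_boundary {r : RatFunc ℂ} (hr : r ∈ polesIn {z | ‖z‖ ≠ 1}) :
    Integrable (boundary r) circleMeasure := by
  obtain ⟨c, hc⟩ := exists_continuous_boundary hr
  exact (integrable_of_continuous c.continuous).congr hc.symm

theorem boundary_denom_mul (r : RatFunc ℂ) : bpoly r.denom * boundary r = bpoly r.num := by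
  rw [bpoly, bpoly, ← map_mul]
  congr 1
  rw [mul_comm]
  exact (div_eq_iff (algebraMap_ne_zero r.denom_ne_zero)).1 (RatFunc.num_div_denom r)|>.symm

/-- Integrable polynomial multiples of elements of `strictDisk` have bounded degree. -/
theorem degLT_of_mem_strictDisk {ρ : RatFunc ℂ} (hρ : ρ ∈ strictDisk) {w : ℂ[X]} (hw : w ≠ 0)
    (hi : Integrable (bpoly w * boundary ρ : BoundaryFun) circleMeasure) :
    DegLT (bpoly w * boundary ρ) w.natDegree := by
  -- After multiplication by the denominator the function is the polynomial `w * num`, of degree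
  -- less than `deg w + deg denom`. Dividing the denominator out again is legitimate because its
  -- roots lie in the closed disk.
  have h : DegLT (bpoly ρ.denom * (bpoly w * boundary ρ))
      ((w.natDegree : ℤ) + ρ.denom.natDegree) := by
    rw [mul_left_comm, boundary_denom_mul, ← bpoly_mul]
    refine degLT_bpoly fun i hi => ?_
    have h1 := (inftyVal_lt_one_iff ρ).1 hρ.1
    refine coeff_eq_zero_of_degree_lt ?_
    rw [degree_mul]
    refine (WithBot.add_lt_add_left (degree_eq_bot.not.2 hw) h1).trans_le ?_
    rw [degree_eq_natDegree hw, degree_eq_natDegree ρ.denom_ne_zero]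
    exact_mod_cast hi
  simpa using h.of_bpoly_mul ρ.denom_ne_zero hρ.2 hi

/-- The case `w = 1`. It is the reason why the Riesz projection annihilates an integrable strictly
proper remainder. -/
theorem degLT_boundary {ρ : RatFunc ℂ} (hρ : ρ ∈ strictDisk)
    (hi : Integrable (boundary ρ) circleMeasure) : DegLT (boundary ρ) 0 := by
  have h1 : bpoly 1 * boundary ρ = boundary ρ := by simp [bpoly]
  have := degLT_of_mem_strictDisk hρ (w := 1) one_ne_zero (by rwa [h1])
  simpa [h1] using this

theorem analytic_boundary {r : RatFunc ℂ} (hr : r ∈ polesIn {z | 1 < ‖z‖}) :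
    Analytic (boundary r) := by
  refine Analytic.of_bpoly_mul r.denom_ne_zero (fun z hz => (hr z hz).le)
    (integrable_boundary (polesIn_mono (fun z hz => hz.ne') hr)) ?_
  rw [boundary_denom_mul]
  exact analytic_bpoly _

end Boundary

/-! ### Splitting functions into an `H^p` part and a strictly proper rational part. -/

section Splitting

open Polynomial

variable {p : ℝ≥0∞}

theorem boundary_mul_mem_Lp {r : RatFunc ℂ} (hr : r ∈ polesIn {z | ‖z‖ ≠ 1}) {x : BoundaryFun}
    (hx : x ∈ Lp ℂ p circleMeasure) : boundary r * x ∈ Lp ℂ p circleMeasure := by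
  obtain ⟨c, hc⟩ := exists_continuous_boundary hr
  rw [Lp.mem_Lp_iff_memLp] at hx ⊢
  refine MemLp.of_le_mul (c := ‖c‖) hx (AEEqFun.aestronglyMeasurable _) ?_
  filter_upwards [AEEqFun.coeFn_mul (boundary r) x, hc] with t h1 h2
  rw [h1, Pi.mul_apply, norm_mul, h2]
  exact mul_le_mul_of_nonneg_right (c.norm_coe_le_norm t) (norm_nonneg _)

theorem one_mem_Lp : (1 : BoundaryFun) ∈ Lp ℂ p circleMeasure := by
  rw [Lp.mem_Lp_iff_memLp]
  exact (memLp_const (1 : ℂ)).ae_eq AEEqFun.coeFn_one.symm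

theorem boundary_mem_Lp {r : RatFunc ℂ} (hr : r ∈ polesIn {z | ‖z‖ ≠ 1}) :
    boundary r ∈ Lp ℂ p circleMeasure := by
  simpa using boundary_mul_mem_Lp hr (one_mem_Lp (p := p))

variable [Fact (1 ≤ p)]

/-- Elements of `H^p` as functions on the circle. -/
noncomputable def incl (p : ℝ≥0∞) [Fact (1 ≤ p)] : Hp p →ₗ[ℂ] BoundaryFun where
  toFun f := ((f : Lp ℂ p circleMeasure) : BoundaryFun)
  map_add' _ _ := rfl
  map_smul' _ _ := rfl

theorem incl_apply (f : Hp p) : incl p f = ((f : Lp ℂ p circleMeasure) : BoundaryFun) := rfl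

theorem incl_injective : Function.Injective (incl p) := fun _ _ h =>
  Subtype.ext (Subtype.ext h)

theorem analytic_incl (f : Hp p) : Analytic (incl p f) := ⟨integrable_Lp p f.1, f.2⟩

theorem exists_incl_eq {x : BoundaryFun} (hx : x ∈ Lp ℂ p circleMeasure) (ha : Analytic x) :
    ∃ f : Hp p, incl p f = x := ⟨⟨⟨x, hx⟩, ha.2⟩, rfl⟩

theorem integrable_of_mem_Lp {x : BoundaryFun} (hx : x ∈ Lp ℂ p circleMeasure) :
    Integrable x circleMeasure := integrable_Lp p ⟨x, hx⟩

/-- Multiplied by the denominator of `r`, the product is `num * f`, which is analytic; division by a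
polynomial without zeros in the open disk preserves this. -/
theorem exists_plus_mul {r : RatFunc ℂ} (hr : r ∈ polesIn {z | 1 < ‖z‖}) (f : Hp p) :
    ∃ g : Hp p, incl p g = boundary r * incl p f := by
  have hr' := polesIn_mono (T := {z | ‖z‖ ≠ 1}) (fun z hz => (ne_of_gt hz : ‖z‖ ≠ 1)) hr
  have hL := boundary_mul_mem_Lp hr' f.1.2
  refine exists_incl_eq hL (Analytic.of_bpoly_mul r.denom_ne_zero (fun z hz => (hr z hz).le)
    (integrable_of_mem_Lp hL) ?_)
  rw [← mul_assoc, boundary_denom_mul]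
  exact (analytic_incl f).bpoly_mul _

theorem exists_incl_eq_boundary {r : RatFunc ℂ} (hr : r ∈ polesIn {z | 1 < ‖z‖}) :
    ∃ g : Hp p, incl p g = boundary r :=
  exists_incl_eq (boundary_mem_Lp (polesIn_mono (fun z hz => (ne_of_gt hz : ‖z‖ ≠ 1)) hr))
    (analytic_boundary hr)

/-- The boundary values of strictly proper rational functions with poles in the closed disk. -/
noncomputable def strictBdry : AddSubgroup BoundaryFun :=
  strictDisk.map (boundary : RatFunc ℂ →+ BoundaryFun)

theorem mem_strictBdry {x : BoundaryFun} :
    x ∈ strictBdry ↔ ∃ ρ ∈ strictDisk, boundary ρ = x := Iff.rfl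

theorem boundary_mem_strictBdry {ρ : RatFunc ℂ} : boundary ρ ∈ strictBdry ↔ ρ ∈ strictDisk := by
  rw [mem_strictBdry]
  constructor
  · rintro ⟨σ, hσ, h⟩
    rwa [← boundary_injective h]
  · exact fun h => ⟨ρ, h, rfl⟩

theorem mul_mem_strictBdry {r : RatFunc ℂ} (hr : r ∈ properDisk) {x : BoundaryFun}
    (hx : x ∈ strictBdry) : boundary r * x ∈ strictBdry := by
  obtain ⟨ρ, hρ, rfl⟩ := hx
  exact ⟨r * ρ, mul_mem_strictDisk hr hρ, map_mul boundary r ρ⟩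

theorem inv_linear_mem {a : ℂ} {S : Set ℂ} (ha : a ∈ S) :
    (algebraMap ℂ[X] (RatFunc ℂ) (X - C a))⁻¹ ∈ polesIn S :=
  inv_mem_polesIn fun z hz => by rwa [root_X_sub_C.1 hz] at ha

theorem inv_mem_strictDisk {w : ℂ[X]} (hw : 0 < w.degree) (h : ∀ z, w.IsRoot z → ‖z‖ ≤ 1) :
    (algebraMap ℂ[X] (RatFunc ℂ) w)⁻¹ ∈ strictDisk := by
  refine ⟨?_, inv_mem_polesIn h⟩
  have := (inftyVal_div_lt_one (u := 1) (v := w) (ne_zero_of_degree_gt hw)).2 (by simpa using hw)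
  simpa using this

theorem inv_mem_properDisk {w : ℂ[X]} (hw : w ≠ 0) (h : ∀ z, w.IsRoot z → ‖z‖ ≤ 1) :
    (algebraMap ℂ[X] (RatFunc ℂ) w)⁻¹ ∈ properDisk := by
  refine mem_properDisk.2 ⟨?_, inv_mem_polesIn h⟩
  have := (inftyVal_div_le_one (u := 1) (v := w) hw).2 (by
    rw [degree_one, zero_le_degree_iff]; exact hw)
  simpa using this

theorem C_mul_mem_strictBdry (c : ℂ) {x : BoundaryFun} (hx : x ∈ strictBdry) :
    bpoly (C c) * x ∈ strictBdry := by
  refine mul_mem_strictBdry (mem_properDisk.2 ⟨?_, algebraMap_mem_polesIn _ _⟩) hx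
  have := (inftyVal_div_le_one (u := C c) (v := 1) one_ne_zero).2 (by simpa using degree_C_le)
  simpa using this

/-- The expansion `1 / (z - a) = ∑ a^j z^{-j-1}` has leading coefficient `1`. This is read off from
the coefficient of index `0` in `(z - a) x = 1`. -/
theorem fourierCoeff_boundary_inv_linear {a : ℂ} (ha : ‖a‖ < 1) :
    Integrable (boundary (algebraMap ℂ[X] (RatFunc ℂ) (X - C a))⁻¹) circleMeasure ∧
    fourierCoeff (boundary (algebraMap ℂ[X] (RatFunc ℂ) (X - C a))⁻¹) (-1) = 1 := by
  set x := boundary (algebraMap ℂ[X] (RatFunc ℂ) (X - C a))⁻¹ with hx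
  have hi : Integrable x circleMeasure := integrable_boundary (inv_linear_mem ha.ne)
  refine ⟨hi, ?_⟩
  have h0 : fourierCoeff x 0 = 0 := (degLT_boundary (inv_mem_strictDisk (by simp)
    fun z hz => by rw [← root_X_sub_C.1 hz]; exact ha.le) hi).2 0 le_rfl
  have h1 := fourierCoeff_linear_mul' a hi 0
  have h2 : bpoly (X - C a) * x = bpoly 1 := by
    rw [hx, bpoly, bpoly, ← map_mul, mul_inv_cancel₀ (algebraMap_ne_zero (X_sub_C_ne_zero a)),
      map_one, map_one, map_one]
  rw [h2, fourierCoeff_bpoly, h0] at h1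
  simpa using h1.symm

/-- Division by `z - a`, `|a| < 1`, in `H^p`, modulo strictly proper rational functions. -/
theorem exists_split_linear {a : ℂ} (ha : ‖a‖ < 1) (f : Hp p) : ∃ (g : Hp p) (c : ℂ),
    boundary (algebraMap ℂ[X] (RatFunc ℂ) (X - C a))⁻¹ * incl p f
      = incl p g + bpoly (C c) * boundary (algebraMap ℂ[X] (RatFunc ℂ) (X - C a))⁻¹ := by
  set x := boundary (algebraMap ℂ[X] (RatFunc ℂ) (X - C a))⁻¹ with hx
  obtain ⟨hi, hx1⟩ := fourierCoeff_boundary_inv_linear ha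
  rw [← hx] at hi hx1
  have hr : (algebraMap ℂ[X] (RatFunc ℂ) (X - C a))⁻¹ ∈ polesIn {z | ‖z‖ ≠ 1} :=
    inv_linear_mem ha.ne
  have hy : x * incl p f ∈ Lp ℂ p circleMeasure := boundary_mul_mem_Lp hr f.1.2
  -- This number plays the role of `f(a)`: subtracting `c / (z - a)` removes the coefficient of
  -- index `-1`.
  obtain ⟨c, hc⟩ : ∃ c, c = fourierCoeff (x * incl p f : BoundaryFun) (-1) := ⟨_, rfl⟩
  have hcx : bpoly (C c) * x ∈ Lp ℂ p circleMeasure :=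
    boundary_mul_mem_Lp (algebraMap_mem_polesIn _ _) (boundary_mem_Lp hr)
  have hgL : x * incl p f - bpoly (C c) * x ∈ Lp ℂ p circleMeasure := sub_mem hy hcx
  have hgi := integrable_of_mem_Lp hgL
  have hone : bpoly (X - C a) * x = 1 := by
    rw [hx, bpoly, ← map_mul, mul_inv_cancel₀ (algebraMap_ne_zero (X_sub_C_ne_zero a)), map_one]
  have hmul : bpoly (X - C a) * (x * incl p f - bpoly (C c) * x) = incl p f - bpoly (C c) := by
    linear_combination (incl p f - bpoly (C c)) * hone
  have hg1 : fourierCoeff (x * incl p f - bpoly (C c) * x : BoundaryFun) (-1) = 0 := by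
    rw [fourierCoeff_aesub (integrable_of_mem_Lp hy) (integrable_of_mem_Lp hcx),
      fourierCoeff_bpoly_C_mul, hx1, hc, mul_one, sub_self]
  have han : Analytic (incl p f - bpoly (C c) : BoundaryFun) :=
    (analytic_incl f).aesub (analytic_bpoly _)
  -- Since `(z - a) g = f - c` is analytic, the negative coefficients of `g` satisfy `g_{n-1} = a
  -- g_n`, so the vanishing at `-1` propagates downwards.
  have hind : ∀ j : ℕ,
      fourierCoeff (x * incl p f - bpoly (C c) * x : BoundaryFun) (-1 - j) = 0 := by
    intro j
    induction j with
    | zero => simpa using hg1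
    | succ j ih =>
      have := fourierCoeff_linear_mul' a hgi (-1 - j)
      rw [hmul, han.2 _ (by omega), ih, mul_zero, sub_zero] at this
      rw [this]; congr 1; push_cast; ring
  obtain ⟨g, hg⟩ := exists_incl_eq hgL ⟨hgi, fun n hn => by
    have := hind (-1 - n).toNat
    rwa [Int.toNat_of_nonneg (by omega), sub_sub_cancel] at this⟩
  exact ⟨g, c, by rw [hg]; ring⟩

theorem exists_split_inv {w : ℂ[X]} (hw : w ≠ 0) (hr : ∀ z, w.IsRoot z → ‖z‖ < 1) (f : Hp p) :
    ∃ g : Hp p, boundary (algebraMap ℂ[X] (RatFunc ℂ) w)⁻¹ * incl p f - incl p g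
      ∈ strictBdry := by
  -- The root condition is carried through the induction because the remainder `c / (z - a)` of one
  -- factor gets multiplied by `w⁻¹`, which must lie in `properDisk` for the product to stay
  -- strictly proper.
  suffices (∀ z, w.IsRoot z → ‖z‖ < 1) ∧ ∀ f : Hp p,
      ∃ g : Hp p, boundary (algebraMap ℂ[X] (RatFunc ℂ) w)⁻¹ * incl p f - incl p g
      ∈ strictBdry from this.2 f
  refine poly_induction_roots (S := {z | ‖z‖ < 1}) (motive := fun w =>
    (∀ z, w.IsRoot z → ‖z‖ < 1) ∧ ∀ f : Hp p,
      ∃ g : Hp p, boundary (algebraMap ℂ[X] (RatFunc ℂ) w)⁻¹ * incl p f - incl p g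
      ∈ strictBdry) ?_ ?_ w hw hr
  · intro c hc
    refine ⟨fun z hz => absurd hz (by simpa using hc), fun f => ?_⟩
    obtain ⟨g, hg⟩ := exists_plus_mul (r := (algebraMap ℂ[X] (RatFunc ℂ) (C c))⁻¹)
      (inv_mem_polesIn fun z hz => absurd hz (by simpa using hc)) f
    exact ⟨g, by rw [hg, sub_self]; exact zero_mem _⟩
  · rintro a w ha hw ⟨hr, ih⟩
    refine ⟨fun z hz => (root_mul.1 hz).elim (fun h => by rwa [← root_X_sub_C.1 h]) (hr z),
      fun f => ?_⟩
    obtain ⟨g, c, hg⟩ := exists_split_linear ha f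
    obtain ⟨g', hg'⟩ := ih g
    refine ⟨g', ?_⟩
    have hs : (algebraMap ℂ[X] (RatFunc ℂ) w)⁻¹ * (algebraMap ℂ[X] (RatFunc ℂ) (X - C a))⁻¹
        ∈ strictDisk := mul_mem_strictDisk (inv_mem_properDisk hw fun z hz => (hr z hz).le)
      (inv_mem_strictDisk (by simp) fun z hz => by rw [← root_X_sub_C.1 hz]; exact (ha : _ < _).le)
    have h2 := add_mem hg' (C_mul_mem_strictBdry c (boundary_mem_strictBdry.2 hs))
    convert h2 using 1
    rw [map_mul, mul_inv, map_mul, map_mul]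
    linear_combination boundary (algebraMap ℂ[X] (RatFunc ℂ) w)⁻¹ * hg

/-- A rational function without poles on the circle maps `H^p` into `H^p` modulo strictly proper
rational functions. -/
theorem exists_split {r : RatFunc ℂ} (hr : r ∈ polesIn {z | ‖z‖ ≠ 1}) (f : Hp p) :
    ∃ g : Hp p, boundary r * incl p f - incl p g ∈ strictBdry := by
  obtain ⟨r₁, r₂, rfl, h₁, h₂, h₂', hT⟩ := exists_separation {z | ‖z‖ ≤ 1} r
  obtain ⟨g₁, hg₁⟩ := exists_plus_mul (polesIn_mono (T := {z | 1 < ‖z‖})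
    (fun z hz => by simpa using hz) h₁) f
  obtain ⟨f', hf'⟩ := exists_plus_mul (p := p) (algebraMap_mem_polesIn _ r₂.num) f
  -- The denominator of `r₂` has its roots in the closed disk and off the circle, hence in the open
  -- disk; its numerator is absorbed into `f'`.
  obtain ⟨g₂, hg₂⟩ := exists_split_inv r₂.denom_ne_zero
    (fun z hz => lt_of_le_of_ne (h₂ z hz) ((hT _ hr).2 z hz)) f'
  refine ⟨g₁ + g₂, ?_⟩
  convert hg₂ using 1
  rw [map_add, map_add, hg₁, hf', ← mul_assoc, ← map_mul, inv_mul_eq_div, RatFunc.num_div_denom]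
  ring

/-- Every rational function is, modulo strictly proper functions with poles in the closed disk,
an element of `H^p`. -/
theorem exists_split_boundary (p : ℝ≥0∞) [Fact (1 ≤ p)] (r : RatFunc ℂ) :
    ∃ g : Hp p, boundary r - incl p g ∈ strictBdry := by
  obtain ⟨r₁, r₂, rfl, h₁, h₂, h₂', hT⟩ := exists_separation {z | ‖z‖ ≤ 1} r
  obtain ⟨g, hg⟩ := exists_incl_eq_boundary (p := p) (polesIn_mono (T := {z | 1 < ‖z‖})
    (fun z hz => by simpa using hz) h₁)
  exact ⟨g, by rw [hg, map_add, add_sub_cancel_left]; exact ⟨r₂, ⟨h₂', h₂⟩, rfl⟩⟩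

theorem exists_split_sum {ι : Type*} [Fintype ι] {r : ι → RatFunc ℂ}
    (hr : ∀ j, r j ∈ polesIn {z | ‖z‖ ≠ 1}) (f : ι → Hp p) :
    ∃ g : Hp p, ∑ j, boundary (r j) * incl p (f j) - incl p g ∈ strictBdry := by
  choose g hg using fun j => exists_split (hr j) (f j)
  refine ⟨∑ j, g j, ?_⟩
  rw [map_sum, ← Finset.sum_sub_distrib]
  exact sum_mem fun j _ => hg j

end Splitting

/-! ### The algebraic description of the graph of `T_Ω`. -/

section Value

open Polynomial

variable {p : ℝ≥0∞} [Fact (1 ≤ p)] {m : ℕ}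

theorem eq_zero_of_analytic_of_degLT {x : BoundaryFun} (hx : Analytic x) (h : DegLT x 0) :
    x = 0 := by
  refine eq_zero_of_fourierCoeff hx.1 fun n => ?_
  rcases lt_or_ge n 0 with hn | hn
  exacts [hx.2 n hn, h.2 n hn]

/-- An anti-analytic function with an analytic polynomial multiple is rational. -/
theorem mem_strictBdry_of_degLT {x : BoundaryFun} (h : DegLT x 0) {E : ℂ[X]} (hE : E ≠ 0)
    (hx : Analytic (bpoly E * x : BoundaryFun)) : x ∈ strictBdry := by
  obtain ⟨u, -, hu⟩ := exists_eq_bpoly hx (h.bpoly_mul hE)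
  have hxr : x = boundary (algebraMap ℂ[X] (RatFunc ℂ) u / algebraMap ℂ[X] (RatFunc ℂ) E) := by
    have h1 : boundary (algebraMap ℂ[X] (RatFunc ℂ) E)⁻¹ * bpoly E = 1 := by
      rw [bpoly, ← map_mul, inv_mul_cancel₀ (algebraMap_ne_zero hE), map_one]
    rw [div_eq_inv_mul, map_mul]
    change x = _ * bpoly u
    rw [← hu]
    linear_combination (-x) * h1
  -- The roots of `E` are arbitrary, so `u / E` is not visibly an element of `strictDisk`; the part
  -- with poles outside the closed disk must be shown to vanish.
  obtain ⟨r₁, r₂, hr, h₁, h₂, h₂', -⟩ := exists_separation {z | ‖z‖ ≤ 1}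
    (algebraMap ℂ[X] (RatFunc ℂ) u / algebraMap ℂ[X] (RatFunc ℂ) E)
  rw [hr, map_add] at hxr
  have ha₁ : Analytic (boundary r₁) := analytic_boundary (polesIn_mono
    (fun z hz => by simpa using hz) h₁)
  have hi₂ : Integrable (boundary r₂) circleMeasure := by
    rw [show boundary r₂ = x - boundary r₁ by rw [hxr]; ring]
    exact integrable_aesub h.1 ha₁.1
  -- As `x - r₂`, the function `r₁` has no coefficients of index `≥ 0`; by the location of its poles
  -- it has no negative ones.
  have h0 : boundary r₁ = 0 := eq_zero_of_analytic_of_degLT ha₁ (by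
    rw [show boundary r₁ = x - boundary r₂ by rw [hxr]; ring]
    exact h.sub (degLT_boundary ⟨h₂', h₂⟩ hi₂))
  rw [hxr, h0, zero_add]
  exact ⟨r₂, ⟨h₂', h₂⟩, rfl⟩

theorem isDecomp_iff {Ω : Matrix (Fin m) (Fin m) (RatFunc ℂ)} {f : Fin m → Hp p}
    {h : Fin m → Lp ℂ p circleMeasure} {η : Fin m → RatFunc ℂ} :
    IsDecomp Ω f h η ↔ (∀ i, IsRatZero (η i)) ∧ ∀ i,
      ∑ j, boundary (Ω i j) * incl p (f j) = (h i : BoundaryFun) + boundary (η i) := by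
  refine and_congr_right fun _ => forall_congr' fun i => ?_
  have hl : ((∑ j, boundary (Ω i j) * incl p (f j) : BoundaryFun) : UnitAddCircle → ℂ)
      =ᵐ[circleMeasure] fun t => ∑ j, ratVal (Ω i j) t * (f j : Lp ℂ p circleMeasure) t := by
    have h1 : ∀ᵐ t ∂circleMeasure, ∀ j, (boundary (Ω i j) * incl p (f j) : BoundaryFun) t
        = ratVal (Ω i j) t * (f j : Lp ℂ p circleMeasure) t := ae_all_iff.2 fun j => by
      filter_upwards [AEEqFun.coeFn_mul (boundary (Ω i j)) (incl p (f j)),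
        coeFn_boundary (Ω i j)] with t h2 h3
      rw [h2, Pi.mul_apply, h3]; rfl
    filter_upwards [h1, AEEqFun.coeFn_finsetSum Finset.univ
      fun j => (boundary (Ω i j) * incl p (f j) : BoundaryFun)] with t h2 h3
    rw [h3, Finset.sum_apply]
    exact Finset.sum_congr rfl fun j _ => h2 j
  have hr : (((h i : BoundaryFun) + boundary (η i) : BoundaryFun) : UnitAddCircle → ℂ)
      =ᵐ[circleMeasure] fun t => h i t + ratVal (η i) t := by
    filter_upwards [AEEqFun.coeFn_add (h i : BoundaryFun) (boundary (η i)),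
      coeFn_boundary (η i)] with t h2 h3
    rw [h2, Pi.add_apply, h3]
  constructor
  · intro H
    have H' : (fun t => ∑ j, ratVal (Ω i j) t * (f j : Lp ℂ p circleMeasure) t)
      =ᵐ[circleMeasure] fun t => h i t + ratVal (η i) t := H
    exact AEEqFun.ext (hl.trans (H'.trans hr.symm))
  · intro H
    rw [H] at hl
    exact hl.symm.trans hr

/-- Vectors over `H^p` as vectors of functions on the circle. -/
noncomputable def inclVec (f : Fin m → Hp p) : Fin m → BoundaryFun := fun i => incl p (f i)

theorem inclVec_injective : Function.Injective (inclVec (p := p) (m := m)) := fun _ _ h =>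
  funext fun i => incl_injective (congrFun h i)

/-- The product of the denominators of the row works. Its roots may lie anywhere, since
`mem_strictBdry_of_degLT` only asks for some nonzero multiplier. -/
theorem exists_bpoly_mul_analytic (r : Fin m → RatFunc ℂ) (f : Fin m → Hp p) :
    ∃ D : ℂ[X], D ≠ 0 ∧
      Analytic (bpoly D * ∑ j, boundary (r j) * incl p (f j) : BoundaryFun) := by
  suffices ∀ s : Finset (Fin m), ∃ D : ℂ[X], D ≠ 0 ∧
      Analytic (bpoly D * ∑ j ∈ s, boundary (r j) * incl p (f j) : BoundaryFun) from
    this Finset.univ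
  intro s
  induction s using Finset.induction_on with
  | empty => exact ⟨1, one_ne_zero, by simpa [bpoly] using analytic_bpoly 0⟩
  | insert a s ha ih =>
    obtain ⟨D, hD, hA⟩ := ih
    refine ⟨(r a).denom * D, mul_ne_zero (r a).denom_ne_zero hD, ?_⟩
    convert (hA.bpoly_mul (r a).denom).aeadd ((analytic_incl (f a)).bpoly_mul (D * (r a).num))
      using 2
    rw [Finset.sum_insert ha, RatToeplitz.bpoly_mul, RatToeplitz.bpoly_mul, ← boundary_denom_mul]
    ring

/-- `T_Ω f = g` if and only if `Ω f - g` is strictly proper rational with all its poles in the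
closed unit disk. -/
theorem isToeplitzValue_iff {Ω : Matrix (Fin m) (Fin m) (RatFunc ℂ)} {f g : Fin m → Hp p} :
    IsToeplitzValue Ω f g ↔
      ∀ i, ((Ω.map boundary).mulVec (inclVec f) - inclVec g) i ∈ strictBdry := by
  have hsum : ∀ i, (Ω.map boundary).mulVec (inclVec f) i
      = ∑ j, boundary (Ω i j) * incl p (f j) := fun i => rfl
  constructor
  · rintro ⟨h, η, H, hP⟩ i
    rw [isDecomp_iff] at H
    have hη := isRatZero_iff.1 (H.1 i)
    have hηs : η i ∈ strictDisk := ⟨hη.1, polesIn_mono (fun z hz => le_of_eq hz) hη.2⟩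
    obtain ⟨D, hD, hA⟩ := exists_bpoly_mul_analytic (Ω i) f
    -- The part of `h` removed by the projection has only negative coefficients, and clearing the
    -- denominators of `Ω` and `η` makes it analytic; therefore it is rational.
    have hx : (h i : BoundaryFun) - incl p (g i) ∈ strictBdry := by
      refine mem_strictBdry_of_degLT (E := (η i).denom * D)
        ⟨integrable_aesub (integrable_Lp p (h i)) (analytic_incl _).1, fun n hn => ?_⟩
        (mul_ne_zero (η i).denom_ne_zero hD) ?_
      · rw [fourierCoeff_aesub (integrable_Lp p (h i)) (analytic_incl _).1]
        exact sub_eq_zero.2 (hP i n hn).symm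
      · convert ((hA.bpoly_mul (η i).denom).aesub (analytic_bpoly (D * (η i).num))).aesub
          ((analytic_incl (g i)).bpoly_mul ((η i).denom * D)) using 2
        rw [RatToeplitz.bpoly_mul, RatToeplitz.bpoly_mul, ← boundary_denom_mul, H.2 i]
        ring
    rw [Pi.sub_apply, hsum, H.2 i]
    convert add_mem hx (boundary_mem_strictBdry.2 hηs) using 1
    simp only [inclVec]
    ring
  · intro H
    have key : ∀ i, ∃ (h : Lp ℂ p circleMeasure) (η : RatFunc ℂ), IsRatZero η ∧
        IsRieszProj h (g i) ∧
        ∑ j, boundary (Ω i j) * incl p (f j) = (h : BoundaryFun) + boundary η := by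
      intro i
      obtain ⟨ρ, hρ, hρe⟩ := mem_strictBdry.1 (H i)
      -- The poles on the circle go into `η`. The rest, `ρ₁`, has continuous boundary values and no
      -- coefficients of index `≥ 0`, so `h = g + ρ₁` still projects to `g`.
      obtain ⟨ρ₁, η, he, h₁, hη, hη', hT⟩ := exists_separation {z | ‖z‖ = 1} ρ
      have hηs : η ∈ strictDisk := ⟨hη', (hT _ hρ.2).2⟩
      have hρ₁ : ρ₁ ∈ strictDisk := by
        rw [show ρ₁ = ρ - η by rw [he]; ring]
        exact sub_mem hρ hηs
      have h₁' : ρ₁ ∈ polesIn {z | ‖z‖ ≠ 1} := h₁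
      refine ⟨(g i : Lp ℂ p circleMeasure) + ⟨boundary ρ₁, boundary_mem_Lp h₁'⟩, η,
        isRatZero_iff.2 ⟨hη', hη⟩, fun n hn => ?_, ?_⟩
      · have := fourierCoeff_aeadd (analytic_incl (g i)).1 (integrable_boundary h₁') n
        rw [(degLT_boundary hρ₁ (integrable_boundary h₁')).2 n hn, add_zero] at this
        exact this.symm
      · rw [Pi.sub_apply, hsum, he, map_add] at hρe
        rw [sub_eq_iff_eq_add'.1 hρe.symm]
        exact (add_assoc _ _ _).symm
    choose h η h1 h2 h3 using key
    exact ⟨h, η, isDecomp_iff.2 ⟨h1, h3⟩, h2⟩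

/-- Uniqueness of the value identifies the chosen one with any admissible `g`; kernel, range and
closedness are all read off from the graph afterwards. -/
theorem mem_toeplitz_graph_iff {Ω : Matrix (Fin m) (Fin m) (RatFunc ℂ)} {f g : Fin m → Hp p} :
    (f, g) ∈ (toeplitz p Ω).graph ↔ IsToeplitzValue Ω f g := by
  rw [LinearPMap.mem_graph_iff]
  constructor
  · rintro ⟨y, rfl, rfl⟩
    exact toeplitz_isToeplitzValue Ω y
  · intro h
    obtain ⟨_, _, H, -⟩ := id h
    exact ⟨⟨f, _, _, H⟩, rfl, (toeplitz_isToeplitzValue Ω _).unique h⟩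

theorem mem_opKer_iff {E F : Type*} [AddCommGroup E] [Module ℂ E] [AddCommGroup F] [Module ℂ F]
    (T : E →ₗ.[ℂ] F) (f : E) : f ∈ opKer T ↔ (f, 0) ∈ T.graph := by
  rw [LinearPMap.mem_graph_iff, opKer, Submodule.mem_map]
  constructor
  · rintro ⟨y, hy, rfl⟩
    exact ⟨y, rfl, hy⟩
  · rintro ⟨y, hy, h0⟩
    exact ⟨y, h0, hy⟩

theorem mem_opRan_iff {E F : Type*} [AddCommGroup E] [Module ℂ E] [AddCommGroup F] [Module ℂ F]
    (T : E →ₗ.[ℂ] F) (g : F) : g ∈ opRan T ↔ ∃ f, (f, g) ∈ T.graph := by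
  rw [opRan, LinearMap.mem_range]
  constructor
  · rintro ⟨y, rfl⟩
    exact ⟨y, T.mem_graph y⟩
  · rintro ⟨f, hf⟩
    obtain ⟨y, -, hy⟩ := T.mem_graph_iff.1 hf
    exact ⟨y, hy⟩

theorem mem_opKer_toeplitz {Ω : Matrix (Fin m) (Fin m) (RatFunc ℂ)} {f : Fin m → Hp p} :
    f ∈ opKer (toeplitz p Ω) ↔ ∀ i, (Ω.map boundary).mulVec (inclVec f) i ∈ strictBdry := by
  rw [mem_opKer_iff, mem_toeplitz_graph_iff, isToeplitzValue_iff]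
  refine forall_congr' fun i => ?_
  rw [Pi.sub_apply, show inclVec (0 : Fin m → Hp p) i = 0 from (incl p).map_zero, sub_zero]

theorem mulVec_mem_strictBdry {A : Matrix (Fin m) (Fin m) (RatFunc ℂ)}
    (hA : ∀ i j, A i j ∈ properDisk) {x : Fin m → BoundaryFun} (hx : ∀ i, x i ∈ strictBdry)
    (i : Fin m) : (A.map boundary).mulVec x i ∈ strictBdry := by
  change ∑ j, boundary (A i j) * x j ∈ strictBdry
  exact sum_mem fun j _ => mul_mem_strictBdry (hA i j) (hx j)

theorem mulVec_mulVec_boundary (A B : Matrix (Fin m) (Fin m) (RatFunc ℂ)) (x : Fin m → BoundaryFun) :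
    (A.map boundary).mulVec ((B.map boundary).mulVec x) = ((A * B).map boundary).mulVec x := by
  rw [Matrix.mulVec_mulVec, Matrix.map_mul]

/-- Invertible matrices of proper rational functions with poles in the closed disk act invertibly
on strictly proper vectors. -/
theorem mulVec_mem_strictBdry_iff {A B : Matrix (Fin m) (Fin m) (RatFunc ℂ)}
    (hA : ∀ i j, A i j ∈ properDisk) (hB : ∀ i j, B i j ∈ properDisk) (hBA : B * A = 1)
    {x : Fin m → BoundaryFun} :
    (∀ i, (A.map boundary).mulVec x i ∈ strictBdry) ↔ ∀ i, x i ∈ strictBdry := by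
  refine ⟨fun h => ?_, fun h => mulVec_mem_strictBdry hA h⟩
  have := mulVec_mem_strictBdry hB h
  rwa [mulVec_mulVec_boundary, hBA, Matrix.map_one _ (map_zero _) (map_one _),
    Matrix.one_mulVec] at this

end Value

/-! ### Polynomials inside `H^p`, their dimensions, and the scalar kernel. -/

section Polynomials

open Polynomial

variable {p : ℝ≥0∞} [Fact (1 ≤ p)] {m : ℕ}

theorem bpoly_C_mul_eq_smul (c : ℂ) (x : BoundaryFun) : bpoly (C c) * x = c • x := by
  refine AEEqFun.ext ?_
  filter_upwards [coeFn_bpoly_mul (C c) x, AEEqFun.coeFn_smul c x] with t h1 h2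
  rw [h1, h2, eval_C, Pi.smul_apply, smul_eq_mul]

/-- Complex scalars become constants of the ring `BoundaryFun`, so that they can be moved through
`Matrix.mulVec`. -/
theorem smul_boundaryFun_eq (c : ℂ) (x : Fin m → BoundaryFun) : c • x = bpoly (C c) • x :=
  funext fun i => (bpoly_C_mul_eq_smul c (x i)).symm

theorem exists_incl_eq_bpoly (p : ℝ≥0∞) [Fact (1 ≤ p)] (u : ℂ[X]) :
    ∃ f : Hp p, incl p f = bpoly u :=
  exists_incl_eq_boundary (algebraMap_mem_polesIn _ u)

/-- Polynomials as elements of `H^p`. -/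
noncomputable def polyHp (p : ℝ≥0∞) [Fact (1 ≤ p)] : ℂ[X] →ₗ[ℂ] Hp p where
  toFun u := (exists_incl_eq_bpoly p u).choose
  map_add' u v := incl_injective (by
    rw [map_add, (exists_incl_eq_bpoly p _).choose_spec, (exists_incl_eq_bpoly p _).choose_spec,
      (exists_incl_eq_bpoly p _).choose_spec, bpoly, map_add, map_add])
  map_smul' c u := incl_injective (by
    rw [map_smul, (exists_incl_eq_bpoly p _).choose_spec, (exists_incl_eq_bpoly p _).choose_spec,
      RingHom.id_apply, ← bpoly_C_mul_eq_smul, ← bpoly_mul, smul_eq_C_mul])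

theorem incl_polyHp (u : ℂ[X]) : incl p (polyHp p u) = bpoly u :=
  (exists_incl_eq_bpoly p u).choose_spec

theorem polyHp_injective : Function.Injective (polyHp p) := fun u v h => by
  have h1 : bpoly u = bpoly v := by rw [← incl_polyHp (p := p), h, incl_polyHp]
  exact RatFunc.algebraMap_injective ℂ (boundary_injective h1)

theorem mem_polySpace {n : ℤ} {f : Hp p} :
    f ∈ polySpace p n ↔ ∃ u : ℂ[X], (∀ i : ℕ, n < i → u.coeff i = 0) ∧ incl p f = bpoly u := by
  refine exists_congr fun u => and_congr_right fun _ => ?_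
  constructor
  · exact fun h => AEEqFun.ext (EventuallyEq.trans h (coeFn_bpoly u).symm)
  · intro h
    filter_upwards [coeFn_bpoly u] with t ht
    rw [← ht, ← h, incl_apply]

theorem polySpace_eq_map (n : ℤ) :
    polySpace p n = (degreeLT ℂ (n + 1).toNat).map (polyHp p) := by
  ext f
  rw [mem_polySpace, Submodule.mem_map]
  refine exists_congr fun u => and_congr ?_ ?_
  -- The truncation in `(n + 1).toNat` is harmless: for `n < 0` both conditions kill every
  -- coefficient.
  · rw [mem_degreeLT, degree_lt_iff_coeff_zero]
    exact forall_congr' fun i => imp_congr_left (by omega)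
  · rw [← incl_polyHp (p := p), incl_injective.eq_iff, eq_comm]

theorem finiteDimensional_polySpace (n : ℤ) : FiniteDimensional ℂ (polySpace p n) := by
  rw [polySpace_eq_map]
  have : FiniteDimensional ℂ (degreeLT ℂ (n + 1).toNat) :=
    (degreeLTEquiv ℂ (n + 1).toNat).symm.finiteDimensional
  infer_instance

theorem finrank_polySpace (n : ℤ) : (Module.finrank ℂ (polySpace p n) : ℤ) = max (n + 1) 0 := by
  rw [polySpace_eq_map, ← (Submodule.equivMapOfInjective (polyHp p) polyHp_injective
    (degreeLT ℂ (n + 1).toNat)).finrank_eq, (degreeLTEquiv ℂ (n + 1).toNat).finrank_eq,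
    Module.finrank_fin_fun, Int.toNat_eq_max]

/-- A product of subspaces as a subspace of the product. -/
def piSubmoduleEquiv {ι : Type*} {E : ι → Type*} [∀ i, AddCommGroup (E i)] [∀ i, Module ℂ (E i)]
    (S : ∀ i, Submodule ℂ (E i)) : Submodule.pi Set.univ S ≃ₗ[ℂ] ∀ i, S i where
  toFun x i := ⟨x.1 i, x.2 i trivial⟩
  invFun x := ⟨fun i => x i, fun i _ => (x i).2⟩
  map_add' _ _ := rfl
  map_smul' _ _ := rfl
  left_inv _ := rfl
  right_inv _ := rfl

theorem finiteDimensional_pi_polySpace (n : Fin m → ℤ) :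
    FiniteDimensional ℂ (Submodule.pi Set.univ fun j => polySpace p (n j)) := by
  have := fun j => finiteDimensional_polySpace (p := p) (n j)
  exact (piSubmoduleEquiv fun j => polySpace p (n j)).symm.finiteDimensional

theorem finrank_pi_polySpace (n : Fin m → ℤ) :
    (Module.finrank ℂ (Submodule.pi Set.univ fun j => polySpace p (n j)) : ℤ)
      = ∑ j, max (n j + 1) 0 := by
  have := fun j => finiteDimensional_polySpace (p := p) (n j)
  rw [(piSubmoduleEquiv fun j => polySpace p (n j)).finrank_eq, Module.finrank_pi_fintype]
  push_cast
  exact Finset.sum_congr rfl fun j _ => finrank_polySpace _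

/-- The scalar kernel: `(a / b) f` is strictly proper if and only if `f` is a polynomial of degree
less than `deg b - deg a`. -/
theorem div_mul_incl_mem_strictBdry_iff {a b : ℂ[X]} (ha : a ≠ 0) (hb : b ≠ 0)
    (hra : ∀ z, a.IsRoot z → ‖z‖ ≤ 1) (hrb : ∀ z, b.IsRoot z → ‖z‖ ≤ 1) (f : Hp p) :
    boundary (algebraMap ℂ[X] (RatFunc ℂ) a / algebraMap ℂ[X] (RatFunc ℂ) b) * incl p f
      ∈ strictBdry ↔ f ∈ polySpace p ((b.natDegree : ℤ) - a.natDegree - 1) := by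
  rw [mem_polySpace]
  have hab : bpoly b * (boundary (algebraMap ℂ[X] (RatFunc ℂ) a / algebraMap ℂ[X] (RatFunc ℂ) b)
      * incl p f) = bpoly a * incl p f := by
    rw [← mul_assoc, bpoly, ← map_mul, mul_div_cancel₀ _ (algebraMap_ne_zero hb)]
  constructor
  · rintro ⟨ρ, hρ, hρe⟩
    have hi : Integrable (bpoly b * boundary ρ : BoundaryFun) circleMeasure := by
      change Integrable (bpoly b * (boundary : RatFunc ℂ →+ BoundaryFun) ρ : BoundaryFun) _
      rw [hρe, hab]
      exact integrable_bpoly_mul (analytic_incl f).1 a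
    -- With `ρ = (a / b) f`, the function `b ρ = a f` is integrable and has no coefficients from
    -- index `deg b` on; dividing by `a` lowers this bound by `deg a`, and an analytic function with
    -- finitely many coefficients is a polynomial.
    have h1 := degLT_of_mem_strictDisk hρ hb hi
    change DegLT (bpoly b * (boundary : RatFunc ℂ →+ BoundaryFun) ρ) _ at h1
    rw [hρe, hab] at h1
    obtain ⟨u, hu, hf⟩ := exists_eq_bpoly (analytic_incl f)
      (h1.of_bpoly_mul ha hra (analytic_incl f).1)
    exact ⟨u, fun i hi => hu i (by omega), hf⟩
  · rintro ⟨u, hu, hf⟩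
    rw [hf, bpoly, ← map_mul, boundary_mem_strictBdry, div_mul_eq_mul_div, ← map_mul]
    refine ⟨(inftyVal_div_lt_one hb).2 ?_, div_mem_polesIn _ hrb⟩
    rcases eq_or_ne u 0 with rfl | hu0
    · simp [bot_lt_iff_ne_bot, hb]
    have h1 : (u.natDegree : ℤ) ≤ (b.natDegree : ℤ) - a.natDegree - 1 := by
      by_contra hlt
      exact hu0 (leadingCoeff_eq_zero.1 (hu u.natDegree (by omega)))
    rw [degree_eq_natDegree (mul_ne_zero ha hu0), degree_eq_natDegree hb, natDegree_mul ha hu0]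
    exact_mod_cast (by omega : a.natDegree + u.natDegree < b.natDegree)

end Polynomials

/-! ### Plus functions acting on `H^p_m`. -/

section PlusAction

variable {p : ℝ≥0∞} [Fact (1 ≤ p)] {m : ℕ}

theorem inclVec_add (f g : Fin m → Hp p) : inclVec (f + g) = inclVec f + inclVec g :=
  funext fun i => map_add (incl p) (f i) (g i)

theorem inclVec_smul (c : ℂ) (f : Fin m → Hp p) :
    inclVec (c • f) = bpoly (Polynomial.C c) • inclVec f :=
  (funext fun i => map_smul (incl p) c (f i) : inclVec (c • f) = c • inclVec f).trans
    (smul_boundaryFun_eq c _)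

theorem exists_plus_mulVec {A : Matrix (Fin m) (Fin m) (RatFunc ℂ)} (hA : IsPlus A)
    (f : Fin m → Hp p) : ∃ g : Fin m → Hp p, inclVec g = (A.map boundary).mulVec (inclVec f) := by
  have h : ∀ i j, ∃ g : Hp p, incl p g = boundary (A i j) * incl p (f j) := fun i j =>
    exists_plus_mul (fun z hz => by
      by_contra hle
      exact hA i j z (le_of_not_gt hle : ‖z‖ ≤ 1) hz) (f j)
  choose g hg using h
  refine ⟨fun i => ∑ j, g i j, funext fun i => ?_⟩
  change incl p (∑ j, g i j) = ∑ j, boundary (A i j) * incl p (f j)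
  rw [map_sum]
  exact Finset.sum_congr rfl fun j _ => hg i j

/-- Multiplication by a plus function. -/
noncomputable def plusMul {A : Matrix (Fin m) (Fin m) (RatFunc ℂ)} (hA : IsPlus A) :
    (Fin m → Hp p) →ₗ[ℂ] (Fin m → Hp p) where
  toFun f := (exists_plus_mulVec hA f).choose
  map_add' f g := inclVec_injective ((exists_plus_mulVec hA _).choose_spec.trans (by
    rw [inclVec_add, Matrix.mulVec_add, inclVec_add, (exists_plus_mulVec hA f).choose_spec,
      (exists_plus_mulVec hA g).choose_spec]))
  map_smul' c f := inclVec_injective ((exists_plus_mulVec hA _).choose_spec.trans (by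
    rw [RingHom.id_apply, inclVec_smul, Matrix.mulVec_smul, inclVec_smul,
      (exists_plus_mulVec hA f).choose_spec]))

theorem inclVec_plusMul {A : Matrix (Fin m) (Fin m) (RatFunc ℂ)} (hA : IsPlus A)
    (f : Fin m → Hp p) : inclVec (plusMul hA f) = (A.map boundary).mulVec (inclVec f) :=
  (exists_plus_mulVec hA f).choose_spec

theorem plusMul_plusMul {A B : Matrix (Fin m) (Fin m) (RatFunc ℂ)} (hA : IsPlus A) (hB : IsPlus B)
    (hAB : A * B = 1) (f : Fin m → Hp p) : plusMul hA (plusMul hB f) = f := by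
  refine inclVec_injective ?_
  rw [inclVec_plusMul, inclVec_plusMul, mulVec_mulVec_boundary, hAB,
    Matrix.map_one _ (map_zero _) (map_one _), Matrix.one_mulVec]

/-- Multiplication by an invertible plus function with plus inverse. -/
noncomputable def plusEquiv {A B : Matrix (Fin m) (Fin m) (RatFunc ℂ)} (hA : IsPlus A)
    (hB : IsPlus B) (hAB : A * B = 1) (hBA : B * A = 1) :
    (Fin m → Hp p) ≃ₗ[ℂ] (Fin m → Hp p) :=
  LinearEquiv.ofLinearMap (plusMul hA) (plusMul hB)
    (LinearMap.ext fun f => plusMul_plusMul hA hB hAB f)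
    (LinearMap.ext fun f => plusMul_plusMul hB hA hBA f)

end PlusAction

/-! ### The unipotent factor of the middle factor, and the kernel. -/

namespace WienerHopfFactorization

open Polynomial

variable {p : ℝ≥0∞} [Fact (1 ≤ p)] {m : ℕ} {Ω : Matrix (Fin m) (Fin m) (RatFunc ℂ)}
  (W : WienerHopfFactorization Ω)

/-- The numerator of the zero function vanishes at the origin, which is not on the circle. -/
theorem φ_ne_zero (j : Fin m) : W.φ j ≠ 0 := fun h => by
  have h0 := W.φ_zeros j 0 (by rw [h]; simp)
  simp at h0

/-- The determinant of a triangular matrix is the product of its diagonal, and the divisors of `z^N`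
are the monomials `c z^n` with `n ≤ N`. -/
theorem exists_P₀_diag (j : Fin m) : ∃ (c : ℂ) (n : ℕ), c ≠ 0 ∧ W.P₀ j j = C c * X ^ n := by
  obtain ⟨N, hN⟩ := W.P₀_det
  have hdet : W.P₀.det = ∏ i, W.P₀ i i :=
    Matrix.det_of_isLowerTriangular _ fun i j hij => W.P₀_lower i j hij
  have hdvd : W.P₀ j j ∣ X ^ N := by
    rw [← hN, hdet]
    exact Finset.dvd_prod_of_mem _ (Finset.mem_univ j)
  obtain ⟨n, -, u, hu⟩ := (dvd_prime_pow prime_X N).1 hdvd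
  obtain ⟨c, hc, hcu⟩ := Polynomial.isUnit_iff.1 (u⁻¹).isUnit
  refine ⟨c, n, hc.ne_zero, ?_⟩
  rw [hcu, mul_comm, ← hu, mul_assoc, Units.mul_inv, mul_one]

theorem P₀_diag_ne_zero (j : Fin m) : W.P₀ j j ≠ 0 := by
  obtain ⟨c, n, hc, h⟩ := W.exists_P₀_diag j
  rw [h]
  exact mul_ne_zero (C_ne_zero.2 hc) (pow_ne_zero _ X_ne_zero)

theorem q_ne_zero (j : Fin m) : W.q j ≠ 0 := RatFunc.denom_ne_zero _

theorem num_diag_ne_zero (j : Fin m) : W.num j j ≠ 0 :=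
  mul_ne_zero (RatFunc.num_ne_zero (W.φ_ne_zero j)) (W.P₀_diag_ne_zero j)

theorem norm_le_one_of_num_diag_root (j : Fin m) (z : ℂ) (hz : (W.num j j).IsRoot z) :
    ‖z‖ ≤ 1 := by
  rcases root_mul.1 hz with h | h
  · exact (W.φ_zeros j z h).le
  · obtain ⟨c, n, hc, he⟩ := W.exists_P₀_diag j
    rw [he] at h
    have : z = 0 ∧ n ≠ 0 := by simpa [hc] using h
    simp [this.1]

theorem norm_le_one_of_den_root (k : ℕ) (j : Fin m) (z : ℂ) (hz : (X ^ k * W.q j).IsRoot z) :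
    ‖z‖ ≤ 1 := by
  rcases root_mul.1 hz with h | h
  · have : z = 0 ∧ k ≠ 0 := by simpa using h
    simp [this.1]
  · exact (W.φ_poles j z h).le

theorem middle_diag (j : Fin m) : W.middle j j = algebraMap ℂ[X] (RatFunc ℂ) (W.num j j) /
    algebraMap ℂ[X] (RatFunc ℂ) (X ^ W.k * W.q j) := by
  rw [middle_apply, map_mul, map_pow, RatFunc.algebraMap_X, inv_pow, inv_mul_eq_div, div_div,
    mul_comm (RatFunc.X ^ W.k)]

theorem middle_diag_ne_zero (j : Fin m) : W.middle j j ≠ 0 := by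
  rw [middle_diag]
  exact div_ne_zero (algebraMap_ne_zero (W.num_diag_ne_zero j))
    (algebraMap_ne_zero (mul_ne_zero (pow_ne_zero _ X_ne_zero) (W.q_ne_zero j)))

/-- The middle factor with its columns divided by their diagonal entries. -/
noncomputable def unipotent : Matrix (Fin m) (Fin m) (RatFunc ℂ) :=
  fun i j => W.middle i j / W.middle j j

theorem unipotent_mul_diagonal : W.unipotent * Matrix.diagonal (fun j => W.middle j j) = W.middle := by
  ext i j
  rw [Matrix.mul_diagonal, unipotent, div_mul_cancel₀ _ (W.middle_diag_ne_zero j)]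

theorem unipotent_diag (j : Fin m) : W.unipotent j j = 1 := div_self (W.middle_diag_ne_zero j)

theorem num_upper {i j : Fin m} (h : i < j) : W.num i j = 0 := by
  rw [num, W.P₀_lower i j h, mul_zero]

theorem unipotent_apply (i j : Fin m) : W.unipotent i j =
    algebraMap ℂ[X] (RatFunc ℂ) (W.num i j * W.q j) /
      algebraMap ℂ[X] (RatFunc ℂ) (W.q i * W.num j j) := by
  rw [unipotent, middle_apply, middle_apply, mul_div_mul_left _ _
    (pow_ne_zero _ (inv_ne_zero RatFunc.X_ne_zero)), div_div_div_eq, map_mul, map_mul]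

theorem unipotent_upper {i j : Fin m} (h : i < j) : W.unipotent i j = 0 := by
  rw [unipotent_apply, num_upper W h, zero_mul, map_zero, zero_div]

/-- This is where the special form enters: the entry is `p_ij q_j / (q_i p_jj)`, and its properness
is the assumed degree inequality. Its poles are among the zeros of `q_i` and `p_jj`, which lie on
the circle or at the origin. -/
theorem unipotent_mem_properDisk (hW : W.SpecialForm) (i j : Fin m) :
    W.unipotent i j ∈ properDisk := by
  rcases eq_or_ne (W.num i j) 0 with h0 | h0
  · rw [unipotent_apply, h0, zero_mul, map_zero, zero_div]
    exact zero_mem _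
  rcases lt_trichotomy i j with h | rfl | h
  · exact absurd (W.num_upper h) h0
  · rw [unipotent_diag]
    exact one_mem _
  · have hne := mul_ne_zero (W.q_ne_zero i) (W.num_diag_ne_zero j)
    rw [unipotent_apply]
    refine mem_properDisk.2 ⟨(inftyVal_div_le_one hne).2 ?_, div_mem_polesIn _ fun z hz => ?_⟩
    · have := hW j i h h0
      rw [kk] at this
      rw [degree_eq_natDegree (mul_ne_zero h0 (W.q_ne_zero j)), degree_eq_natDegree hne,
        natDegree_mul h0 (W.q_ne_zero j), natDegree_mul (W.q_ne_zero i) (W.num_diag_ne_zero j)]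
      exact_mod_cast (by omega : (W.num i j).natDegree + (W.q j).natDegree
        ≤ (W.q i).natDegree + (W.num j j).natDegree)
    · exact (root_mul.1 hz).elim (fun h => (W.φ_poles i z h).le)
        (W.norm_le_one_of_num_diag_root j z)

theorem exists_unipotent_inverse (hW : W.SpecialForm) :
    ∃ N : Matrix (Fin m) (Fin m) (RatFunc ℂ), (∀ i j, N i j ∈ properDisk) ∧
      N * W.unipotent = 1 ∧ W.unipotent * N = 1 := by
  -- The matrix is regarded over the subring `properDisk`. It has determinant `1` there, so its
  -- inverse has entries in the subring as well.
  let M : Matrix (Fin m) (Fin m) properDisk :=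
    fun i j => ⟨W.unipotent i j, W.unipotent_mem_properDisk hW i j⟩
  have hdet : M.det = 1 := by
    rw [Matrix.det_of_isLowerTriangular M fun i j hij => Subtype.ext (W.unipotent_upper hij)]
    exact Finset.prod_eq_one fun j _ => Subtype.ext (W.unipotent_diag j)
  have hu : IsUnit M.det := hdet ▸ isUnit_one
  have hM : M.map properDisk.subtype = W.unipotent := rfl
  refine ⟨M⁻¹.map properDisk.subtype, fun i j => (M⁻¹ i j).2, ?_, ?_⟩
  · rw [← hM, ← Matrix.map_mul, Matrix.nonsing_inv_mul _ hu, Matrix.map_one _ rfl rfl]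
  · rw [← hM, ← Matrix.map_mul, Matrix.mul_nonsing_inv _ hu, Matrix.map_one _ rfl rfl]

theorem eq_minus_mul_middle_mul_plus : Ω = W.minus * W.middle * W.plus := by
  conv_lhs => rw [W.factorization]
  rw [middle, Matrix.mul_smul, Matrix.smul_mul, ← mul_assoc]

theorem mem_properDisk_of_isMinus {A : Matrix (Fin m) (Fin m) (RatFunc ℂ)} (hA : IsMinus A)
    (i j : Fin m) : A i j ∈ properDisk :=
  mem_properDisk.2 ⟨(inftyVal_le_one_iff _).2 (hA.2 i j), fun z hz => by
    by_contra hlt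
    exact hA.1 i j z (le_of_not_ge hlt : 1 ≤ ‖z‖) hz⟩

theorem minus_mul_inv : W.minus * W.minus⁻¹ = 1 :=
  Matrix.mul_nonsing_inv _ ((Matrix.isUnit_iff_isUnit_det _).1 W.minus_isUnit)

theorem minus_inv_mul : W.minus⁻¹ * W.minus = 1 :=
  Matrix.nonsing_inv_mul _ ((Matrix.isUnit_iff_isUnit_det _).1 W.minus_isUnit)

theorem plus_mul_inv : W.plus * W.plus⁻¹ = 1 :=
  Matrix.mul_nonsing_inv _ ((Matrix.isUnit_iff_isUnit_det _).1 W.plus_isUnit)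

theorem plus_inv_mul : W.plus⁻¹ * W.plus = 1 :=
  Matrix.nonsing_inv_mul _ ((Matrix.isUnit_iff_isUnit_det _).1 W.plus_isUnit)

theorem mul_mem_properDisk {A B : Matrix (Fin m) (Fin m) (RatFunc ℂ)}
    (hA : ∀ i j, A i j ∈ properDisk) (hB : ∀ i j, B i j ∈ properDisk) (i j : Fin m) :
    (A * B) i j ∈ properDisk := by
  rw [Matrix.mul_apply]
  exact sum_mem fun l _ => mul_mem (hA i l) (hB l j)

/-- The invertible factor `Ω₋ M` of `Ω = (Ω₋ M) D Ω₊`, with `M` the unipotent factor and `D` the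
diagonal of the middle factor. -/
theorem exists_proper_factor (hW : W.SpecialForm) :
    ∃ U V : Matrix (Fin m) (Fin m) (RatFunc ℂ), (∀ i j, U i j ∈ properDisk) ∧
      (∀ i j, V i j ∈ properDisk) ∧ V * U = 1 ∧ U * V = 1 ∧ U = W.minus * W.unipotent := by
  obtain ⟨N, hN, hNM, hMN⟩ := W.exists_unipotent_inverse hW
  refine ⟨W.minus * W.unipotent, N * W.minus⁻¹,
    mul_mem_properDisk (mem_properDisk_of_isMinus W.minus_isMinus) (W.unipotent_mem_properDisk hW),
    mul_mem_properDisk hN (mem_properDisk_of_isMinus W.minus_inv_isMinus), ?_, ?_, rfl⟩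
  · rw [mul_assoc, ← mul_assoc _ W.minus, W.minus_inv_mul, one_mul, hNM]
  · rw [mul_assoc, ← mul_assoc _ N, hMN, one_mul, W.minus_mul_inv]

theorem diagonal_mulVec_boundary (d : Fin m → RatFunc ℂ) (x : Fin m → BoundaryFun) (i : Fin m) :
    ((Matrix.diagonal d).map boundary).mulVec x i = boundary (d i) * x i := by
  rw [Matrix.diagonal_map (map_zero _), Matrix.mulVec_diagonal]

theorem mem_polySpace_iff_middle (j : Fin m) (f : Hp p) :
    boundary (W.middle j j) * incl p f ∈ strictBdry ↔
      f ∈ polySpace p ((W.k : ℤ) + (W.q j).natDegree - W.kk j - 1) := by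
  have hX : (X ^ W.k * W.q j : ℂ[X]) ≠ 0 := mul_ne_zero (pow_ne_zero _ X_ne_zero) (W.q_ne_zero j)
  rw [middle_diag, div_mul_incl_mem_strictBdry_iff (W.num_diag_ne_zero j) hX
    (W.norm_le_one_of_num_diag_root j) (W.norm_le_one_of_den_root W.k j),
    natDegree_mul (pow_ne_zero _ X_ne_zero) (W.q_ne_zero j), natDegree_X_pow, kk, Nat.cast_add]

/-- Cancelling the unipotent factor leaves a diagonal symbol, so the condition splits into one
scalar condition for each component. -/
theorem opKer_middle (hW : W.SpecialForm) : opKer (toeplitz p W.middle) = Submodule.pi Set.univ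
    (fun j => polySpace p ((W.k : ℤ) + (W.q j).natDegree - W.kk j - 1)) := by
  obtain ⟨N, hN, hNM, -⟩ := W.exists_unipotent_inverse hW
  ext f
  rw [mem_opKer_toeplitz, ← W.unipotent_mul_diagonal]
  simp only [← mulVec_mulVec_boundary]
  rw [mulVec_mem_strictBdry_iff (W.unipotent_mem_properDisk hW) hN hNM, Submodule.mem_pi]
  simp only [diagonal_mulVec_boundary, Set.mem_univ, true_imp_iff]
  exact forall_congr' fun j => W.mem_polySpace_iff_middle j (f j)

/-- The left factor `Ω₋ M` cancels as a whole, and `Ω₊` only changes the variable; the dimension is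
therefore that of the kernel for the middle factor. -/
theorem opKer_eq_comap (hW : W.SpecialForm) : opKer (toeplitz p Ω) = (Submodule.pi Set.univ
    (fun j => polySpace p ((W.k : ℤ) + (W.q j).natDegree - W.kk j - 1))).comap
      (plusEquiv W.plus_isPlus W.plus_inv_isPlus W.plus_mul_inv W.plus_inv_mul).toLinearMap := by
  obtain ⟨U, V, hU, hV, hVU, -, hUe⟩ := W.exists_proper_factor hW
  ext f
  have hΩ : ∀ x, (Ω.map boundary).mulVec x = (U.map boundary).mulVec
      (((Matrix.diagonal fun j => W.middle j j).map boundary).mulVec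
        ((W.plus.map boundary).mulVec x)) := fun x => by
    rw [mulVec_mulVec_boundary, mulVec_mulVec_boundary, hUe, mul_assoc W.minus,
      W.unipotent_mul_diagonal, ← W.eq_minus_mul_middle_mul_plus]
  rw [mem_opKer_toeplitz, hΩ, mulVec_mem_strictBdry_iff hU hV hVU, Submodule.mem_comap, Submodule.mem_pi]
  simp only [diagonal_mulVec_boundary, Set.mem_univ, true_imp_iff]
  refine forall_congr' fun j => ?_
  rw [← inclVec_plusMul W.plus_isPlus]
  exact W.mem_polySpace_iff_middle j _

theorem finiteDimensional_opKer (hW : W.SpecialForm) :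
    FiniteDimensional ℂ (opKer (toeplitz p Ω)) ∧
    (Module.finrank ℂ (opKer (toeplitz p Ω)) : ℤ)
      = ∑ j, max ((W.k : ℤ) + (W.q j).natDegree - W.kk j) 0 := by
  rw [W.opKer_eq_comap hW]
  have e := LinearEquiv.ofSubmodule' (plusEquiv (p := p) W.plus_isPlus W.plus_inv_isPlus
    W.plus_mul_inv W.plus_inv_mul) (Submodule.pi Set.univ
    (fun j => polySpace p ((W.k : ℤ) + (W.q j).natDegree - W.kk j - 1)))
  have := finiteDimensional_pi_polySpace (p := p)
    fun j : Fin m => (W.k : ℤ) + (W.q j).natDegree - W.kk j - 1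
  refine ⟨e.symm.finiteDimensional, ?_⟩
  rw [e.finrank_eq, finrank_pi_polySpace]
  simp only [sub_add_cancel]

end WienerHopfFactorization

/-! ### Density of polynomials in `H^p` and continuity of Fourier coefficients. -/

section Density

variable {p : ℝ≥0∞} [Fact (1 ≤ p)]

theorem integral_norm_le_norm_Lp (f : Lp ℂ p circleMeasure) :
    ∫ t, ‖f t‖ ∂circleMeasure ≤ ‖f‖ := by
  have h := eLpNorm_le_eLpNorm_of_exponent_le (Fact.out : 1 ≤ p) (Lp.aestronglyMeasurable f)
  rw [Lp.norm_def, integral_norm_eq_lintegral_enorm (Lp.aestronglyMeasurable f),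
    ← eLpNorm_one_eq_lintegral_enorm]
  exact ENNReal.toReal_mono (Lp.eLpNorm_ne_top f) h

theorem integrable_continuous_mul (c : C(UnitAddCircle, ℂ)) (f : Lp ℂ p circleMeasure) :
    Integrable (fun t => c t * f t) circleMeasure :=
  (integrable_Lp p f).bdd_mul (c := ‖c‖) c.continuous.aestronglyMeasurable
    (ae_of_all _ fun t => c.norm_coe_le_norm t)

/-- The Fourier coefficients of `c f`, with `c` continuous, as functionals of `f ∈ L^p`. -/
noncomputable def coeffMulL (p : ℝ≥0∞) [Fact (1 ≤ p)] (c : C(UnitAddCircle, ℂ)) (n : ℤ) :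
    Lp ℂ p circleMeasure →L[ℂ] ℂ :=
  LinearMap.mkContinuous
    { toFun := fun f => fourierCoeff (fun t => c t * f t) n
      map_add' := fun f g => by
        rw [← fourierCoeff_add' (integrable_continuous_mul c f) (integrable_continuous_mul c g)]
        refine congrFun (fourierCoeff_congr_ae ?_) n
        filter_upwards [Lp.coeFn_add f g] with t ht
        rw [ht, Pi.add_apply, mul_add]
      map_smul' := fun a f => by
        rw [RingHom.id_apply, smul_eq_mul, ← fourierCoeff.const_mul]
        refine congrFun (fourierCoeff_congr_ae ?_) n
        filter_upwards [Lp.coeFn_smul a f] with t ht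
        rw [ht, Pi.smul_apply, smul_eq_mul, mul_left_comm] } ‖c‖ fun f => by
    refine (norm_fourierCoeff_le _ n).trans ?_
    refine le_trans ?_ (mul_le_mul_of_nonneg_left (integral_norm_le_norm_Lp f) (norm_nonneg c))
    rw [← integral_const_mul]
    refine integral_mono (integrable_continuous_mul c f).norm
      ((integrable_Lp p f).norm.const_mul _) fun t => ?_
    simp only [norm_mul]
    exact mul_le_mul_of_nonneg_right (c.norm_coe_le_norm t) (norm_nonneg _)

/-- Translation on `L^p`. -/
noncomputable def translate (s : UnitAddCircle) :
    Lp ℂ p circleMeasure →ₗᵢ[ℂ] Lp ℂ p circleMeasure :=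
  Lp.compMeasurePreservingₗᵢ ℂ (s +ᵥ ·) (measurePreserving_vadd s circleMeasure)

theorem coeFn_translate (s : UnitAddCircle) (f : Lp ℂ p circleMeasure) :
    translate s f =ᵐ[circleMeasure] fun t => f (s + t) :=
  Lp.coeFn_compMeasurePreserving f (measurePreserving_vadd s circleMeasure)

theorem translate_zero (f : Lp ℂ p circleMeasure) : translate 0 f = f := by
  refine Lp.ext ?_
  filter_upwards [coeFn_translate 0 f] with t ht
  rw [ht, zero_add]

theorem continuous_translate (hp : p ≠ ∞) (f : Lp ℂ p circleMeasure) :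
    Continuous fun s : UnitAddCircle => translate s f := by
  have : Fact (p ≠ ∞) := ⟨hp⟩
  -- By definition `translate s f` is the domain action of `s` on `f`, and this action on `L^p` is
  -- continuous for finite `p`.
  have h : Continuous fun s : UnitAddCircle => (DomAddAct.mk s) +ᵥ f :=
    (DomAddAct.continuous_mk).vadd continuous_const
  exact h

theorem translate_fourierLp (s : UnitAddCircle) (k : ℤ) :
    translate s (fourierLp p k : Lp ℂ p circleMeasure) = fourier k s • fourierLp p k := by
  refine Lp.ext ?_
  have h := (measurePreserving_vadd s circleMeasure).quasiMeasurePreserving.ae_eq_comp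
    (coeFn_fourierLp p k)
  filter_upwards [coeFn_translate s (fourierLp p k), coeFn_fourierLp p k, h,
    Lp.coeFn_smul (fourier k s) (fourierLp p k : Lp ℂ p circleMeasure)] with t h1 h2 h3 h4
  rw [h1, h4, Pi.smul_apply, h2, smul_eq_mul]
  refine h3.trans ?_
  simp only [Function.comp_apply, vadd_eq_add, fourier_apply, smul_add, AddCircle.toCircle_add,
    Circle.coe_mul]

/-- The Fourier coefficients of `s ↦ Λ (translate s f)`, as functionals of `f`. -/
noncomputable def coeffTranslateL (hp : p ≠ ∞) (Λ : Lp ℂ p circleMeasure →L[ℂ] ℂ) (n : ℤ) :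
    Lp ℂ p circleMeasure →L[ℂ] ℂ :=
  LinearMap.mkContinuous
    { toFun := fun f => fourierCoeff (fun s => Λ (translate s f)) n
      map_add' := fun f g => by
        simp only [map_add]
        exact fourierCoeff_add' (integrable_of_continuous (Λ.continuous.comp
          (continuous_translate hp f))) (integrable_of_continuous (Λ.continuous.comp
          (continuous_translate hp g))) n
      map_smul' := fun a f => by
        rw [RingHom.id_apply, smul_eq_mul, ← fourierCoeff.const_mul]
        simp only [map_smul, smul_eq_mul] } ‖Λ‖ fun f => by
    refine (norm_fourierCoeff_le _ n).trans ?_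
    have h : ∀ s : UnitAddCircle, ‖Λ (translate s f)‖ ≤ ‖Λ‖ * ‖f‖ := fun s => by
      simpa using Λ.le_opNorm (translate s f)
    refine (integral_mono (integrable_of_continuous (Λ.continuous.comp
      (continuous_translate hp f))).norm (integrable_const (‖Λ‖ * ‖f‖)) h).trans ?_
    simp

/-- Both sides are continuous and linear in `f`, so it suffices to compare them on the characters,
whose span is dense and which are eigenvectors of every translation. -/
theorem fourierCoeff_translate (hp : p ≠ ∞) (Λ : Lp ℂ p circleMeasure →L[ℂ] ℂ) (n : ℤ)
    (f : Lp ℂ p circleMeasure) : fourierCoeff (fun s => Λ (translate s f)) n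
      = fourierCoeff f n * Λ (fourierLp p n) := by
  have hd : Dense ((Submodule.span ℂ (Set.range (@fourierLp 1 _ p _)) :
      Submodule ℂ (Lp ℂ p circleMeasure)) : Set (Lp ℂ p circleMeasure)) := by
    rw [Submodule.dense_iff_topologicalClosure_eq_top]
    exact span_fourierLp_closure_eq_top hp
  have h := ContinuousLinearMap.ext_on hd (f := coeffTranslateL hp Λ n)
    (g := Λ (fourierLp p n) • coeffMulL p 1 n) (by
      rintro _ ⟨k, rfl⟩
      change fourierCoeff (fun s => Λ (translate s (fourierLp p k))) n = Λ (fourierLp p n) *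
        fourierCoeff (fun t => (1 : ℂ) * (fourierLp p k : Lp ℂ p circleMeasure) t) n
      simp only [translate_fourierLp, map_smul, smul_eq_mul, one_mul]
      rw [fourierCoeff_congr_ae (coeFn_fourierLp p k), fourierCoeff_fourier]
      have h1 := fourierCoeff.const_mul (T := 1) (fourier k) (Λ (fourierLp p k)) n
      rw [fourierCoeff_fourier] at h1
      simp only [mul_comm _ (Λ (fourierLp p k))]
      rw [h1]
      rcases eq_or_ne n k with rfl | hnk
      · rfl
      · simp [hnk])
  have h2 := congrArg (fun L => L f) h
  refine h2.trans ?_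
  change Λ (fourierLp p n) * fourierCoeff (fun t => (1 : ℂ) * f t) n = _
  simp only [one_mul]
  exact mul_comm _ _

/-- Density of the analytic trigonometric polynomials in `H^p`. -/
theorem mem_closure_span_fourierLp (hp : p ≠ ∞) (f : Hp p) : (f : Lp ℂ p circleMeasure) ∈
    (Submodule.span ℂ (Set.range fun n : ℕ => (fourierLp p n : Lp ℂ p circleMeasure))
      ).topologicalClosure := by
  set S := (Submodule.span ℂ (Set.range fun n : ℕ => (fourierLp p n : Lp ℂ p circleMeasure))
    ).topologicalClosure with hS
  by_contra hf
  have hcl : IsClosed (S : Set (Lp ℂ p circleMeasure)) := Submodule.isClosed_topologicalClosure _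
  have hq : ‖S.mkQ f‖ ≠ 0 := by
    intro h0
    have h1 : (f : Lp ℂ p circleMeasure) ∈ closure (S : Set (Lp ℂ p circleMeasure)) :=
      (QuotientAddGroup.norm_mk_eq_zero_iff_mem_closure (S := S.toAddSubgroup)).1 h0
    rw [hcl.closure_eq] at h1
    exact hf h1
  -- Hahn–Banach in the quotient by the closed span: `Λ` annihilates all `z^n` with `n ≥ 0` but not
  -- `f`.
  obtain ⟨g, -, hg⟩ := exists_dual_vector ℂ (S.mkQ f) hq
  let Λ : Lp ℂ p circleMeasure →L[ℂ] ℂ := g.comp S.mkQL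
  have hΛ : ∀ n : ℕ, Λ (fourierLp p n) = 0 := fun n => by
    have : S.mkQ (fourierLp p n : Lp ℂ p circleMeasure) = 0 := by
      rw [Submodule.mkQ_apply, Submodule.Quotient.mk_eq_zero]
      exact Submodule.le_topologicalClosure _ (Submodule.subset_span ⟨n, rfl⟩)
    change g (S.mkQ _) = 0
    rw [this, map_zero]
  have hc : Continuous fun s : UnitAddCircle => Λ (translate s (f : Lp ℂ p circleMeasure)) :=
    Λ.continuous.comp (continuous_translate hp _)
  -- The function `s ↦ Λ (translate s f)` has coefficients `f_n Λ(z^n)`, which vanish for `n < 0`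
  -- because of `f` and for `n ≥ 0` because of `Λ`. Being continuous, it vanishes also at `s = 0`,
  -- where it equals `Λ f`.
  have hae := ae_eq_zero_of_fourierCoeff (integrable_of_continuous hc) fun n => by
    rw [fourierCoeff_translate hp]
    rcases lt_or_ge n 0 with hn | hn
    · rw [f.2 n hn, zero_mul]
    · lift n to ℕ using hn
      rw [hΛ, mul_zero]
  have h0 := congrFun (Continuous.ae_eq_iff_eq circleMeasure hc continuous_zero |>.1 hae) 0
  simp only [translate_zero] at h0
  have h1 : g (S.mkQ (f : Lp ℂ p circleMeasure)) = 0 := h0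
  rw [hg] at h1
  exact hq (Complex.ofReal_eq_zero.1 h1)

theorem dense_range_polyHp (hp : p ≠ ∞) : Dense (Set.range (polyHp p)) := by
  intro f
  rw [Metric.mem_closure_iff]
  intro ε hε
  obtain ⟨y, hy, hd⟩ := Metric.mem_closure_iff.1 (mem_closure_span_fourierLp hp f) ε hε
  have : ∃ u : Polynomial ℂ, ((polyHp p u : Hp p) : Lp ℂ p circleMeasure) = y := by
    have hle : Submodule.span ℂ (Set.range fun n : ℕ => (fourierLp p n : Lp ℂ p circleMeasure))
        ≤ LinearMap.range ((Hp p).subtype.comp (polyHp p)) := by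
      rw [Submodule.span_le]
      rintro _ ⟨n, rfl⟩
      refine ⟨Polynomial.X ^ n, Subtype.ext ?_⟩
      refine (incl_polyHp (p := p) (Polynomial.X ^ n)).trans (AEEqFun.ext ?_)
      filter_upwards [coeFn_bpoly (Polynomial.X ^ n), coeFn_fourierLp p n] with t h1 h2
      rw [h1, h2, Polynomial.eval_pow, Polynomial.eval_X, fourier_apply, natCast_zsmul,
        AddCircle.toCircle_nsmul, Circle.coe_pow]
      rfl
    exact hle hy
  obtain ⟨u, rfl⟩ := this
  exact ⟨_, ⟨u, rfl⟩, hd⟩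

theorem exists_coeff_functional (p : ℝ≥0∞) [Fact (1 ≤ p)] {r : RatFunc ℂ}
    (hr : r ∈ polesIn {z | ‖z‖ ≠ 1}) (n : ℤ) :
    ∃ L : Hp p →L[ℂ] ℂ, ∀ f, L f = fourierCoeff (boundary r * incl p f : BoundaryFun) n := by
  obtain ⟨c, hc⟩ := exists_continuous_boundary hr
  refine ⟨(coeffMulL p c n).comp (Hp p).subtypeL, fun f => ?_⟩
  refine congrFun (fourierCoeff_congr_ae ?_) n
  filter_upwards [hc, AEEqFun.coeFn_mul (boundary r) (incl p f)] with t h1 h2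
  rw [h2, Pi.mul_apply, h1]
  rfl

end Density

/-! ### Coefficient criteria for strict properness, and density of the domain. -/

section Fredholm

open Polynomial

variable {p : ℝ≥0∞} [Fact (1 ≤ p)] {m : ℕ}

theorem fourierCoeff_X_pow_mul (a : ℕ) (x : BoundaryFun) (n : ℤ) :
    fourierCoeff (bpoly (X ^ a) * x : BoundaryFun) n = fourierCoeff x (n - a) := by
  rw [fourierCoeff_congr_ae (coeFn_bpoly_mul _ x)]
  simp only [eval_pow, eval_X]
  exact fourierCoeff_pow_mul a x n

/-- Membership of `x` in `strictBdry` in terms of the Fourier coefficients of `q x`. -/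
theorem mem_strictBdry_iff_degLT {x : BoundaryFun} {q : ℂ[X]} (hq : q ≠ 0)
    (hr : ∀ z, q.IsRoot z → ‖z‖ ≤ 1) (hi : Integrable (bpoly q * x : BoundaryFun) circleMeasure)
    {h : Hp p} (hh : bpoly q * x - incl p h ∈ strictBdry) :
    x ∈ strictBdry ↔ DegLT (bpoly q * x) q.natDegree := by
  constructor
  · rintro ⟨ρ, hρ, rfl⟩
    exact degLT_of_mem_strictDisk hρ hq hi
  · intro hd
    have hσi := integrable_aesub hi (analytic_incl h).1
    have hσ : DegLT (bpoly q * x - incl p h) 0 := by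
      obtain ⟨ρ, hρ, he⟩ := mem_strictBdry.1 hh
      rw [← he] at hσi ⊢
      exact degLT_boundary hρ hσi
    have hhd : DegLT (incl p h) q.natDegree := by
      have := hd.sub (hσ.mono (Int.natCast_nonneg q.natDegree))
      rwa [sub_sub_cancel] at this
    obtain ⟨u, hu, hhu⟩ := exists_eq_bpoly (analytic_incl h) hhd
    have hinv : boundary (algebraMap ℂ[X] (RatFunc ℂ) q)⁻¹ * bpoly q = 1 := by
      rw [bpoly, ← map_mul, inv_mul_cancel₀ (algebraMap_ne_zero hq), map_one]
    -- The `H^p` part of `q x` is a polynomial `u` with `deg u < deg q`, so `x` is `u / q` plus a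
    -- strictly proper remainder divided by `q`.
    have hx : x = boundary (algebraMap ℂ[X] (RatFunc ℂ) u / algebraMap ℂ[X] (RatFunc ℂ) q)
        + boundary (algebraMap ℂ[X] (RatFunc ℂ) q)⁻¹ * (bpoly q * x - incl p h) := by
      rw [div_eq_inv_mul, map_mul]
      change x = _ * bpoly u + _
      rw [← hhu]
      linear_combination (-x) * hinv
    rw [hx]
    refine add_mem (boundary_mem_strictBdry.2 ⟨(inftyVal_div_lt_one hq).2 ?_,
      div_mem_polesIn u hr⟩) (mul_mem_strictBdry (inv_mem_properDisk hq hr) hh)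
    rw [degree_eq_natDegree hq, degree_lt_iff_coeff_zero]
    exact fun i hi => hu i (by exact_mod_cast hi)

theorem integrable_mulVec_inclVec {A : Matrix (Fin m) (Fin m) (RatFunc ℂ)}
    (hA : ∀ i j, A i j ∈ polesIn {z | ‖z‖ ≠ 1}) (f : Fin m → Hp p) (i : Fin m) :
    Integrable ((A.map boundary).mulVec (inclVec f) i) circleMeasure := by
  refine integrable_of_mem_Lp (p := p) ?_
  change ∑ j, boundary (A i j) * incl p (f j) ∈ _
  exact sum_mem fun j _ => boundary_mul_mem_Lp (hA i j) (f j).1.2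

theorem exists_split_mulVec {A : Matrix (Fin m) (Fin m) (RatFunc ℂ)}
    (hA : ∀ i j, A i j ∈ polesIn {z | ‖z‖ ≠ 1}) (f : Fin m → Hp p) (i : Fin m) :
    ∃ h : Hp p, (A.map boundary).mulVec (inclVec f) i - incl p h ∈ strictBdry :=
  exists_split_sum (hA i) f

theorem exists_coeff_mulVec (p : ℝ≥0∞) [Fact (1 ≤ p)] {A : Matrix (Fin m) (Fin m) (RatFunc ℂ)}
    (hA : ∀ i j, A i j ∈ polesIn {z | ‖z‖ ≠ 1}) (i : Fin m) (n : ℤ) :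
    ∃ L : (Fin m → Hp p) →L[ℂ] ℂ,
      ∀ f, L f = fourierCoeff ((A.map boundary).mulVec (inclVec f) i) n := by
  choose L hL using fun j => exists_coeff_functional p (hA i j) n
  refine ⟨∑ j, (L j).comp (ContinuousLinearMap.proj j), fun f => ?_⟩
  have h1 : ∀ s : Finset (Fin m), Integrable (∑ j ∈ s, boundary (A i j) * incl p (f j) :
      BoundaryFun) circleMeasure ∧ ∑ j ∈ s, L j (f j)
        = fourierCoeff (∑ j ∈ s, boundary (A i j) * incl p (f j) : BoundaryFun) n := by
    intro s
    induction s using Finset.induction_on with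
    | empty =>
      have h0 : bpoly 0 = 0 := by simp [bpoly]
      rw [Finset.sum_empty, Finset.sum_empty, ← h0]
      exact ⟨integrable_bpoly 0, by rw [fourierCoeff_bpoly]; simp⟩
    | insert a s ha ih =>
      have hi : Integrable (boundary (A i a) * incl p (f a) : BoundaryFun) circleMeasure :=
        integrable_of_mem_Lp (boundary_mul_mem_Lp (hA i a) (f a).1.2)
      rw [Finset.sum_insert ha, Finset.sum_insert ha]
      exact ⟨integrable_aeadd hi ih.1, by rw [fourierCoeff_aeadd hi ih.1, hL, ih.2]⟩
  rw [_root_.sum_apply]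
  exact (h1 Finset.univ).2

/-- For a polynomial vector `u` the product `Ω u` is rational, and every rational function is an
element of `H^p` up to a strictly proper one; so polynomial vectors lie in the domain. -/
theorem dense_toeplitz_domain (hp : p ≠ ∞) (Ω : Matrix (Fin m) (Fin m) (RatFunc ℂ)) :
    Dense ((toeplitz p Ω).domain : Set (Fin m → Hp p)) := by
  refine (dense_pi (s := fun _ : Fin m => Set.range (polyHp p)) Set.univ
    fun i _ => dense_range_polyHp hp).mono ?_
  intro f hf
  choose u hu using fun i => hf i trivial
  choose g hg using fun i =>
    exists_split_boundary p (∑ j, Ω i j * algebraMap ℂ[X] (RatFunc ℂ) (u j))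
  have hgr : (f, g) ∈ (toeplitz p Ω).graph := by
    rw [mem_toeplitz_graph_iff, isToeplitzValue_iff]
    intro i
    convert hg i using 1
    rw [map_sum]
    change ∑ j, boundary (Ω i j) * incl p (f j) - incl p (g i) = _
    congr 1
    refine Finset.sum_congr rfl fun j _ => ?_
    rw [← hu j, incl_polyHp, map_mul]
  obtain ⟨y, hy, -⟩ := (LinearPMap.mem_graph_iff _).1 hgr
  have := y.2
  rwa [show (y : Fin m → Hp p) = f from hy] at this

end Fredholm

/-! ### Symbols without zeroes on the circle. -/

namespace WienerHopfFactorization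

open Polynomial

variable {p : ℝ≥0∞} [Fact (1 ≤ p)] {m : ℕ} {Ω : Matrix (Fin m) (Fin m) (RatFunc ℂ)}
  (W : WienerHopfFactorization Ω)

theorem isUnit_middle (hW : W.SpecialForm) : IsUnit W.middle := by
  obtain ⟨N, -, h1, h2⟩ := W.exists_unipotent_inverse hW
  rw [← W.unipotent_mul_diagonal]
  refine IsUnit.mul (IsUnit.of_mul_eq_one N h2) ?_
  rw [Matrix.isUnit_iff_isUnit_det, Matrix.det_diagonal]
  exact (Finset.prod_ne_zero_iff.2 fun j _ => W.middle_diag_ne_zero j).isUnit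

theorem isUnit_self (hW : W.SpecialForm) : IsUnit Ω := by
  have h := (W.minus_isUnit.mul (W.isUnit_middle hW)).mul W.plus_isUnit
  rwa [← W.eq_minus_mul_middle_mul_plus] at h

theorem mul_mem_polesIn {S : Set ℂ} {A B : Matrix (Fin m) (Fin m) (RatFunc ℂ)}
    (hA : ∀ i j, A i j ∈ polesIn S) (hB : ∀ i j, B i j ∈ polesIn S) (i j : Fin m) :
    (A * B) i j ∈ polesIn S := by
  rw [Matrix.mul_apply]
  exact sum_mem fun l _ => mul_mem (hA i l) (hB l j)

theorem X_inv_pow_mem_polesIn (k : ℕ) : (RatFunc.X⁻¹ ^ k : RatFunc ℂ) ∈ polesIn {z | ‖z‖ ≠ 1} := by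
  refine pow_mem ?_ k
  rw [← RatFunc.algebraMap_X]
  exact inv_mem_polesIn fun z hz => by
    have : z = 0 := by simpa using hz
    simp [this]

theorem plus_mem_polesIn (i j : Fin m) : W.plus i j ∈ polesIn {z | ‖z‖ ≠ 1} :=
  fun z hz h1 => W.plus_isPlus i j z (le_of_eq h1) hz

theorem minus_mem_polesIn (i j : Fin m) : W.minus i j ∈ polesIn {z | ‖z‖ ≠ 1} :=
  fun z hz h1 => W.minus_isMinus.1 i j z (ge_of_eq h1) hz

theorem minus_inv_mem_polesIn (i j : Fin m) : W.minus⁻¹ i j ∈ polesIn {z | ‖z‖ ≠ 1} :=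
  fun z hz h1 => W.minus_inv_isMinus.1 i j z (ge_of_eq h1) hz

/-- Solving the factorization for `Ω₀⁻¹` gives `z^{-k} P₀ Ω₊ Ω⁻¹ Ω₋`, in which no factor has a pole
on the circle; `φ_j⁻¹` is a diagonal entry. -/
theorem φ_inv_mem_polesIn (hW : W.SpecialForm) (hz : NoZerosOnCircle Ω) (j : Fin m) :
    (W.φ j)⁻¹ ∈ polesIn {z | ‖z‖ ≠ 1} := by
  set P := W.P₀.map (algebraMap ℂ[X] (RatFunc ℂ)) with hP
  set Y := (RatFunc.X⁻¹ ^ W.k : RatFunc ℂ) • (P * W.plus * Ω⁻¹) with hY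
  have h1 : W.minus * (Matrix.diagonal W.φ * Y) = 1 := by
    rw [← Matrix.mul_nonsing_inv Ω ((Matrix.isUnit_iff_isUnit_det _).1 (W.isUnit_self hW)),
      hY, Matrix.mul_smul, Matrix.mul_smul]
    conv_rhs => enter [1]; rw [W.factorization]
    rw [Matrix.smul_mul]
    simp only [mul_assoc, hP]
  have h2 : Matrix.diagonal W.φ * (Y * W.minus) = 1 := by
    rw [← mul_assoc]
    exact mul_eq_one_comm.1 h1
  have h3 := congrFun (congrFun h2 j) j
  rw [Matrix.diagonal_mul, Matrix.one_apply_eq] at h3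
  rw [inv_eq_of_mul_eq_one_right h3]
  refine mul_mem_polesIn (fun i j => ?_) W.minus_mem_polesIn j j
  rw [hY, Matrix.smul_apply]
  refine mul_mem (X_inv_pow_mem_polesIn _) (mul_mem_polesIn (mul_mem_polesIn
    (fun i j => algebraMap_mem_polesIn _ _) W.plus_mem_polesIn) (fun i j z h h1 => ?_) i j)
  exact hz i j z h1 h

/-- A zero of the numerator would lie on the circle and, by coprimality with the denominator, would
be a pole of `φ_j⁻¹` there. -/
theorem φ_num_eq_C (hW : W.SpecialForm) (hz : NoZerosOnCircle Ω) (j : Fin m) :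
    ∃ c : ℂ, c ≠ 0 ∧ (W.φ j).num = C c := by
  have hφ := W.φ_inv_mem_polesIn hW hz j
  have h0 : (W.φ j).num ≠ 0 := RatFunc.num_ne_zero (W.φ_ne_zero j)
  have hroot : ∀ z, ¬ (W.φ j).num.IsRoot z := by
    intro z hroot
    have h1 := W.φ_zeros j z hroot
    have h2 : (W.φ j)⁻¹.denom.eval z ≠ 0 := fun h => hφ z h h1
    have h3 : (W.φ j)⁻¹.num * (W.φ j).num = (W.φ j)⁻¹.denom * (W.φ j).denom := by
      refine RatFunc.algebraMap_injective ℂ ?_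
      rw [map_mul, map_mul]
      have e1 := RatFunc.num_div_denom (W.φ j)
      have e2 := RatFunc.num_div_denom (W.φ j)⁻¹
      rw [div_eq_iff (algebraMap_ne_zero (RatFunc.denom_ne_zero _))] at e1 e2
      rw [e1, e2]
      field_simp [W.φ_ne_zero j]
    have h4 := congrArg (eval z) h3
    rw [eval_mul, eval_mul, hroot.eq_zero, mul_zero] at h4
    have h5 : (W.φ j).denom.eval z = 0 := (mul_eq_zero.1 h4.symm).resolve_left h2
    obtain ⟨a, b, hab⟩ := RatFunc.isCoprime_num_denom (W.φ j)
    have h6 := congrArg (eval z) hab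
    rw [eval_add, eval_mul, eval_mul, hroot.eq_zero, h5] at h6
    simp at h6
  have hdeg : (W.φ j).num.degree = 0 := by
    by_contra hne
    obtain ⟨z, hz⟩ := IsAlgClosed.exists_root _ hne
    exact hroot z hz
  refine ⟨(W.φ j).num.coeff 0, fun hc => h0 ?_, eq_C_of_degree_eq_zero hdeg⟩
  rw [eq_C_of_degree_eq_zero hdeg, hc, C_0]

theorem num_diag_eq (hW : W.SpecialForm) (hz : NoZerosOnCircle Ω) (j : Fin m) :
    ∃ c : ℂ, c ≠ 0 ∧ W.num j j = C c * X ^ W.kk j := by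
  obtain ⟨c, hc, h1⟩ := W.φ_num_eq_C hW hz j
  obtain ⟨c', n, hc', h2⟩ := W.exists_P₀_diag j
  have h3 : W.num j j = C (c * c') * X ^ n := by rw [num, h1, h2, C_mul, mul_assoc]
  have h4 : W.kk j = n := by
    rw [kk, h3, natDegree_C_mul_X_pow _ _ (mul_ne_zero hc hc')]
  exact ⟨c * c', mul_ne_zero hc hc', by rw [h4, h3]⟩

/-- For `Ω` without zeroes on the circle, the inverse of the unipotent factor has no poles on the
circle after multiplication by the `q_i`. -/
theorem q_mul_unipotent_inv_mem (hW : W.SpecialForm) (hz : NoZerosOnCircle Ω)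
    {N : Matrix (Fin m) (Fin m) (RatFunc ℂ)} (hN : W.unipotent * N = 1) (i j : Fin m) :
    (Matrix.diagonal (fun i => algebraMap ℂ[X] (RatFunc ℂ) (W.q i)) * N) i j
      ∈ polesIn {z | ‖z‖ ≠ 1} := by
  obtain ⟨e, he⟩ := W.P₀_det
  set P := W.P₀.map (algebraMap ℂ[X] (RatFunc ℂ)) with hP
  -- The inverse of `P₀` is `z^{-e}` times its adjugate, with no pole except possibly at the origin.
  set Q : Matrix (Fin m) (Fin m) (RatFunc ℂ) :=
    (RatFunc.X⁻¹ ^ e : RatFunc ℂ) • W.P₀.adjugate.map (algebraMap ℂ[X] (RatFunc ℂ)) with hQ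
  have hX : (RatFunc.X : RatFunc ℂ) ^ e ≠ 0 := pow_ne_zero _ RatFunc.X_ne_zero
  have hQP : Q * P = 1 := by
    rw [hQ, hP, Matrix.smul_mul, ← Matrix.map_mul, Matrix.adjugate_mul, he]
    ext a b
    rcases eq_or_ne a b with rfl | hab
    · simp [hX]
    · simp [hab]
  -- Inverting `M = Ω₀ P₀ diag(q_j / p_jj)` gives `diag(q) M⁻¹ = diag(p_jj) P₀⁻¹ Ω₀⁻¹`, and the
  -- right-hand side has no poles on the circle.
  set R := Matrix.diagonal (fun j => algebraMap ℂ[X] (RatFunc ℂ) (W.num j j)) * Q *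
    Matrix.diagonal fun j => (W.φ j)⁻¹ with hR
  have hu : W.unipotent = Matrix.diagonal W.φ * P * Matrix.diagonal fun j =>
      algebraMap ℂ[X] (RatFunc ℂ) (W.q j) / algebraMap ℂ[X] (RatFunc ℂ) (W.num j j) := by
    ext a b
    rw [Matrix.mul_diagonal, Matrix.diagonal_mul, hP, Matrix.map_apply, unipotent_apply, num, q,
      map_mul, map_mul, map_mul]
    conv_rhs => rw [← RatFunc.num_div_denom (W.φ a)]
    rw [div_mul_eq_mul_div, div_mul_div_comm, q]
  have hRu : R * W.unipotent = Matrix.diagonal fun i => algebraMap ℂ[X] (RatFunc ℂ) (W.q i) := by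
    have hd : (Matrix.diagonal fun j => (W.φ j)⁻¹) * Matrix.diagonal W.φ = 1 := by
      rw [Matrix.diagonal_mul_diagonal, ← Matrix.diagonal_one]
      exact congrArg _ (funext fun j => inv_mul_cancel₀ (W.φ_ne_zero j))
    rw [hR, hu, mul_assoc, ← mul_assoc _ (Matrix.diagonal W.φ * P), ← mul_assoc _ _ P, hd, one_mul,
      mul_assoc, ← mul_assoc Q, hQP, one_mul, Matrix.diagonal_mul_diagonal]
    exact congrArg _ (funext fun j =>
      mul_div_cancel₀ _ (algebraMap_ne_zero (W.num_diag_ne_zero j)))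
  rw [← hRu, mul_assoc, hN, mul_one, hR, Matrix.mul_diagonal, Matrix.diagonal_mul, hQ,
    Matrix.smul_apply]
  exact mul_mem (mul_mem (algebraMap_mem_polesIn _ _) (mul_mem (X_inv_pow_mem_polesIn e)
    (algebraMap_mem_polesIn _ _))) (W.φ_inv_mem_polesIn hW hz j)

/-- The factors `Ω = U D Ω₊` and `diag(q) (D Ω₊ f - U⁻¹ g) = A f - B g`, where `D` is the diagonal of
the middle factor, `U` is invertible over the proper functions with poles in the closed disk, and
`A` and `B` have no poles on the circle. -/
structure CircleFactorization where
  /-- the factor `U` -/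
  U : Matrix (Fin m) (Fin m) (RatFunc ℂ)
  /-- the inverse of `U` -/
  V : Matrix (Fin m) (Fin m) (RatFunc ℂ)
  /-- the symbol acting on `f` -/
  A : Matrix (Fin m) (Fin m) (RatFunc ℂ)
  /-- the symbol acting on `g` -/
  B : Matrix (Fin m) (Fin m) (RatFunc ℂ)
  U_mem : ∀ i j, U i j ∈ properDisk
  V_mem : ∀ i j, V i j ∈ properDisk
  V_mul_U : V * U = 1
  U_mul_V : U * V = 1
  eq_mul : Ω = U * (Matrix.diagonal (fun j => W.middle j j) * W.plus)
  A_eq : A = Matrix.diagonal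
    (fun j => RatFunc.X⁻¹ ^ W.k * algebraMap ℂ[X] (RatFunc ℂ) (W.num j j)) * W.plus
  A_eq' : A = Matrix.diagonal (fun i => algebraMap ℂ[X] (RatFunc ℂ) (W.q i)) *
    (Matrix.diagonal (fun j => W.middle j j) * W.plus)
  B_eq : B = Matrix.diagonal (fun i => algebraMap ℂ[X] (RatFunc ℂ) (W.q i)) * V
  A_mem : ∀ i j, A i j ∈ polesIn {z | ‖z‖ ≠ 1}
  B_mem : ∀ i j, B i j ∈ polesIn {z | ‖z‖ ≠ 1}

theorem nonempty_circleFactorization (hW : W.SpecialForm) (hz : NoZerosOnCircle Ω) :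
    Nonempty W.CircleFactorization := by
  obtain ⟨N, hN, hNM, hMN⟩ := W.exists_unipotent_inverse hW
  refine ⟨⟨W.minus * W.unipotent, N * W.minus⁻¹,
    Matrix.diagonal (fun j => RatFunc.X⁻¹ ^ W.k * algebraMap ℂ[X] (RatFunc ℂ) (W.num j j)) * W.plus,
    Matrix.diagonal (fun i => algebraMap ℂ[X] (RatFunc ℂ) (W.q i)) * (N * W.minus⁻¹),
    mul_mem_properDisk (mem_properDisk_of_isMinus W.minus_isMinus) (W.unipotent_mem_properDisk hW),
    mul_mem_properDisk hN (mem_properDisk_of_isMinus W.minus_inv_isMinus), ?_, ?_, ?_, rfl, ?_,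
    rfl, ?_, ?_⟩⟩
  · rw [mul_assoc, ← mul_assoc _ W.minus, W.minus_inv_mul, one_mul, hNM]
  · rw [mul_assoc, ← mul_assoc _ N, hMN, one_mul, W.minus_mul_inv]
  · rw [← mul_assoc, mul_assoc W.minus, W.unipotent_mul_diagonal]
    exact W.eq_minus_mul_middle_mul_plus
  · rw [← mul_assoc, Matrix.diagonal_mul_diagonal]
    congr 2
    funext j
    rw [middle_apply, mul_left_comm, mul_div_cancel₀ _ (algebraMap_ne_zero (W.q_ne_zero j))]
  · intro i j
    rw [Matrix.diagonal_mul]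
    exact mul_mem (mul_mem (X_inv_pow_mem_polesIn _) (algebraMap_mem_polesIn _ _))
      (W.plus_mem_polesIn i j)
  · rw [← mul_assoc]
    exact mul_mem_polesIn (W.q_mul_unipotent_inv_mem hW hz hMN) W.minus_inv_mem_polesIn

end WienerHopfFactorization

/-! ### Closedness of the operator and description of its range. -/

namespace WienerHopfFactorization.CircleFactorization

open Polynomial

variable {p : ℝ≥0∞} [Fact (1 ≤ p)] {m : ℕ} {Ω : Matrix (Fin m) (Fin m) (RatFunc ℂ)}
  {W : WienerHopfFactorization Ω} (K : W.CircleFactorization)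

theorem norm_le_one_of_q_root (W : WienerHopfFactorization Ω) (i : Fin m) (z : ℂ)
    (hz : (W.q i).IsRoot z) : ‖z‖ ≤ 1 := (W.φ_poles i z hz).le

theorem B_mulVec (x : Fin m → BoundaryFun) (i : Fin m) : (K.B.map boundary).mulVec x i
    = bpoly (W.q i) * (K.V.map boundary).mulVec x i := by
  rw [K.B_eq, ← mulVec_mulVec_boundary, diagonal_mulVec_boundary]

theorem A_mulVec (f : Fin m → Hp p) (i : Fin m) : (K.A.map boundary).mulVec (inclVec f) i
    = boundary (RatFunc.X⁻¹ ^ W.k * algebraMap ℂ[X] (RatFunc ℂ) (W.num i i))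
      * incl p (plusMul W.plus_isPlus f i) := by
  rw [K.A_eq, ← mulVec_mulVec_boundary, diagonal_mulVec_boundary, ← inclVec_plusMul W.plus_isPlus]
  rfl

theorem X_pow_mul_A_mulVec (f : Fin m → Hp p) (i : Fin m) :
    bpoly (X ^ W.k) * (K.A.map boundary).mulVec (inclVec f) i
      = bpoly (W.num i i) * incl p (plusMul W.plus_isPlus f i) := by
  rw [A_mulVec, ← mul_assoc, bpoly, ← map_mul, ← mul_assoc, map_pow, RatFunc.algebraMap_X, inv_pow,
    mul_inv_cancel₀ (pow_ne_zero _ RatFunc.X_ne_zero), one_mul]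

/-- `T_Ω f = g` in terms of Fourier coefficients. -/
theorem isToeplitzValue_iff_coeff (f g : Fin m → Hp p) : IsToeplitzValue Ω f g ↔
    ∀ i, ∀ n : ℤ, ((W.q i).natDegree : ℤ) ≤ n →
      fourierCoeff ((K.A.map boundary).mulVec (inclVec f) i) n
        = fourierCoeff ((K.B.map boundary).mulVec (inclVec g) i) n := by
  obtain ⟨DP, hDP⟩ : ∃ DP, DP = Matrix.diagonal (fun j => W.middle j j) * W.plus := ⟨_, rfl⟩
  have hval : (Ω.map boundary).mulVec (inclVec f) - inclVec g = (K.U.map boundary).mulVec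
      ((DP.map boundary).mulVec (inclVec f) - (K.V.map boundary).mulVec (inclVec g)) := by
    rw [Matrix.mulVec_sub, mulVec_mulVec_boundary, mulVec_mulVec_boundary, hDP, ← K.eq_mul,
      K.U_mul_V, Matrix.map_one _ (map_zero _) (map_one _), Matrix.one_mulVec]
  rw [isToeplitzValue_iff, hval, mulVec_mem_strictBdry_iff K.U_mem K.V_mem K.V_mul_U]
  refine forall_congr' fun i => ?_
  have hq : bpoly (W.q i) * ((DP.map boundary).mulVec (inclVec f)
      - (K.V.map boundary).mulVec (inclVec g)) i
      = (K.A.map boundary).mulVec (inclVec f) i - (K.B.map boundary).mulVec (inclVec g) i := by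
    rw [K.B_mulVec, K.A_eq', ← hDP, ← mulVec_mulVec_boundary, diagonal_mulVec_boundary,
      Pi.sub_apply, mul_sub]
  have hA := integrable_mulVec_inclVec K.A_mem f i
  have hB := integrable_mulVec_inclVec K.B_mem g i
  obtain ⟨h₁, hh₁⟩ := exists_split_mulVec K.A_mem f i
  obtain ⟨h₂, hh₂⟩ := exists_split_mulVec K.B_mem g i
  -- Multiplication by `q_i` turns the possibly non-integrable component of `D Ω₊ f - V g` into the
  -- integrable `(A f - B g)_i`, and strict properness into vanishing of the coefficients from `deg
  -- q_i` on.
  rw [mem_strictBdry_iff_degLT (W.q_ne_zero i) (norm_le_one_of_q_root W i)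
    (by rw [hq]; exact integrable_aesub hA hB) (h := h₁ - h₂)
    (by rw [hq, map_sub]; convert sub_mem hh₁ hh₂ using 1; ring), hq]
  constructor
  · intro h n hn
    have := h.2 n hn
    rwa [fourierCoeff_aesub hA hB, sub_eq_zero] at this
  · exact fun h => ⟨integrable_aesub hA hB, fun n hn => by
      rw [fourierCoeff_aesub hA hB, h n hn, sub_self]⟩

/-- The entries of `A` and `B` are bounded multipliers, so each coefficient equation defines a
closed subset of the product, and the graph is their intersection. -/
theorem isClosed_toeplitz (K : W.CircleFactorization) : (toeplitz p Ω).IsClosed := by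
  choose LA hLA using fun i n => exists_coeff_mulVec p K.A_mem i n
  choose LB hLB using fun i n => exists_coeff_mulVec p K.B_mem i n
  have : ((toeplitz p Ω).graph : Set ((Fin m → Hp p) × (Fin m → Hp p))) =
      ⋂ (i : Fin m) (n : ℤ) (_ : ((W.q i).natDegree : ℤ) ≤ n),
        {x | LA i n x.1 = LB i n x.2} := by
    ext ⟨f, g⟩
    rw [SetLike.mem_coe, mem_toeplitz_graph_iff, K.isToeplitzValue_iff_coeff]
    simp only [Set.mem_iInter, Set.mem_ofPred_eq, hLA, hLB]
  rw [LinearPMap.IsClosed, this]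
  exact isClosed_iInter fun i => isClosed_iInter fun n => isClosed_iInter fun _ =>
    isClosed_eq ((LA i n).continuous.comp continuous_fst) ((LB i n).continuous.comp continuous_snd)

/-- Solution of `A f = B g` modulo low-degree terms, in one component. -/
theorem exists_component_solution (hW : W.SpecialForm) (hz : NoZerosOnCircle Ω) (i : Fin m)
    (g : Fin m → Hp p) (hg : ∀ n : ℤ, ((W.q i).natDegree : ℤ) ≤ n → n < (W.kk i : ℤ) - W.k →
      fourierCoeff ((K.B.map boundary).mulVec (inclVec g) i) n = 0) :
    ∃ F : Hp p, ∀ n : ℤ, ((W.q i).natDegree : ℤ) ≤ n →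
      fourierCoeff (boundary (RatFunc.X⁻¹ ^ W.k * algebraMap ℂ[X] (RatFunc ℂ) (W.num i i))
        * incl p F : BoundaryFun) n
      = fourierCoeff ((K.B.map boundary).mulVec (inclVec g) i) n := by
  obtain ⟨c, hc, hnum⟩ := W.num_diag_eq hW hz i
  have hB := integrable_mulVec_inclVec K.B_mem g i
  obtain ⟨h, hh⟩ := exists_split_mulVec K.B_mem g i
  have hcoef : ∀ n : ℤ, 0 ≤ n → fourierCoeff ((K.B.map boundary).mulVec (inclVec g) i) n
      = fourierCoeff (incl p h) n := by
    intro n hn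
    have hσi := integrable_aesub hB (analytic_incl h).1
    obtain ⟨ρ, hρ, he⟩ := mem_strictBdry.1 hh
    have h0 : fourierCoeff ((K.B.map boundary).mulVec (inclVec g) i - incl p h : BoundaryFun) n
        = 0 := by
      rw [← he] at hσi ⊢
      exact (degLT_boundary hρ hσi).2 n hn
    rwa [fourierCoeff_aesub hB (analytic_incl h).1, sub_eq_zero] at h0
  -- Coefficients below `e` may be discarded: those below `deg q_i` are unconstrained, the others
  -- vanish by `hg`. The truncated subtraction does no harm, since it is only used as a lower bound
  -- on `e`.
  obtain ⟨e, he⟩ : ∃ e : ℕ, e = max (W.q i).natDegree (W.kk i - W.k) := ⟨_, rfl⟩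
  let u : ℂ[X] := ∑ a ∈ Finset.range e, monomial a (fourierCoeff (incl p h) a)
  have hu : ∀ a : ℕ, u.coeff a = if a < e then fourierCoeff (incl p h) a else 0 := fun a => by
    simp only [u, finsetSum_coeff, coeff_monomial, Finset.sum_ite_eq', Finset.mem_range]
  have hy : ∀ n : ℤ, fourierCoeff (incl p h - bpoly u : BoundaryFun) n
      = if n < e then 0 else fourierCoeff (incl p h) n := by
    intro n
    rw [fourierCoeff_aesub (analytic_incl h).1 (integrable_bpoly u), fourierCoeff_bpoly]
    split_ifs with h1 h2 h2
    · rw [(analytic_incl h).2 n h1, sub_zero]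
    · omega
    · rw [hu, if_pos (by omega), Int.toNat_of_nonneg (by omega), sub_self]
    · rw [hu, if_neg (by omega), sub_zero]
  have hne : algebraMap ℂ[X] (RatFunc ℂ) (W.num i i) ≠ 0 :=
    algebraMap_ne_zero (W.num_diag_ne_zero i)
  have hr : algebraMap ℂ[X] (RatFunc ℂ) (X ^ W.k) / algebraMap ℂ[X] (RatFunc ℂ) (W.num i i)
      ∈ polesIn {z | ‖z‖ ≠ 1} := div_mem_polesIn _ fun z hzr => by
    rw [hnum] at hzr
    have : z = 0 ∧ W.kk i ≠ 0 := by simpa [hc] using hzr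
    simp [this.1]
  have hyL : incl p h - bpoly u ∈ Lp ℂ p circleMeasure :=
    sub_mem h.1.2 (boundary_mem_Lp (algebraMap_mem_polesIn _ u))
  obtain ⟨x, hx⟩ : ∃ x, x = boundary (algebraMap ℂ[X] (RatFunc ℂ) (X ^ W.k) /
    algebraMap ℂ[X] (RatFunc ℂ) (W.num i i)) * (incl p h - bpoly u) := ⟨_, rfl⟩
  have hxL : x ∈ Lp ℂ p circleMeasure := hx ▸ boundary_mul_mem_Lp hr hyL
  have hxm : bpoly (C c) * (bpoly (X ^ W.kk i) * x) = bpoly (X ^ W.k) * (incl p h - bpoly u) := by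
    rw [← mul_assoc, ← bpoly_mul, ← hnum, hx, ← mul_assoc, bpoly, ← map_mul,
      mul_div_cancel₀ _ hne]
  -- From `c z^{k_i} x = z^k (h - u)`, the `n`-th coefficient of `x` is a multiple of that of `h -
  -- u` at `n + k_i - k`, which is below `e` when `n < 0`.
  have hxa : ∀ n < 0, fourierCoeff x n = 0 := by
    intro n hn
    have h1 := congrArg (fun y : BoundaryFun => fourierCoeff y (n + W.kk i)) hxm
    simp only [fourierCoeff_bpoly_C_mul, fourierCoeff_X_pow_mul, add_sub_cancel_right] at h1
    rw [hy, if_pos (by omega)] at h1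
    exact (mul_eq_zero.1 h1).resolve_left hc
  obtain ⟨F, hF⟩ := exists_incl_eq hxL ⟨integrable_of_mem_Lp hxL, hxa⟩
  refine ⟨F, fun n hn => ?_⟩
  have hback : boundary (RatFunc.X⁻¹ ^ W.k * algebraMap ℂ[X] (RatFunc ℂ) (W.num i i))
      * incl p F = incl p h - bpoly u := by
    rw [hF, hx, ← mul_assoc, ← map_mul, map_pow, RatFunc.algebraMap_X, mul_assoc,
      mul_div_cancel₀ _ hne, inv_pow, inv_mul_cancel₀ (pow_ne_zero _ RatFunc.X_ne_zero), map_one,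
      one_mul]
  rw [hback, hy]
  split_ifs with hlt
  · exact (hg n hn (by omega)).symm
  · exact (hcoef n (by omega)).symm

/-- The range of `T_Ω` is given by finitely many Fourier coefficients. -/
theorem mem_opRan_iff_coeff (hW : W.SpecialForm) (hz : NoZerosOnCircle Ω) (g : Fin m → Hp p) :
    g ∈ opRan (toeplitz p Ω) ↔
      ∀ i, ∀ n : ℤ, ((W.q i).natDegree : ℤ) ≤ n → n < (W.kk i : ℤ) - W.k →
        fourierCoeff ((K.B.map boundary).mulVec (inclVec g) i) n = 0 := by
  rw [mem_opRan_iff]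
  simp only [mem_toeplitz_graph_iff, K.isToeplitzValue_iff_coeff]
  constructor
  · rintro ⟨f, hf⟩ i n hn hlt
    rw [← hf i n hn]
    obtain ⟨c, hc, hnum⟩ := W.num_diag_eq hW hz i
    -- Since `z^k (A f)_i = c z^{k_i} (Ω₊ f)_i`, the `n`-th coefficient of `(A f)_i` is `c` times
    -- that of `(Ω₊ f)_i` at `n + k - k_i < 0`.
    have h1 := congrArg (fun y : BoundaryFun => fourierCoeff y (n + W.k))
      (K.X_pow_mul_A_mulVec f i)
    simp only [hnum, bpoly_mul, mul_assoc, fourierCoeff_bpoly_C_mul, fourierCoeff_X_pow_mul,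
      add_sub_cancel_right] at h1
    rw [h1, (analytic_incl _).2 _ (by omega), mul_zero]
  · intro hg
    choose F hF using fun i => K.exists_component_solution hW hz i g (hg i)
    -- The components of `Ω₊ f` can be prescribed independently, with `f = Ω₊⁻¹ F`.
    refine ⟨plusMul W.plus_inv_isPlus F, fun i n hn => ?_⟩
    rw [A_mulVec, plusMul_plusMul W.plus_isPlus W.plus_inv_isPlus W.plus_mul_inv, hF i n hn]

/-- Prescribed values of the Fourier coefficients that determine the range. -/
theorem exists_coeff_eq (p : ℝ≥0∞) [Fact (1 ≤ p)] (y : Fin m → ℂ[X]) : ∃ g : Fin m → Hp p,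
    ∀ i, ∀ n : ℕ, (W.q i).natDegree ≤ n →
      fourierCoeff ((K.B.map boundary).mulVec (inclVec g) i) n = (y i).coeff n := by
  let x : Fin m → RatFunc ℂ := fun i =>
    algebraMap ℂ[X] (RatFunc ℂ) (y i) / algebraMap ℂ[X] (RatFunc ℂ) (W.q i)
  -- Formally `B g = y` is solved by `U (y / q)`. Its `H^p` part differs from it by a strictly
  -- proper `σ`, which changes `(B g)_i` by `q_i (V σ)_i` only, and this has no coefficients of
  -- index `≥ deg q_i`.
  choose g hg using fun i => exists_split_boundary p (K.U.mulVec x i)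
  obtain ⟨σ, hσ⟩ : ∃ σ : Fin m → BoundaryFun,
      σ = boundary ∘ K.U.mulVec x - inclVec g := ⟨_, rfl⟩
  have hσs : ∀ i, σ i ∈ strictBdry := fun i => by rw [hσ]; exact hg i
  have hVg : (K.V.map boundary).mulVec (inclVec g)
      = boundary ∘ x - (K.V.map boundary).mulVec σ := by
    have h1 : boundary ∘ K.U.mulVec x = (K.U.map boundary).mulVec (boundary ∘ x) :=
      funext fun i => boundary.map_mulVec K.U x i
    rw [hσ, Matrix.mulVec_sub, h1, mulVec_mulVec_boundary, K.V_mul_U,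
      Matrix.map_one _ (map_zero _) (map_one _), Matrix.one_mulVec, sub_sub_cancel]
  refine ⟨g, fun i n hn => ?_⟩
  have hB := integrable_mulVec_inclVec K.B_mem g i
  have hBg : (K.B.map boundary).mulVec (inclVec g) i
      = bpoly (y i) - bpoly (W.q i) * (K.V.map boundary).mulVec σ i := by
    rw [K.B_mulVec, hVg, Pi.sub_apply, mul_sub, Function.comp_apply, bpoly, ← map_mul,
      mul_div_cancel₀ _ (algebraMap_ne_zero (W.q_ne_zero i))]
  obtain ⟨ρ, hρ, he⟩ := mem_strictBdry.1 (mulVec_mem_strictBdry K.V_mem hσs i)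
  rw [← he] at hBg
  have hi : Integrable (bpoly (W.q i) * boundary ρ : BoundaryFun) circleMeasure := by
    rw [show bpoly (W.q i) * boundary ρ
      = bpoly (y i) - (K.B.map boundary).mulVec (inclVec g) i by rw [hBg]; ring]
    exact integrable_aesub (integrable_bpoly _) hB
  rw [hBg, fourierCoeff_aesub (integrable_bpoly _) hi,
    (degLT_of_mem_strictDisk hρ (W.q_ne_zero i) hi).2 n (by exact_mod_cast hn), sub_zero,
    fourierCoeff_bpoly, if_neg (by omega), Int.toNat_natCast]

/-- The range of `T_Ω` is the kernel of a continuous surjection onto a finite-dimensional space. -/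
theorem exists_range_functional (K : W.CircleFactorization) (hW : W.SpecialForm) (hz : NoZerosOnCircle Ω) :
    ∃ Φ : (Fin m → Hp p) →L[ℂ]
        ((Σ i : Fin m, Fin ((W.kk i : ℤ) - (W.q i).natDegree - W.k).toNat) → ℂ),
      Function.Surjective Φ ∧ LinearMap.ker Φ.toLinearMap = opRan (toeplitz p Ω) := by
  choose L hL using fun i n => exists_coeff_mulVec p K.B_mem i n
  -- The index set enumerates the `n` with `deg q_i ≤ n < k_i - k` as `n = deg q_i + s`; `toNat`
  -- leaves no `s` when this interval is empty.
  refine ⟨ContinuousLinearMap.pi fun s => L s.1 (((W.q s.1).natDegree + s.2 : ℕ) : ℤ), ?_, ?_⟩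
  · intro t
    obtain ⟨g, hg⟩ := K.exists_coeff_eq p fun i =>
      ∑ s : Fin ((W.kk i : ℤ) - (W.q i).natDegree - W.k).toNat,
        monomial ((W.q i).natDegree + (s : ℕ)) (t ⟨i, s⟩)
    refine ⟨g, funext fun ⟨i, s⟩ => ?_⟩
    rw [ContinuousLinearMap.pi_apply, hL, hg i _ (Nat.le_add_right _ _), finsetSum_coeff]
    simp only [coeff_monomial, add_right_inj, Fin.val_inj, Finset.sum_ite_eq', Finset.mem_univ,
      if_true]
  · ext g
    rw [K.mem_opRan_iff_coeff hW hz, LinearMap.mem_ker]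
    have h1 : (∀ s : (Σ i : Fin m, Fin ((W.kk i : ℤ) - (W.q i).natDegree - W.k).toNat),
        L s.1 (((W.q s.1).natDegree + s.2 : ℕ) : ℤ) g = 0) ↔ ∀ i, ∀ n : ℤ,
        ((W.q i).natDegree : ℤ) ≤ n → n < (W.kk i : ℤ) - W.k →
        fourierCoeff ((K.B.map boundary).mulVec (inclVec g) i) n = 0 := by
      constructor
      · intro h i n hn hlt
        have := h ⟨i, ⟨(n - (W.q i).natDegree).toNat, by omega⟩⟩
        rw [hL] at this
        rw [← this]
        congr 1
        push_cast
        omega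
      · rintro h ⟨i, s⟩
        rw [hL]
        have hs : (s : ℕ) < ((W.kk i : ℤ) - (W.q i).natDegree - W.k).toNat := s.2
        exact h i _ (by push_cast; omega) (by push_cast; omega)
    rw [← h1]
    exact funext_iff

end WienerHopfFactorization.CircleFactorization

/-! ### The Fredholm property and the codimension of the range. -/

namespace WienerHopfFactorization

variable {p : ℝ≥0∞} [Fact (1 ≤ p)] {m : ℕ} {Ω : Matrix (Fin m) (Fin m) (RatFunc ℂ)}
  (W : WienerHopfFactorization Ω)

/-- As the kernel of a continuous surjection onto a finite-dimensional coordinate space, the range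
is closed, and its codimension is the number of coordinates. -/
theorem isFredholm_toeplitz (hp : p ≠ ∞) (hW : W.SpecialForm) (hz : NoZerosOnCircle Ω) :
    IsFredholm (E := Fin m → Hp p) (F := Fin m → Hp p) (toeplitz p Ω) ∧
    (Module.finrank ℂ ((Fin m → Hp p) ⧸ opRan (toeplitz p Ω)) : ℤ)
      = ∑ j, max ((W.kk j : ℤ) - (W.q j).natDegree - W.k) 0 := by
  obtain ⟨K⟩ := W.nonempty_circleFactorization hW hz
  obtain ⟨Φ, hΦ, hker⟩ := K.exists_range_functional (p := p) hW hz
  have e := LinearMap.quotKerEquivOfSurjective Φ.toLinearMap hΦ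
  rw [hker] at e
  refine ⟨⟨dense_toeplitz_domain hp Ω, K.isClosed_toeplitz, (W.finiteDimensional_opKer hW).1, ?_,
    e.symm.finiteDimensional⟩, ?_⟩
  · rw [← hker]
    exact Φ.isClosed_ker
  · rw [e.finrank_eq, Module.finrank_fintype_fun_eq_card, Fintype.card_sigma]
    push_cast
    simp only [Fintype.card_fin, Int.toNat_eq_max]

end WienerHopfFactorization

end RatToeplitz

theorem theorem1p4 (p : ℝ≥0∞) [Fact (1 ≤ p)] (hp_one : 1 < p) (hp_top : p ≠ ∞) (m : ℕ)
    (Ω : Matrix (Fin m) (Fin m) (RatFunc ℂ)) (W : RatToeplitz.WienerHopfFactorization Ω)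
    (hW : W.SpecialForm) :
    (FiniteDimensional ℂ (RatToeplitz.opKer (RatToeplitz.toeplitz p Ω)) ∧
      (Module.finrank ℂ (RatToeplitz.opKer (RatToeplitz.toeplitz p Ω)) : ℤ)
        = ∑ j, max ((W.k : ℤ) + (W.q j).natDegree - W.kk j) 0) ∧
    RatToeplitz.opKer (RatToeplitz.toeplitz p W.middle)
      = Submodule.pi Set.univ
          (fun j => RatToeplitz.polySpace p ((W.k : ℤ) + (W.q j).natDegree - W.kk j - 1)) ∧
    (RatToeplitz.NoZerosOnCircle Ω →
      RatToeplitz.IsFredholm (E := Fin m → RatToeplitz.Hp p) (F := Fin m → RatToeplitz.Hp p)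
        (RatToeplitz.toeplitz p Ω) ∧
      (Module.finrank ℂ ((Fin m → RatToeplitz.Hp p) ⧸
          RatToeplitz.opRan (RatToeplitz.toeplitz p Ω)) : ℤ)
        = ∑ j, max ((W.kk j : ℤ) - (W.q j).natDegree - W.k) 0) := by
  refine ⟨W.finiteDimensional_opKer hW, W.opKer_middle hW, fun hz => ?_⟩
  exact W.isFredholm_toeplitz hp_top hW hz
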